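/- Let $d\in\{1,2,3\}$, $\mu\in\mathbb{R}$, and let $V\in L^p(\mathbb{R}^d)$ be real-valued and reflection-symmetric, $V(x)=V(-x)$, where $p=1$ if $d=1$, $1<p<\infty$ if $d=2$, and $p=3/2$ if $d=3$. For $T>0$ let $$K_T=\frac{-\nabla^2-\mu}{\tanh\left(\frac{-\nabla^2-\mu}{2T}\right)},$$ i.e. multiplication by $\frac{q^2-\mu}{\tanh((q^2-\mu)/(2T))}$ in Fourier space (with value $2T$ where $q^2=\mu$), and let $K_T+V$ be the self-adjoint operator on $L^2_{\rm sym}(\mathbb{R}^d)$, the reflection-symmetric complex-valued functions in $L^2(\mathbb{R}^d)$, that is defined through its quadratic form on the form domain of $K_T$ in $L^2_{\rm sym}(\mathbb{R}^d)$. Suppose that $T_c>0$ is the critical temperature, i.e. that $0$ is the lowest eigenvalue of $K_{T_c}+V$, and that this eigenvalue is non-degenerate. Let $\alpha_0$ be a corresponding eigenfunction. Then $$e^{\kappa|x|}\sqrt{|V|}\,\alpha_0\in L^2(\mathbb{R}^d)\qquad\text{for every real } \kappa<\kappa_c:=\operatorname{Im}\sqrt{\mu+i\pi T_c},$$ where $\sqrt{\,\cdot\,}$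 is the principal square root (so that $\kappa_c>0$). -/

import Mathlib

open MeasureTheory
open scoped ENNReal FourierTransform ComplexConjugate

noncomputable section

namespace BCS

/-- The symbol of `K_T`, as a function of the kinetic energy `s`, the spectral variable of the
negative Laplacian: `(s - μ) / tanh ((s - μ) / (2 T))`, extended by continuity by the value `2 T`
at `s = μ`. -/
def symbolOfEnergy (μ T s : ℝ) : ℝ :=
  if s = μ then 2 * T else (s - μ) / Real.tanh ((s - μ) / (2 * T))

/-- The Fourier symbol of `K_T` on `ℝ^d`. Mathlib's Fourier transform uses the phase
`exp (-2 π i ⟪x, ξ⟫)`, so the negative Laplacian is multiplication by `(2 π ‖ξ‖) ^ 2`. -/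
def symbol {d : ℕ} (μ T : ℝ) (ξ : EuclideanSpace ℝ (Fin d)) : ℝ :=
  symbolOfEnergy μ T ((2 * Real.pi * ‖ξ‖) ^ 2)

/-- The admissible pairs of a dimension `d` and an integrability exponent `p` of the
potential. -/
def AdmissibleExponent (d : ℕ) (p : ℝ≥0∞) : Prop :=
  (d = 1 ∧ p = 1) ∨ (d = 2 ∧ 1 < p ∧ p < ⊤) ∨ (d = 3 ∧ p = 3 / 2)

/-- The space of reflection-symmetric square-integrable functions, as a set of (classes of)
functions in `L²(ℝ^d; ℂ)`. -/
def L2sym (d : ℕ) : Set (Lp ℂ 2 (volume : Measure (EuclideanSpace ℝ (Fin d)))) :=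
  {ψ | ∀ᵐ x, ψ (-x) = ψ x}

/-- The form domain of `K_T` on the reflection-symmetric functions: those `ψ` for which
`∫ K_T(ξ) |ψ̂(ξ)|² dξ` is finite. For potentials in the admissible `L^p` class, which are
infinitesimally form-bounded, this is also the form domain of `K_T + V`. -/
def formDomain (d : ℕ) (μ T : ℝ) :
    Set (Lp ℂ 2 (volume : Measure (EuclideanSpace ℝ (Fin d)))) :=
  {ψ | ψ ∈ L2sym d ∧ Integrable (fun ξ => symbol μ T ξ * ‖(𝓕 ψ) ξ‖ ^ 2)}

/-- The sesquilinear form `⟨φ | K_T + V | ψ⟩`, antilinear in the first argument. -/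
def form {d : ℕ} (μ T : ℝ) (V : EuclideanSpace ℝ (Fin d) → ℝ)
    (φ ψ : Lp ℂ 2 (volume : Measure (EuclideanSpace ℝ (Fin d)))) : ℂ :=
  (∫ ξ, (symbol μ T ξ : ℂ) * (conj ((𝓕 φ) ξ) * (𝓕 ψ) ξ)) +
    ∫ x, (V x : ℂ) * (conj (φ x) * ψ x)

/-- The graph of the self-adjoint operator `K_T + V` on the reflection-symmetric functions, defined
through its quadratic form: `ψ` lies in the operator domain and `(K_T + V) ψ = f` if `ψ` is in the
form domain, `f` is a reflection-symmetric `L²` function, and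
`⟨φ | K_T + V | ψ⟩ = ⟨φ | f⟩` for all `φ` in the form domain. -/
def OperatorGraph {d : ℕ} (μ T : ℝ) (V : EuclideanSpace ℝ (Fin d) → ℝ)
    (ψ f : Lp ℂ 2 (volume : Measure (EuclideanSpace ℝ (Fin d)))) : Prop :=
  ψ ∈ formDomain d μ T ∧ f ∈ L2sym d ∧
    ∀ φ ∈ formDomain d μ T, form μ T V φ ψ = inner ℂ φ f

/-- `ψ` is an eigenfunction of `K_T + V` with eigenvalue `E`. -/
def IsEigenfunction {d : ℕ} (μ T : ℝ) (V : EuclideanSpace ℝ (Fin d) → ℝ) (E : ℝ)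
    (ψ : Lp ℂ 2 (volume : Measure (EuclideanSpace ℝ (Fin d)))) : Prop :=
  ψ ≠ 0 ∧ OperatorGraph μ T V ψ ((E : ℂ) • ψ)

/-- `T` is the critical temperature: `T > 0`, and `K_T + V` has `0` as its lowest eigenvalue.
(As `K_T` is strictly increasing in `T`, there is at most one such `T`.) -/
def IsCriticalTemperature {d : ℕ} (μ : ℝ) (V : EuclideanSpace ℝ (Fin d) → ℝ) (T : ℝ) : Prop :=
  0 < T ∧ IsLeast {E : ℝ | ∃ ψ, IsEigenfunction μ T V E ψ} 0

/-- The eigenvalue `E` of `K_T + V` is non-degenerate: any two eigenfunctions are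
proportional. -/
def IsNondegenerate {d : ℕ} (μ T : ℝ) (V : EuclideanSpace ℝ (Fin d) → ℝ) (E : ℝ) : Prop :=
  ∀ ψ φ, IsEigenfunction μ T V E ψ → IsEigenfunction μ T V E φ → ∃ c : ℂ, φ = c • ψ

/-- `κ_c = Im √(μ + i π T)`, with the principal branch of the square root. -/
def criticalRate (μ T : ℝ) : ℝ :=
  (Complex.sqrt ((μ : ℂ) + Complex.I * Real.pi * T)).im

end BCS

end

/-!
The eigenvalue equation says `α = -K_T⁻¹ V α`, so `√|V| α` decays exponentially as soon as the
convolution kernel of `K_T⁻¹` does, provided that the part of the equation that lives far from the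
origin can be absorbed. The threshold `Im √(μ + i π T)` is the distance of the singularities of
`1 / K_T` from the real momenta.

*The kernel.* The partial fractions of `tanh` give
`1 / K_T(p) = ∑ₖ 4 T / |p² - σₖ²|²` with `σₖ² = μ + i ωₖ` and `ωₖ = (2 k + 1) π T`
(`hasSum_inv_symbolOfEnergy`). Each summand is a product of two complex conjugate resolvents. Both
are integrals of the heat semigroup along a ray of complex times, and the direction `i yₖ / σₖ`,
`yₖ = Im σₖ`, turns the integrands into heat kernels that are dominated by heat kernels at real
times with the factor `exp (-t yₖ²)` (`enorm_integral_resolvent_pair_le`). So, in every dimension and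
without Bessel functions, the kernel of `1 / |p² - σₖ²|²` is bounded by a multiple of the positive
kernel of `(yₖ² - Δ)⁻²`. The sum over `k` of these is `bcsKernel`
(`exists_enorm_integral_inv_symbol_le`).

*The weight.* For `κ < y₀ = criticalRate μ T`, completing a square in the heat kernel bounds
`exp (κ |x|)` times `bcsKernel` by the sum of the kernels of `m ^ (d / 2) (yₖ² - κ y₀ - m Δ)⁻²`,
with `m = (1 - κ / y₀)⁻¹`. Since `yₖ²` grows linearly in `k`, the Fourier multiplier of the sum is at
most a multiple of `1 / (1 + |ξ|²)` (`exists_weighted_kernel`). By the Sobolev inequality and duality,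
`√|W| M √|W'|` is bounded on `L²` for this kernel `M`, with squared norm at most
a multiple of `‖W‖ₚ ‖W'‖ₚ` (`exists_weighted_form_bound`).

*The equation.* Testing the form equation with `φ = K_T⁻¹ h` for even `h` gives
`|α| ≤ C bcsKernel ∗ (|V| |α|)` almost everywhere (`exists_enorm_eigenfunction_le`).

*Absorption.* Multiply this inequality by `√|V|` and a bounded weight `exp (κ min (|x|, n))`. The
part of the weighted function outside of a large ball is controlled by itself, with the small factor
`‖V 1_{|x| > R}‖ₚ`, and by the part inside of the ball, which is bounded uniformly in `n`. As the
weighted function is square-integrable for fixed `n`, the former contribution can be absorbed;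
monotone convergence `n → ∞` concludes (`lintegral_weighted_ne_top`).
-/

set_option linter.unusedSectionVars false

namespace BCS

/-! ### The Fourier transform on `L²` -/

section FourierL2

variable {E : Type*} [NormedAddCommGroup E] [InnerProductSpace ℝ E] [FiniteDimensional ℝ E]
  [MeasurableSpace E] [BorelSpace E]

lemma integral_fourier_mul_eq_flip {f g : E → ℂ} (hf : Integrable f) (hg : Integrable g) :
    ∫ ξ, 𝓕 f ξ * g ξ = ∫ x, f x * 𝓕 g x := by
  simpa using! VectorFourier.integral_fourierIntegral_smul_eq_flip (L := innerₗ E)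
    Real.continuous_fourierChar continuous_inner hf hg

lemma continuous_fourier {f : E → ℂ} (hf : Integrable f) : Continuous (𝓕 f) :=
  VectorFourier.fourierIntegral_continuous Real.continuous_fourierChar
    (by exact continuous_inner) hf

lemma norm_fourier_le (f : E → ℂ) (ξ : E) : ‖𝓕 f ξ‖ ≤ ∫ x, ‖f x‖ :=
  VectorFourier.norm_fourierIntegral_le_integral_norm _ _ _ _ _

/-- The Fourier transform of `L²` agrees with the one of tempered distributions. -/
lemma integral_schwartz_mul_fourier (u : Lp ℂ 2 (volume : Measure E)) (g : SchwartzMap E ℂ) :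
    ∫ x, g x * (𝓕 u) x = ∫ x, (𝓕 g) x * u x := by
  have h := congrArg (fun T => T g) (Lp.fourier_toTemperedDistribution_eq u)
  simpa [Lp.toTemperedDistribution_apply] using h.symm

lemma ae_eq_of_integral_schwartz_mul_eq {u v : E → ℂ} (hu : LocallyIntegrable u)
    (hv : LocallyIntegrable v)
    (h : ∀ g : SchwartzMap E ℂ, ∫ x, g x * u x = ∫ x, g x * v x) : u =ᵐ[volume] v := by
  refine ae_eq_of_integral_contDiff_smul_eq hu hv fun g hg hc => ?_
  have hg₁ : HasCompactSupport (Complex.ofRealCLM ∘ g) := hc.comp_left rfl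
  have hg₂ := Complex.ofRealCLM.contDiff.comp hg
  simpa [Complex.real_smul] using h (hg₁.toSchwartzMap hg₂)

/-- On `L¹ ∩ L²` the Fourier transform of `L²` is given by the Fourier integral. -/
lemma fourier_toLp_ae_eq {f : E → ℂ} (h1 : Integrable f) (h2 : MemLp f 2) :
    ⇑(𝓕 (h2.toLp f) : Lp ℂ 2 (volume : Measure E)) =ᵐ[volume] 𝓕 f := by
  refine ae_eq_of_integral_schwartz_mul_eq ((Lp.memLp _).locallyIntegrable (by norm_num))
    (continuous_fourier h1).locallyIntegrable fun g => ?_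
  rw [integral_schwartz_mul_fourier]
  calc _ = ∫ x, 𝓕 (g : E → ℂ) x * f x := by
        refine integral_congr_ae ?_
        filter_upwards [h2.coeFn_toLp] with x hx
        rw [hx, SchwartzMap.fourier_coe]
    _ = _ := integral_fourier_mul_eq_flip g.integrable h1

/-- On `L¹ ∩ L²` the inverse Fourier transform of `L²` is given by the inverse Fourier
integral. -/
lemma fourierInv_toLp_ae_eq {f : E → ℂ} (h1 : Integrable f) (h2 : MemLp f 2) :
    ⇑(𝓕⁻ (h2.toLp f) : Lp ℂ 2 (volume : Measure E)) =ᵐ[volume] 𝓕⁻ f := by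
  have hF : 𝓕⁻ f = fun x => 𝓕 f (-x) := funext fun x => Real.fourierInv_eq_fourier_neg f x
  refine ae_eq_of_integral_schwartz_mul_eq ((Lp.memLp _).locallyIntegrable (by norm_num))
    ?_ fun g => ?_
  · rw [hF]; exact ((continuous_fourier h1).comp continuous_neg).locallyIntegrable
  have key := integral_schwartz_mul_fourier (𝓕⁻ (h2.toLp f)) (𝓕⁻ g)
  simp only [FourierTransform.fourier_fourierInv_eq] at key
  rw [← key, hF]
  have h3 : ∀ x, (𝓕⁻ g) x = 𝓕 (g : E → ℂ) (-x) := fun x => by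
    rw [SchwartzMap.fourierInv_coe, Real.fourierInv_eq_fourier_neg]
  calc _ = ∫ x, 𝓕 (g : E → ℂ) (-x) * f x := by
        refine integral_congr_ae ?_
        filter_upwards [h2.coeFn_toLp] with x hx
        rw [hx, h3]
    _ = ∫ x, 𝓕 (g : E → ℂ) x * f (-x) := by
        rw [← integral_neg_eq_self]; simp
    _ = ∫ x, g x * 𝓕 (fun y => f (-y)) x :=
        integral_fourier_mul_eq_flip g.integrable h1.comp_neg
    _ = _ := by
        congr 1; ext x
        have := Real.fourierInv_eq_fourier_comp_neg f
        rw [hF] at this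
        rw [← congrFun this x]

/-- A square-integrable function is even as soon as its Fourier transform is. -/
lemma even_of_fourier_even (u : Lp ℂ 2 (volume : Measure E))
    (h : ∀ᵐ ξ, (𝓕 u) (-ξ) = (𝓕 u) ξ) : ∀ᵐ x, u (-x) = u x := by
  have hl : LocallyIntegrable (u : E → ℂ) := (Lp.memLp _).locallyIntegrable (by norm_num)
  refine ae_eq_of_integral_schwartz_mul_eq (u := fun x => u (-x)) ?_ hl fun g => ?_
  · exact ((Lp.memLp u).comp_measurePreserving
      (Measure.measurePreserving_neg volume)).locallyIntegrable (by norm_num)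
  have key := fun g : SchwartzMap E ℂ => integral_schwartz_mul_fourier u (𝓕⁻ g)
  simp only [FourierTransform.fourier_fourierInv_eq] at key
  have h3 : ∀ x, (𝓕⁻ g) x = 𝓕 (g : E → ℂ) (-x) := fun x => by
    rw [SchwartzMap.fourierInv_coe, Real.fourierInv_eq_fourier_neg]
  let g' : SchwartzMap E ℂ :=
    SchwartzMap.compCLMOfContinuousLinearEquiv ℂ (ContinuousLinearEquiv.neg ℝ) g
  have hg' : ∀ x, g' x = g (-x) := fun x => rfl
  have h4 : ∀ x, (𝓕⁻ g') x = (𝓕⁻ g) (-x) := fun x => by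
    rw [h3, SchwartzMap.fourierInv_coe, Real.fourierInv_eq_fourier_comp_neg, neg_neg]
    simp only [hg', neg_neg]
  calc ∫ x, g x * u (-x) = ∫ x, g' x * u x := by
        rw [← integral_neg_eq_self]; simp [hg']
    _ = ∫ x, (𝓕⁻ g) (-x) * (𝓕 u) (-x) := by
        rw [← key g']
        refine integral_congr_ae ?_
        filter_upwards [h] with x hx
        rw [hx, h4]
    _ = ∫ x, (𝓕⁻ g) x * (𝓕 u) x := integral_neg_eq_self (fun x => (𝓕⁻ g) x * (𝓕 u) x) volume
    _ = _ := key g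

lemma lintegral_enorm_fourier_sq (u : Lp ℂ 2 (volume : Measure E)) :
    ∫⁻ ξ, ‖(𝓕 u) ξ‖ₑ ^ 2 = ∫⁻ x, ‖u x‖ₑ ^ 2 := by
  have h : ∀ v : Lp ℂ 2 (volume : Measure E), ∫⁻ ξ, ‖v ξ‖ₑ ^ 2 = ‖v‖ₑ ^ 2 := fun v => by
    rw [Lp.enorm_def, eLpNorm_eq_lintegral_rpow_enorm_toReal (by norm_num) (by norm_num)]
    rw [← ENNReal.rpow_natCast, ← ENNReal.rpow_mul]
    simp
  rw [h, h, ← ofReal_norm, ← ofReal_norm, Lp.norm_fourier_eq]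

lemma integral_conj_fourier_mul (u v : Lp ℂ 2 (volume : Measure E)) :
    ∫ ξ, conj ((𝓕 u) ξ) * (𝓕 v) ξ = ∫ x, conj (u x) * v x := by
  have h := Lp.inner_fourier_eq u v
  rw [L2.inner_def, L2.inner_def] at h
  simpa [mul_comm] using h

end FourierL2

/-! ### Heat kernels at complex times -/

section Heat

variable {E : Type*} [NormedAddCommGroup E] [InnerProductSpace ℝ E] [FiniteDimensional ℝ E]
  [MeasurableSpace E] [BorelSpace E]

/-- The heat kernel at the complex time `w`, `Re w > 0`: the convolution kernel of
`exp (w Δ)`. -/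
noncomputable def heatKernel (w : ℂ) (x : E) : ℂ :=
  (4 * Real.pi * w)⁻¹ ^ (Module.finrank ℝ E / 2 : ℂ) * Complex.exp (-(‖x‖ ^ 2 / (4 * w)))

/-- The quadratic form of `exp (w Δ)`, in momentum space and in position space. -/
lemma integral_gaussian_fourier {w : ℂ} (hw : 0 < w.re) {f g : E → ℂ} (hf : Integrable f)
    (hg : Integrable g) :
    ∫ ξ, Complex.exp (-w * (2 * Real.pi * ‖ξ‖) ^ 2) * (conj (𝓕 g ξ) * 𝓕 f ξ) =
      ∫ x, conj (g x) * ∫ y, heatKernel w (x - y) * f y := by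
  have hw0 : w ≠ 0 := by rintro rfl; simp at hw
  set b : ℂ := 4 * Real.pi ^ 2 * w with hb
  have hbre : 0 < b.re := by
    have : b = ((4 * Real.pi ^ 2 : ℝ) : ℂ) * w := by simp [hb]
    rw [this, Complex.re_ofReal_mul]; positivity
  have hG : Integrable (fun ξ : E => Complex.exp (-b * ‖ξ‖ ^ 2)) := by
    simpa using GaussianFourier.integrable_cexp_neg_mul_sq_norm_add hbre 0 (0 : E)
  have hk : Integrable (fun ξ : E => Complex.exp (-b * ‖ξ‖ ^ 2) * 𝓕 f ξ) :=
    hG.mul_bdd (c := ∫ x, ‖f x‖) (continuous_fourier hf).aestronglyMeasurable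
      (Filter.Eventually.of_forall (norm_fourier_le f))
  have h1 : ∫ ξ, conj (𝓕 g ξ) * (Complex.exp (-b * ‖ξ‖ ^ 2) * 𝓕 f ξ) =
      ∫ x, conj (g x) * 𝓕⁻ (fun ξ : E => Complex.exp (-b * ‖ξ‖ ^ 2) * 𝓕 f ξ) x := by
    have hcg : ∀ ξ, conj (𝓕 g ξ) = 𝓕 (fun x => conj (g x)) (-ξ) := fun ξ => by
      rw [Real.fourier_eq', Real.fourier_eq', ← integral_conj]
      congr 1; ext x
      simp [← Complex.exp_conj, Complex.conj_ofNat]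
    simp_rw [hcg]
    have hcgi : Integrable (fun x => conj (g x)) :=
      (LinearIsometryEquiv.integrable_comp_iff Complex.conjLIE).2 hg
    rw [← integral_neg_eq_self]
    simp only [neg_neg, norm_neg]
    have := integral_fourier_mul_eq_flip hcgi hk.comp_neg
    simp only [norm_neg] at this
    rw [this, Real.fourierInv_eq_fourier_comp_neg]
    simp
  have h2 : ∀ x, 𝓕⁻ (fun ξ : E => Complex.exp (-b * ‖ξ‖ ^ 2) * 𝓕 f ξ) x =
      ∫ y, heatKernel w (x - y) * f y := fun x => by
    have hGx : Integrable (fun ξ : E =>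
        Complex.exp (-b * ‖ξ‖ ^ 2 + 2 * Real.pi * Complex.I * inner ℝ x ξ)) :=
      GaussianFourier.integrable_cexp_neg_mul_sq_norm_add hbre (2 * Real.pi * Complex.I) x
    rw [Real.fourierInv_eq']
    calc _ = ∫ ξ, 𝓕 f ξ * Complex.exp (-b * ‖ξ‖ ^ 2 + 2 * Real.pi * Complex.I * inner ℝ x ξ) := by
          congr 1; ext ξ
          rw [Complex.exp_add, real_inner_comm, smul_eq_mul]
          push_cast
          ring_nf
      _ = _ := by
          rw [integral_fourier_mul_eq_flip hf hGx]
          congr 1; ext y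
          rw [fourier_gaussian_innerProductSpace' hbre, heatKernel, mul_comm]
          have e1 : (Real.pi : ℂ) / b = (4 * Real.pi * w)⁻¹ := by
            rw [hb]; field_simp
          have e2 : -(Real.pi : ℂ) ^ 2 * ‖x - y‖ ^ 2 / b = -(‖x - y‖ ^ 2 / (4 * w)) := by
            rw [hb]; field_simp
          rw [e1, e2]
  simp_rw [h2] at h1
  rw [← h1]
  congr 1; ext ξ
  rw [show -w * (2 * Real.pi * ‖ξ‖ : ℂ) ^ 2 = -b * ‖ξ‖ ^ 2 by rw [hb]; ring]
  ring

end Heat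

/-! ### Heat kernels at real times and positive convolution forms -/

section Kernels

variable {E : Type*} [NormedAddCommGroup E] [InnerProductSpace ℝ E] [FiniteDimensional ℝ E]
  [MeasurableSpace E] [BorelSpace E]

/-- The heat kernel at the real time `t > 0`. -/
noncomputable def realHeatKernel (t : ℝ) (x : E) : ℝ :=
  (4 * Real.pi * t)⁻¹ ^ (Module.finrank ℝ E / 2 : ℝ) * Real.exp (-(‖x‖ ^ 2 / (4 * t)))

lemma realHeatKernel_nonneg {t : ℝ} (ht : 0 < t) (x : E) : 0 ≤ realHeatKernel t x := by
  unfold realHeatKernel; positivity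

lemma heatKernel_ofReal {t : ℝ} (ht : 0 < t) (x : E) :
    heatKernel (t : ℂ) x = (realHeatKernel t x : ℂ) := by
  unfold heatKernel realHeatKernel
  push_cast
  rw [Complex.ofReal_cpow (by positivity)]
  push_cast
  rfl

lemma measurable_realHeatKernel :
    Measurable (fun q : ℝ × E => realHeatKernel q.1 q.2) := by
  unfold realHeatKernel; fun_prop

/-- On the circle `‖c‖² = Re c`, the heat kernel at the complex time `s c + s' c̄` is dominated by
the heat kernel at the real time `s + s'`: there `Re c⁻¹ = 1`, so that the Gaussian does not
widen. -/
lemma norm_heatKernel_le {c : ℂ} {r : ℝ} (hr : 0 < r) (hre : c.re = r) (hn : ‖c‖ ^ 2 = r)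
    {s s' : ℝ} (hs : 0 < s) (hs' : 0 < s') (x : E) :
    ‖heatKernel (s * c + s' * conj c) x‖ ≤
      r ^ (-(Module.finrank ℝ E / 2 : ℝ)) * realHeatKernel (s + s') x := by
  set w : ℂ := s * c + s' * conj c with hw
  set τ := s + s' with hτdef
  have hτ : 0 < τ := by positivity
  have hwre : w.re = τ * r := by simp [hw, hre, hτdef]; ring
  have hwn : ‖w‖ ^ 2 ≤ τ ^ 2 * r := by
    have : ‖w‖ ≤ τ * ‖c‖ := by
      calc ‖w‖ ≤ ‖(s : ℂ) * c‖ + ‖(s' : ℂ) * conj c‖ := norm_add_le _ _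
        _ = τ * ‖c‖ := by
          rw [norm_mul, norm_mul, Complex.norm_conj, Complex.norm_of_nonneg hs.le,
            Complex.norm_of_nonneg hs'.le, hτdef]; ring
    calc ‖w‖ ^ 2 ≤ (τ * ‖c‖) ^ 2 := by gcongr
      _ = τ ^ 2 * r := by rw [mul_pow, hn]
  have hwge : τ * r ≤ ‖w‖ := hwre ▸ Complex.re_le_norm w
  have hwpos : 0 < ‖w‖ := lt_of_lt_of_le (by positivity) hwge
  have hw0 : w ≠ 0 := norm_pos_iff.1 hwpos
  unfold heatKernel realHeatKernel
  rw [norm_mul, ← mul_assoc]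
  have h1 : ‖(4 * Real.pi * w)⁻¹ ^ (Module.finrank ℝ E / 2 : ℂ)‖ ≤
      r ^ (-(Module.finrank ℝ E / 2 : ℝ)) * (4 * Real.pi * τ)⁻¹ ^ (Module.finrank ℝ E / 2 : ℝ) := by
    have : (Module.finrank ℝ E / 2 : ℂ) = ((Module.finrank ℝ E / 2 : ℝ) : ℂ) := by push_cast; rfl
    rw [this, Complex.norm_cpow_real, Real.rpow_neg hr.le, ← Real.inv_rpow hr.le,
      ← Real.mul_rpow (by positivity) (by positivity)]
    refine Real.rpow_le_rpow (by positivity) ?_ (by positivity)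
    rw [norm_inv, norm_mul, norm_mul, Complex.norm_of_nonneg Real.pi_pos.le, ← mul_inv]
    refine inv_anti₀ (by positivity) ?_
    norm_num
    nlinarith [Real.pi_pos]
  have h2 : ‖Complex.exp (-(‖x‖ ^ 2 / (4 * w)))‖ ≤ Real.exp (-(‖x‖ ^ 2 / (4 * τ))) := by
    rw [Complex.norm_exp]
    refine Real.exp_le_exp.2 ?_
    have e1 : (-((‖x‖ : ℂ) ^ 2 / (4 * w))) = ((-(‖x‖ ^ 2 / 4) : ℝ) : ℂ) * w⁻¹ := by
      push_cast; field_simp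
    rw [e1, Complex.re_ofReal_mul, Complex.inv_re, hwre, Complex.normSq_eq_norm_sq]
    have : 1 / τ ≤ τ * r / ‖w‖ ^ 2 := by
      rw [div_le_div_iff₀ hτ (by positivity)]
      nlinarith
    have h4 : ‖x‖ ^ 2 / (4 * τ) = ‖x‖ ^ 2 / 4 * (1 / τ) := by field_simp
    rw [h4]
    nlinarith [mul_le_mul_of_nonneg_left this (show 0 ≤ ‖x‖ ^ 2 / 4 by positivity)]
  exact mul_le_mul h1 h2 (norm_nonneg _) (by positivity)

/-- Lebesgue measure on the quadrant of pairs of positive times. -/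
noncomputable def quadrant : Measure (ℝ × ℝ) :=
  (volume.restrict (Set.Ioi 0)).prod (volume.restrict (Set.Ioi 0))

instance : SFinite quadrant := by unfold quadrant; infer_instance

lemma ae_quadrant : ∀ᵐ q ∂quadrant, 0 < q.1 ∧ 0 < q.2 := by
  unfold quadrant
  rw [Measure.prod_restrict]
  exact ae_restrict_mem (measurableSet_Ioi.prod measurableSet_Ioi)

/-- The convolution kernel of `(b - m Δ)⁻²`, written as a superposition of heat kernels. It is
`[0, ∞]`-valued, so that no integrability has to be tracked. -/
noncomputable def resolventSqKernel (m b : ℝ) (x : E) : ℝ≥0∞ :=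
  ∫⁻ q, ENNReal.ofReal (Real.exp (-(q.1 + q.2) * b)) *
    ENNReal.ofReal (realHeatKernel (m * (q.1 + q.2)) x) ∂quadrant

/-- The bilinear form `∫∫ g(x) M(x - y) f(y) dx dy` of convolution with `M`. -/
noncomputable def convForm (M g f : E → ℝ≥0∞) : ℝ≥0∞ :=
  ∫⁻ x, g x * ∫⁻ y, M (x - y) * f y

lemma convForm_lintegral {Ω : Type*} [MeasurableSpace Ω] {ν : Measure Ω} [SFinite ν]
    {K : Ω → E → ℝ≥0∞} (hK : Measurable (Function.uncurry K)) {g f : E → ℝ≥0∞}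
    (hg : Measurable g) (hf : Measurable f) :
    convForm (fun x => ∫⁻ q, K q x ∂ν) g f = ∫⁻ q, convForm (K q) g f ∂ν := by
  unfold convForm
  have hK' : ∀ x : E, Measurable (fun p : Ω × E => K p.1 (x - p.2)) := fun x =>
    hK.comp (measurable_fst.prodMk (measurable_snd.const_sub x))
  have hK'' : Measurable (fun p : (Ω × E) × E => K p.1.1 (p.1.2 - p.2)) :=
    hK.comp ((measurable_fst.comp measurable_fst).prodMk
      ((measurable_snd.comp measurable_fst).sub measurable_snd))
  have hin : ∀ x : E, ∫⁻ y, (∫⁻ q, K q (x - y) ∂ν) * f y =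
      ∫⁻ q, (∫⁻ y, K q (x - y) * f y) ∂ν := fun x => by
    rw [lintegral_lintegral_swap]
    · congr 1; ext y
      exact (lintegral_mul_const _ ((hK' x).comp (measurable_prodMk_right))).symm
    · exact (((hK' x)).mul (hf.comp measurable_snd)).aemeasurable
  simp_rw [hin]
  have hmeas : Measurable (fun p : Ω × E => ∫⁻ y, K p.1 (p.2 - y) * f y) :=
    Measurable.lintegral_prod_right' (f := fun p : (Ω × E) × E => K p.1.1 (p.1.2 - p.2) * f p.2)
      (hK''.mul (hf.comp measurable_snd))
  rw [lintegral_lintegral_swap]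
  · congr 1; ext x
    exact (lintegral_const_mul _ (hmeas.comp (measurable_prodMk_right))).symm
  · exact ((hg.comp measurable_snd).mul hmeas).aemeasurable

lemma convForm_const_mul (a : ℝ≥0∞) {M g f : E → ℝ≥0∞} (hM : Measurable M) (hg : Measurable g)
    (hf : Measurable f) : convForm (fun x => a * M x) g f = a * convForm M g f := by
  unfold convForm
  have h1 : ∀ x : E, ∫⁻ y, a * M (x - y) * f y = a * ∫⁻ y, M (x - y) * f y := fun x => by
    rw [← lintegral_const_mul]
    · simp_rw [mul_assoc]
    · exact (hM.comp (measurable_id.const_sub x)).mul hf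
  simp_rw [h1]
  rw [← lintegral_const_mul]
  · congr 1; ext x; ring
  · exact hg.mul (Measurable.lintegral_prod_right' (f := fun p : E × E => M (p.1 - p.2) * f p.2)
      ((hM.comp (measurable_fst.sub measurable_snd)).mul (hf.comp measurable_snd)))

lemma convForm_tsum {M : ℕ → E → ℝ≥0∞} {g f : E → ℝ≥0∞} (hM : ∀ k, Measurable (M k))
    (hg : Measurable g) (hf : Measurable f) :
    convForm (fun x => ∑' k, M k x) g f = ∑' k, convForm (M k) g f := by
  have := convForm_lintegral (ν := Measure.count) (K := M)
    (measurable_from_prod_countable_right (fun k => hM k)) hg hf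
  simpa [lintegral_count] using this

lemma measurable_heat_times (m b : ℝ) :
    Measurable (Function.uncurry fun (q : ℝ × ℝ) (x : E) =>
      ENNReal.ofReal (Real.exp (-(q.1 + q.2) * b)) *
        ENNReal.ofReal (realHeatKernel (m * (q.1 + q.2)) x)) := by
  refine Measurable.mul (by fun_prop) (ENNReal.measurable_ofReal.comp ?_)
  exact measurable_realHeatKernel.comp (f := fun p : (ℝ × ℝ) × E => (m * (p.1.1 + p.1.2), p.2))
    (by fun_prop)

lemma measurable_resolventSqKernel (m b : ℝ) :
    Measurable (resolventSqKernel m b : E → ℝ≥0∞) :=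
  Measurable.lintegral_prod_left' (measurable_heat_times m b)

lemma convForm_resolventSqKernel (m b : ℝ) {g f : E → ℝ≥0∞} (hg : Measurable g)
    (hf : Measurable f) :
    convForm (resolventSqKernel m b) g f =
      ∫⁻ q, ENNReal.ofReal (Real.exp (-(q.1 + q.2) * b)) *
        convForm (fun x => ENNReal.ofReal (realHeatKernel (m * (q.1 + q.2)) x)) g f ∂quadrant := by
  unfold resolventSqKernel
  rw [convForm_lintegral (measurable_heat_times m b) hg hf]
  congr 1; ext q
  refine convForm_const_mul _ (ENNReal.measurable_ofReal.comp ?_) hg hf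
  exact measurable_realHeatKernel.comp (f := fun x : E => (m * (q.1 + q.2), x)) (by fun_prop)

lemma lintegral_quadrant_exp {a : ℝ} (ha : 0 < a) :
    ∫⁻ q, ENNReal.ofReal (Real.exp (-(q.1 + q.2) * a)) ∂quadrant = ENNReal.ofReal ((a⁻¹) ^ 2) := by
  have h1 : ∫⁻ s in Set.Ioi (0 : ℝ), ENNReal.ofReal (Real.exp (-s * a)) = ENNReal.ofReal a⁻¹ := by
    have hi : IntegrableOn (fun s : ℝ => Real.exp (-a * s)) (Set.Ioi 0) :=
      integrableOn_exp_mul_Ioi (by linarith) 0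
    have := ofReal_integral_eq_lintegral_ofReal hi
      (Filter.Eventually.of_forall fun s => (Real.exp_pos _).le)
    simp_rw [show ∀ s : ℝ, -s * a = -a * s from fun s => by ring]
    rw [← this, integral_exp_mul_Ioi (by linarith)]
    simp
  have h2 : ∀ q : ℝ × ℝ, ENNReal.ofReal (Real.exp (-(q.1 + q.2) * a)) =
      ENNReal.ofReal (Real.exp (-q.1 * a)) * ENNReal.ofReal (Real.exp (-q.2 * a)) := fun q => by
    rw [← ENNReal.ofReal_mul (Real.exp_pos _).le, ← Real.exp_add]; ring_nf
  simp_rw [h2]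
  unfold quadrant
  rw [lintegral_prod_mul (f := fun s : ℝ => ENNReal.ofReal (Real.exp (-s * a)))
    (g := fun s : ℝ => ENNReal.ofReal (Real.exp (-s * a))) (by fun_prop) (by fun_prop), h1,
    ← ENNReal.ofReal_mul (by positivity), sq]

lemma integral_quadrant_cexp {A B : ℂ} (hA : 0 < A.re) (hB : 0 < B.re) :
    ∫ q, Complex.exp (-(q.1 * A) - q.2 * B) ∂quadrant = (A * B)⁻¹ := by
  have h1 : ∀ {A : ℂ}, 0 < A.re → ∫ s in Set.Ioi (0 : ℝ), Complex.exp (-(s * A)) = A⁻¹ :=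
    fun {A} hA => by
    have := integral_exp_mul_complex_Ioi (a := -A) (by simpa using hA) 0
    simp_rw [show ∀ s : ℝ, -((s : ℂ) * A) = -A * s from fun s => by ring]
    rw [this]; simp
  have h2 : ∀ q : ℝ × ℝ, Complex.exp (-(q.1 * A) - q.2 * B) =
      Complex.exp (-(q.1 * A)) * Complex.exp (-(q.2 * B)) := fun q => by
    rw [← Complex.exp_add]; ring_nf
  simp_rw [h2]
  unfold quadrant
  rw [integral_prod_mul (fun s : ℝ => Complex.exp (-(s * A)))
    (fun s : ℝ => Complex.exp (-(s * B))), h1 hA, h1 hB, mul_inv]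

lemma enorm_integral_heat_le {w : ℂ} {K : E → ℝ≥0∞} (hK : ∀ x, ‖heatKernel w x‖ₑ ≤ K x)
    (g f : E → ℂ) :
    ‖∫ x, conj (g x) * ∫ y, heatKernel w (x - y) * f y‖ₑ ≤
      convForm K (fun x => ‖g x‖ₑ) (fun x => ‖f x‖ₑ) := by
  refine (enorm_integral_le_lintegral_enorm _).trans (lintegral_mono fun x => ?_)
  rw [enorm_mul]
  refine mul_le_mul' (le_of_eq ?_) ?_
  · rw [← ofReal_norm, Complex.norm_conj, ofReal_norm]
  refine (enorm_integral_le_lintegral_enorm _).trans (lintegral_mono fun y => ?_)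
  rw [enorm_mul]
  exact mul_le_mul' (hK _) le_rfl

end Kernels

/-! ### Resolvents as superpositions of heat kernels -/

section FormBounds

variable {E : Type*} [NormedAddCommGroup E] [InnerProductSpace ℝ E] [FiniteDimensional ℝ E]
  [MeasurableSpace E] [BorelSpace E]

/-- The Fourier multiplier `|p² - σ²|⁻²` is dominated, as a convolution operator, by
a multiple of `((Im σ)² - Δ)⁻²`. The resolvent and its conjugate are integrals of
`exp (-s c (p² - σ²))` and `exp (-s' c̄ (p² - σ̄²))` over the times `s, s' > 0`, for a suitable
direction `c` in the complex plane. -/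
lemma enorm_integral_resolvent_pair_le {σ : ℂ} {r : ℝ} (hσ : 0 < σ.im)
    (hr : r = σ.im ^ 2 / ‖σ‖ ^ 2) {f g : E → ℂ}
    (hfm : Measurable f) (hgm : Measurable g) (hf : Integrable f) (hg : Integrable g)
    (hfg : Integrable fun ξ => conj (𝓕 g ξ) * 𝓕 f ξ) :
    ‖∫ ξ, (((‖(((2 * Real.pi * ‖ξ‖) ^ 2 : ℝ) : ℂ) - σ ^ 2‖ ^ 2)⁻¹ : ℝ) : ℂ) *
        (conj (𝓕 g ξ) * 𝓕 f ξ)‖ₑ ≤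
      ENNReal.ofReal (r * r ^ (-(Module.finrank ℝ E / 2 : ℝ))) *
        convForm (resolventSqKernel 1 (σ.im ^ 2)) (fun x => ‖g x‖ₑ) (fun x => ‖f x‖ₑ) := by
  set y := σ.im with hy
  have hσ0 : σ ≠ 0 := by rintro rfl; simp [hy] at hσ
  have hσn : 0 < ‖σ‖ := norm_pos_iff.2 hσ0
  have hrpos : 0 < r := by rw [hr]; positivity
  -- For this direction `c σ² = i y σ` has real part `-y²`, which yields the decay rate `y`, and
  -- `c` lies on the circle `‖c‖² = Re c` of `norm_heatKernel_le`.
  set c : ℂ := Complex.I * y / σ with hc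
  have hcre : c.re = r := by
    rw [hc, hr, Complex.div_re, Complex.normSq_eq_norm_sq]
    simp [← hy]; ring
  have hcn : ‖c‖ ^ 2 = r := by
    rw [hc, hr]; simp [div_pow]
  have hcσ : c * σ ^ 2 = Complex.I * y * σ := by rw [hc]; field_simp
  set P : E → ℝ := fun ξ => (2 * Real.pi * ‖ξ‖) ^ 2 with hP
  have hPm : Measurable P := by rw [hP]; fun_prop
  set A : E → ℂ := fun ξ => c * (P ξ - σ ^ 2) with hA
  have hAre : ∀ ξ, (A ξ).re = r * P ξ + y ^ 2 := fun ξ => by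
    have : A ξ = ((P ξ : ℝ) : ℂ) * c - Complex.I * y * σ := by
      rw [← hcσ]; simp only [hA]; ring
    rw [this, Complex.sub_re, Complex.re_ofReal_mul, hcre]
    simp [← hy]; ring
  have hApos : ∀ ξ, y ^ 2 ≤ (A ξ).re := fun ξ => by
    rw [hAre]; have : 0 ≤ r * P ξ := by positivity
    linarith
  have hA0 : ∀ ξ, 0 < (A ξ).re := fun ξ => lt_of_lt_of_le (by positivity) (hApos ξ)
  have hrep : ∀ ξ, (((‖((P ξ : ℝ) : ℂ) - σ ^ 2‖ ^ 2)⁻¹ : ℝ) : ℂ) =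
      r * ∫ q, Complex.exp (-(q.1 * A ξ) - q.2 * conj (A ξ)) ∂quadrant := fun ξ => by
    rw [integral_quadrant_cexp (hA0 ξ) (by simpa using hA0 ξ), Complex.mul_conj,
      Complex.normSq_eq_norm_sq, hA]
    simp only [norm_mul, mul_pow, hcn]
    push_cast
    have : (r : ℂ) ≠ 0 := by exact_mod_cast hrpos.ne'
    field_simp
  have hsplit : ∀ (q : ℝ × ℝ) (ξ : E), Complex.exp (-(q.1 * A ξ) - q.2 * conj (A ξ)) =
      Complex.exp (q.1 * (Complex.I * y * σ) + q.2 * conj (Complex.I * y * σ)) *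
      Complex.exp (-(q.1 * c + q.2 * conj c) * (2 * Real.pi * ‖ξ‖) ^ 2) := fun q ξ => by
    rw [← Complex.exp_add, ← hcσ]
    congr 1
    simp only [hA, hP, map_mul, map_sub, Complex.conj_ofReal, map_pow]
    push_cast; ring
  have hnorm : ∀ (q : ℝ × ℝ),
      ‖Complex.exp (q.1 * (Complex.I * y * σ) + q.2 * conj (Complex.I * y * σ))‖ =
      Real.exp (-(q.1 + q.2) * y ^ 2) := fun q => by
    rw [Complex.norm_exp]
    congr 1
    simp [← hy]; ring
  set u : E → ℂ := fun ξ => conj (𝓕 g ξ) * 𝓕 f ξ with hu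
  have hint : Integrable (fun p : E × (ℝ × ℝ) =>
      u p.1 * Complex.exp (-(p.2.1 * A p.1) - p.2.2 * conj (A p.1)))
      ((volume : Measure E).prod quadrant) := by
    have hq : Integrable (fun q : ℝ × ℝ => Real.exp (-(q.1 + q.2) * y ^ 2)) quadrant := by
      refine ⟨by fun_prop, ?_⟩
      rw [hasFiniteIntegral_iff_ofReal (Filter.Eventually.of_forall fun q => (Real.exp_pos _).le),
        lintegral_quadrant_exp (by positivity)]
      exact ENNReal.ofReal_lt_top
    refine (hfg.norm.mul_prod hq).mono' ?_ ?_
    · refine (hfg.aestronglyMeasurable.comp_fst).mul (Measurable.aestronglyMeasurable ?_)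
      simp only [hA]
      fun_prop
    · have h1 : ∀ᵐ p ∂((volume : Measure E).prod quadrant), 0 < p.2.1 ∧ 0 < p.2.2 :=
        Measure.quasiMeasurePreserving_snd.ae ae_quadrant
      filter_upwards [h1] with p hp
      rw [norm_mul]
      refine mul_le_mul_of_nonneg_left ?_ (norm_nonneg _)
      rw [Complex.norm_exp]
      refine Real.exp_le_exp.2 ?_
      have := hApos p.1
      simp
      nlinarith [hp.1, hp.2]
  calc _ = ‖∫ ξ, (r : ℂ) * ∫ q, u ξ *
        Complex.exp (-(q.1 * A ξ) - q.2 * conj (A ξ)) ∂quadrant‖ₑ := by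
        congr 2; ext ξ
        rw [integral_const_mul, hrep]; ring
    _ = ‖(r : ℂ) * ∫ q, (∫ ξ, u ξ *
        Complex.exp (-(q.1 * A ξ) - q.2 * conj (A ξ))) ∂quadrant‖ₑ := by
        rw [integral_const_mul, integral_integral_swap hint]
    _ ≤ ENNReal.ofReal r * ∫⁻ q, ENNReal.ofReal (r ^ (-(Module.finrank ℝ E / 2 : ℝ))) *
        (ENNReal.ofReal (Real.exp (-(q.1 + q.2) * y ^ 2)) *
        convForm (fun x => ENNReal.ofReal (realHeatKernel (1 * (q.1 + q.2)) x))
          (fun x => ‖g x‖ₑ) (fun x => ‖f x‖ₑ)) ∂quadrant := by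
        rw [enorm_mul]
        refine mul_le_mul' (le_of_eq ?_) ?_
        · rw [← ofReal_norm, Complex.norm_of_nonneg hrpos.le]
        refine (enorm_integral_le_lintegral_enorm _).trans (lintegral_mono_ae ?_)
        filter_upwards [ae_quadrant] with q hq
        have hw : 0 < ((q.1 : ℂ) * c + q.2 * conj c).re := by
          simp only [Complex.add_re, Complex.re_ofReal_mul, Complex.conj_re, hcre]
          have := mul_pos hq.1 hrpos; have := mul_pos hq.2 hrpos; linarith
        have e1 : ∫ ξ, u ξ * Complex.exp (-(q.1 * A ξ) - q.2 * conj (A ξ)) =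
            Complex.exp (q.1 * (Complex.I * y * σ) + q.2 * conj (Complex.I * y * σ)) *
            ∫ x, conj (g x) * ∫ y, heatKernel (q.1 * c + q.2 * conj c) (x - y) * f y := by
          rw [← integral_gaussian_fourier hw hf hg, ← integral_const_mul]
          congr 1; ext ξ
          rw [hsplit]; ring
        rw [e1, enorm_mul, ← ofReal_norm, hnorm, mul_left_comm]
        refine mul_le_mul' le_rfl ?_
        rw [← convForm_const_mul]
        · refine enorm_integral_heat_le (fun x => ?_) g f
          rw [← ofReal_norm, ← ENNReal.ofReal_mul (by positivity), one_mul]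
          exact ENNReal.ofReal_le_ofReal (norm_heatKernel_le hrpos hcre hcn hq.1 hq.2 x)
        · exact ENNReal.measurable_ofReal.comp (measurable_realHeatKernel.comp
            (f := fun x : E => (1 * (q.1 + q.2), x)) (by fun_prop))
        · exact hgm.enorm
        · exact hfm.enorm
    _ = _ := by
        rw [convForm_resolventSqKernel _ _ hgm.enorm hfm.enorm,
          lintegral_const_mul', ← mul_assoc, ← ENNReal.ofReal_mul hrpos.le]
        exact ENNReal.ofReal_ne_top

/-- A positive convolution form is at most the form of its Fourier multiplier, evaluated on the
absolute values of the Fourier transforms. -/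
lemma convForm_heat_le {t : ℝ} (ht : 0 < t) {g f : E → ℝ} (hg0 : ∀ x, 0 ≤ g x)
    (hf0 : ∀ x, 0 ≤ f x) (hg : Integrable g) (hf : Integrable f) :
    convForm (fun x => ENNReal.ofReal (realHeatKernel t x)) (fun x => ENNReal.ofReal (g x))
      (fun x => ENNReal.ofReal (f x)) ≤
    ∫⁻ ξ, ENNReal.ofReal (Real.exp (-t * (2 * Real.pi * ‖ξ‖) ^ 2)) *
      (‖𝓕 (fun x => (g x : ℂ)) ξ‖ₑ * ‖𝓕 (fun x => (f x : ℂ)) ξ‖ₑ) := by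
  set B : ℝ := (4 * Real.pi * t)⁻¹ ^ (Module.finrank ℝ E / 2 : ℝ) with hB
  have hB0 : 0 ≤ B := by positivity
  have hbound : ∀ x : E, ‖realHeatKernel t x‖ ≤ B := fun x => by
    rw [Real.norm_of_nonneg (realHeatKernel_nonneg ht x)]
    unfold realHeatKernel
    refine mul_le_of_le_one_right hB0 (Real.exp_le_one_iff.2 ?_)
    have : 0 ≤ ‖x‖ ^ 2 / (4 * t) := by positivity
    linarith
  have hm : Measurable (fun x : E => realHeatKernel t x) :=
    measurable_realHeatKernel.comp (f := fun x : E => (t, x)) (by fun_prop)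
  have hi1 : ∀ x : E, Integrable (fun y => realHeatKernel t (x - y) * f y) := fun x =>
    hf.bdd_mul (c := B) (hm.comp (measurable_id.const_sub x)).aestronglyMeasurable
      (Filter.Eventually.of_forall fun y => hbound _)
  have hp : Integrable (fun p : E × E => g p.1 * (realHeatKernel t (p.1 - p.2) * f p.2)) := by
    have := (hg.mul_prod hf).bdd_mul (c := B) (f := fun p : E × E => realHeatKernel t (p.1 - p.2))
      (hm.comp (measurable_fst.sub measurable_snd)).aestronglyMeasurable
      (Filter.Eventually.of_forall fun y => hbound _)
    refine this.congr (Filter.Eventually.of_forall fun p => ?_)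
    simp only; ring
  have hi2 : Integrable (fun x => g x * ∫ y, realHeatKernel t (x - y) * f y) := by
    simpa only [integral_const_mul] using hp.integral_prod_left
  have hnn : ∀ x : E, 0 ≤ ∫ y, realHeatKernel t (x - y) * f y := fun x =>
    integral_nonneg fun y => mul_nonneg (realHeatKernel_nonneg ht _) (hf0 y)
  have e1 : convForm (fun x => ENNReal.ofReal (realHeatKernel t x))
      (fun x => ENNReal.ofReal (g x)) (fun x => ENNReal.ofReal (f x)) =
      ENNReal.ofReal (∫ x, g x * ∫ y, realHeatKernel t (x - y) * f y) := by
    unfold convForm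
    rw [ofReal_integral_eq_lintegral_ofReal hi2
      (Filter.Eventually.of_forall fun x => mul_nonneg (hg0 x) (hnn x))]
    congr 1; ext x
    rw [ENNReal.ofReal_mul (hg0 x), ofReal_integral_eq_lintegral_ofReal (hi1 x)
      (Filter.Eventually.of_forall fun y => mul_nonneg (realHeatKernel_nonneg ht _) (hf0 y))]
    simp_rw [ENNReal.ofReal_mul (realHeatKernel_nonneg ht _)]
  have e2 : ((∫ x, g x * ∫ y, realHeatKernel t (x - y) * f y : ℝ) : ℂ) =
      ∫ x, conj (g x : ℂ) * ∫ y, heatKernel (t : ℂ) (x - y) * (f y : ℂ) := by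
    rw [← integral_complex_ofReal]
    congr 1; ext x
    push_cast
    rw [Complex.conj_ofReal, ← integral_complex_ofReal]
    simp_rw [heatKernel_ofReal ht]
    push_cast
    rfl
  rw [e1]
  calc _ ≤ ‖((∫ x, g x * ∫ y, realHeatKernel t (x - y) * f y : ℝ) : ℂ)‖ₑ := by
        rw [← ofReal_norm]
        exact ENNReal.ofReal_le_ofReal (by simpa using le_abs_self _)
    _ ≤ _ := by
        rw [e2, ← integral_gaussian_fourier (w := (t : ℂ)) (f := fun x => (f x : ℂ))
          (g := fun x => (g x : ℂ)) (by simpa using ht) hf.ofReal hg.ofReal]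
        refine (enorm_integral_le_lintegral_enorm _).trans (lintegral_mono fun ξ => ?_)
        rw [enorm_mul, enorm_mul]
        refine mul_le_mul' (le_of_eq ?_) (mul_le_mul' (le_of_eq ?_) le_rfl)
        · rw [← ofReal_norm, Complex.norm_exp]
          congr 2
          rw [show (-(t : ℂ) * (2 * Real.pi * ‖ξ‖) ^ 2) =
            ((-t * (2 * Real.pi * ‖ξ‖) ^ 2 : ℝ) : ℂ) by push_cast; rfl, Complex.ofReal_re]
        · rw [← ofReal_norm, Complex.norm_conj, ofReal_norm]

lemma convForm_resolventSqKernel_le {m b : ℝ} (hm : 0 < m) (hb : 0 < b) {g f : E → ℝ}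
    (hg0 : ∀ x, 0 ≤ g x) (hf0 : ∀ x, 0 ≤ f x) (hgm : Measurable g) (hfm : Measurable f)
    (hg : Integrable g) (hf : Integrable f) :
    convForm (resolventSqKernel m b) (fun x => ENNReal.ofReal (g x))
      (fun x => ENNReal.ofReal (f x)) ≤
    ∫⁻ ξ, ENNReal.ofReal (((b + m * (2 * Real.pi * ‖ξ‖) ^ 2)⁻¹) ^ 2) *
      (‖𝓕 (fun x => (g x : ℂ)) ξ‖ₑ * ‖𝓕 (fun x => (f x : ℂ)) ξ‖ₑ) := by
  rw [convForm_resolventSqKernel m b hgm.ennreal_ofReal hfm.ennreal_ofReal]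
  set u : E → ℝ≥0∞ := fun ξ => ‖𝓕 (fun x => (g x : ℂ)) ξ‖ₑ * ‖𝓕 (fun x => (f x : ℂ)) ξ‖ₑ with hu
  have hum : Measurable u :=
    (continuous_fourier hg.ofReal).measurable.enorm.mul
      (continuous_fourier hf.ofReal).measurable.enorm
  calc _ ≤ ∫⁻ q, ENNReal.ofReal (Real.exp (-(q.1 + q.2) * b)) *
        (∫⁻ ξ, ENNReal.ofReal (Real.exp (-(m * (q.1 + q.2)) * (2 * Real.pi * ‖ξ‖) ^ 2)) * u ξ)
          ∂quadrant := by
        refine lintegral_mono_ae ?_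
        filter_upwards [ae_quadrant] with q hq
        exact mul_le_mul' le_rfl
          (convForm_heat_le (mul_pos hm (add_pos hq.1 hq.2)) hg0 hf0 hg hf)
    _ = ∫⁻ q, (∫⁻ ξ, ENNReal.ofReal
        (Real.exp (-(q.1 + q.2) * (b + m * (2 * Real.pi * ‖ξ‖) ^ 2))) * u ξ) ∂quadrant := by
        congr 1; ext q
        rw [← lintegral_const_mul' _ _ ENNReal.ofReal_ne_top]
        congr 1; ext ξ
        rw [← mul_assoc, ← ENNReal.ofReal_mul (Real.exp_pos _).le, ← Real.exp_add]
        ring_nf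
    _ = _ := by
        rw [lintegral_lintegral_swap]
        · congr 1; ext ξ
          rw [lintegral_mul_const, lintegral_quadrant_exp (by positivity)]
          fun_prop
        · exact Measurable.aemeasurable (by fun_prop)

end FormBounds

/-! ### The Matsubara expansion of `1 / K_T` -/

section PartialFractions

/-- The partial fractions of the tangent, from those of the cotangent and
`tan z = cot z - 2 cot (2 z)`. -/
lemma hasSum_tan_partial_fraction {x : ℂ} (hx : x ∈ Complex.integerComplement)
    (hx2 : 2 * x ∈ Complex.integerComplement) :
    HasSum (fun k : ℕ => 8 * x / ((2 * k + 1) ^ 2 - (2 * x) ^ 2))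
      (Real.pi * Complex.tan (Real.pi * x)) := by
  have h1 : HasSum (fun n : ℕ => cotTerm x n)
      (Real.pi * Complex.cot (Real.pi * x) - 1 / x) := by
    rw [cot_series_rep' hx]; exact (summable_cotTerm hx).hasSum
  have h2 : HasSum (fun n : ℕ => 2 * cotTerm (2 * x) n)
      (2 * (Real.pi * Complex.cot (Real.pi * (2 * x)) - 1 / (2 * x))) := by
    rw [cot_series_rep' hx2]; exact (summable_cotTerm hx2).hasSum.mul_left 2
  have hodd : ∀ k : ℕ, 2 * cotTerm (2 * x) (2 * k + 1) = cotTerm x k := fun k => by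
    rw [cotTerm_identity hx2, cotTerm_identity hx]
    push_cast
    rw [show (2 * x + (2 * (k : ℂ) + 1 + 1)) * (2 * x - (2 * (k : ℂ) + 1 + 1)) =
      4 * ((x + (k + 1)) * (x - (k + 1))) by ring]
    rw [one_div, one_div, mul_inv]; ring
  have heven : Summable (fun k : ℕ => 2 * cotTerm (2 * x) (2 * k)) :=
    h2.summable.comp_injective (i := fun k : ℕ => 2 * k) (fun a b h => by simpa using h)
  have h3 := (heven.hasSum.even_add_odd (f := fun n => 2 * cotTerm (2 * x) n)
    (by simpa only [hodd] using h1)).unique h2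
  have hsin : Complex.sin (Real.pi * x) ≠ 0 := sin_pi_mul_ne_zero hx
  have hx0 : x ≠ 0 := by
    rintro rfl; exact hx ⟨0, by simp⟩
  have hcos : Complex.cos (Real.pi * x) ≠ 0 := by
    intro h
    refine sin_pi_mul_ne_zero hx2 ?_
    rw [show (Real.pi : ℂ) * (2 * x) = 2 * (Real.pi * x) by ring, Complex.sin_two_mul, h]; simp
  have h4 : Real.pi * Complex.tan (Real.pi * x) =
      -∑' k : ℕ, 2 * cotTerm (2 * x) (2 * k) := by
    have h5 : ∑' k : ℕ, 2 * cotTerm (2 * x) (2 * k) =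
      2 * (Real.pi * Complex.cot (Real.pi * (2 * x)) - 1 / (2 * x)) -
        (Real.pi * Complex.cot (Real.pi * x) - 1 / x) := by rw [← h3]; ring
    rw [h5, Complex.tan_eq_sin_div_cos, Complex.cot, Complex.cot,
      show (Real.pi : ℂ) * (2 * x) = 2 * (Real.pi * x) by ring, Complex.sin_two_mul,
      Complex.cos_two_mul]
    have h6 := Complex.sin_sq_add_cos_sq (Real.pi * x)
    field_simp
    linear_combination Real.pi * x * h6
  rw [h4]
  refine (heven.hasSum.neg).congr_fun fun k => ?_
  rw [cotTerm_identity hx2]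
  push_cast
  rw [show (2 * x + (2 * (k : ℂ) + 1)) * (2 * x - (2 * (k : ℂ) + 1)) =
      -((2 * k + 1) ^ 2 - (2 * x) ^ 2) by ring, one_div, inv_neg]
  ring

/-- The Matsubara frequencies `(2 k + 1) π T`. -/
noncomputable def matsubara (T : ℝ) (k : ℕ) : ℝ := (2 * k + 1) * Real.pi * T

lemma matsubara_pos {T : ℝ} (hT : 0 < T) (k : ℕ) : 0 < matsubara T k := by
  unfold matsubara; positivity

/-- The expansion of `1 / K_T` over the Matsubara frequencies. -/
lemma hasSum_inv_symbolOfEnergy {μ T s : ℝ} (hT : 0 < T) (hs : s ≠ μ) :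
    HasSum (fun k : ℕ => 4 * T / ((s - μ) ^ 2 + matsubara T k ^ 2))
      (symbolOfEnergy μ T s)⁻¹ := by
  set z := s - μ with hz
  have hz0 : z ≠ 0 := sub_ne_zero.2 hs
  set x : ℂ := ((z / (2 * Real.pi * T) : ℝ) : ℂ) * Complex.I with hx
  have hne : z / (2 * Real.pi * T) ≠ 0 := by have := Real.pi_pos; positivity
  have hxc : x ∈ Complex.integerComplement := by
    rintro ⟨n, hn⟩
    have := congrArg Complex.im hn
    rw [hx, Complex.im_ofReal_mul, Complex.I_im, mul_one, Complex.intCast_im] at this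
    exact hne this.symm
  have hxc2 : 2 * x ∈ Complex.integerComplement := by
    rintro ⟨n, hn⟩
    have := congrArg Complex.im hn
    rw [hx, ← Complex.ofReal_ofNat, Complex.im_ofReal_mul, Complex.im_ofReal_mul, Complex.I_im,
      mul_one, Complex.intCast_im] at this
    exact mul_ne_zero two_ne_zero hne this.symm
  have h := (hasSum_tan_partial_fraction hxc hxc2).mul_left (1 / (Real.pi * Complex.I * z))
  rw [← Complex.hasSum_ofReal]
  have hI := Complex.I_ne_zero
  have hπ : (Real.pi : ℂ) ≠ 0 := by exact_mod_cast Real.pi_ne_zero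
  have hzC : (z : ℂ) ≠ 0 := by exact_mod_cast hz0
  have hTC : (T : ℂ) ≠ 0 := by exact_mod_cast hT.ne'
  have hlim : (((symbolOfEnergy μ T s)⁻¹ : ℝ) : ℂ) =
      1 / (Real.pi * Complex.I * z) * (Real.pi * Complex.tan (Real.pi * x)) := by
    rw [symbolOfEnergy, if_neg hs, ← hz]
    have e : (Real.pi : ℂ) * x = ((z / (2 * T) : ℝ) : ℂ) * Complex.I := by
      rw [hx]; push_cast; field_simp
    rw [e, Complex.tan_mul_I]
    push_cast
    field_simp
  rw [hlim]
  refine h.congr_fun fun k => ?_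
  have hden : ((z : ℂ) ^ 2 + (matsubara T k : ℂ) ^ 2) ≠ 0 := by
    have : 0 < z ^ 2 + matsubara T k ^ 2 := by
      have := matsubara_pos hT k; positivity
    exact_mod_cast this.ne'
  have e : ((2 * (k : ℂ) + 1) ^ 2 - (2 * x) ^ 2) =
      ((z : ℂ) ^ 2 + (matsubara T k : ℂ) ^ 2) / (Real.pi * T) ^ 2 := by
    rw [hx, matsubara, mul_pow, mul_pow, Complex.I_sq]
    push_cast
    field_simp
    ring
  rw [e, hx]
  push_cast
  field_simp
  ring

end PartialFractions

/-! ### The decay rates of the Matsubara resolvents -/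

section MatsubaraRates

/-- `√(μ + i ω)` at the Matsubara frequency `ω = (2 k + 1) π T`. -/
noncomputable def matsubaraRoot (μ T : ℝ) (k : ℕ) : ℂ :=
  Complex.sqrt ((μ : ℂ) + Complex.I * matsubara T k)

lemma matsubaraRoot_zero_im (μ T : ℝ) : (matsubaraRoot μ T 0).im = criticalRate μ T := by
  simp [matsubaraRoot, criticalRate, matsubara, mul_assoc]

lemma matsubaraRoot_sq (μ T : ℝ) (k : ℕ) :
    matsubaraRoot μ T k ^ 2 = (μ : ℂ) + Complex.I * matsubara T k := by
  unfold matsubaraRoot Complex.sqrt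
  exact Complex.cpow_ofNat_inv_pow _ 2

lemma norm_energy (μ T : ℝ) (k : ℕ) (s : ℝ) :
    ‖(s : ℂ) - matsubaraRoot μ T k ^ 2‖ ^ 2 = (s - μ) ^ 2 + matsubara T k ^ 2 := by
  rw [matsubaraRoot_sq, ← Complex.normSq_eq_norm_sq, Complex.normSq_apply]
  simp; ring

lemma norm_matsubaraRoot_sq (μ T : ℝ) (k : ℕ) :
    ‖matsubaraRoot μ T k‖ ^ 2 = √(μ ^ 2 + matsubara T k ^ 2) := by
  have h := norm_energy μ T k 0
  rw [Complex.ofReal_zero, zero_sub, norm_neg, norm_pow, zero_sub, neg_sq] at h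
  rw [← h, Real.sqrt_sq (by positivity)]

lemma matsubaraRoot_im {μ T : ℝ} (hT : 0 < T) (k : ℕ) :
    (matsubaraRoot μ T k).im = √((√(μ ^ 2 + matsubara T k ^ 2) - μ) / 2) := by
  rw [← norm_matsubaraRoot_sq, ← norm_pow, matsubaraRoot_sq]
  unfold matsubaraRoot
  rw [Complex.sqrt_eq_real_add_ite, if_pos (by simpa using (matsubara_pos hT k).le)]
  simp

lemma lt_sqrt_matsubara {μ T : ℝ} (hT : 0 < T) (k : ℕ) :
    |μ| < √(μ ^ 2 + matsubara T k ^ 2) := by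
  rw [← Real.sqrt_sq_eq_abs]
  have := matsubara_pos hT k
  exact Real.sqrt_lt_sqrt (by positivity) (by nlinarith)

lemma matsubaraRoot_im_sq {μ T : ℝ} (hT : 0 < T) (k : ℕ) :
    (matsubaraRoot μ T k).im ^ 2 = (√(μ ^ 2 + matsubara T k ^ 2) - μ) / 2 := by
  rw [matsubaraRoot_im hT, Real.sq_sqrt]
  have := lt_sqrt_matsubara (μ := μ) hT k
  have := le_abs_self μ
  linarith

lemma matsubaraRoot_im_pos {μ T : ℝ} (hT : 0 < T) (k : ℕ) : 0 < (matsubaraRoot μ T k).im := by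
  rw [matsubaraRoot_im hT]
  have := lt_sqrt_matsubara (μ := μ) hT k
  have := le_abs_self μ
  exact Real.sqrt_pos.2 (by linarith)

lemma criticalRate_pos {μ T : ℝ} (hT : 0 < T) : 0 < criticalRate μ T :=
  matsubaraRoot_zero_im μ T ▸ matsubaraRoot_im_pos hT 0

lemma matsubara_le {T : ℝ} (hT : 0 < T) (k : ℕ) : matsubara T 0 ≤ matsubara T k := by
  unfold matsubara
  have : 0 ≤ (k : ℝ) := Nat.cast_nonneg k
  push_cast
  gcongr

/-- The squared rates `(Im √(μ + i ω_k))²` grow at least linearly in `k`. -/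
lemma exists_matsubaraRoot_im_sq_ge {μ T : ℝ} (hT : 0 < T) :
    ∃ δ > 0, ∀ k : ℕ, criticalRate μ T ^ 2 + δ * k ≤ (matsubaraRoot μ T k).im ^ 2 := by
  set ω := matsubara T 0 with hω
  have hω0 : 0 < ω := matsubara_pos hT 0
  refine ⟨Real.pi * T * ω / (|μ| + ω), by have := Real.pi_pos; positivity, fun k => ?_⟩
  rw [← matsubaraRoot_zero_im, matsubaraRoot_im_sq hT, matsubaraRoot_im_sq hT, ← hω]
  set ν := matsubara T k with hν
  have hk : ν = ω + 2 * k * (Real.pi * T) := by simp [hν, hω, matsubara]; ring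
  have hνω : ω ≤ ν := matsubara_le hT k
  set a := √(μ ^ 2 + ω ^ 2) with ha
  set b := √(μ ^ 2 + ν ^ 2) with hb
  have ha2 : a ^ 2 = μ ^ 2 + ω ^ 2 := Real.sq_sqrt (by positivity)
  have hb2 : b ^ 2 = μ ^ 2 + ν ^ 2 := Real.sq_sqrt (by positivity)
  have ha0 : 0 ≤ a := Real.sqrt_nonneg _
  have hb0 : 0 ≤ b := Real.sqrt_nonneg _
  have hμ0 := abs_nonneg μ
  have haω : a ≤ |μ| + ω := abs_le_of_sq_le_sq' (by rw [ha2, ← sq_abs μ]; nlinarith)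
    (by linarith) |>.2
  have hbν : b ≤ |μ| + ν := abs_le_of_sq_le_sq' (by rw [hb2, ← sq_abs μ]; nlinarith)
    (by linarith) |>.2
  have hab : a ≤ b := Real.sqrt_le_sqrt (by nlinarith)
  have hk0 : 0 ≤ k * (Real.pi * T) := by have := Real.pi_pos; positivity
  have key : (ν - ω) * ω / (|μ| + ω) ≤ b - a := by
    rw [div_le_iff₀ (by positivity)]
    have h1 : (ν - ω) * (ν + ω) = (b - a) * (b + a) := by nlinarith
    have h2 : (b - a) * (b + a) ≤ (b - a) * (2 * |μ| + ν + ω) :=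
      mul_le_mul_of_nonneg_left (by linarith) (by linarith)
    have h3 : (ν - ω) * (ν + ω) * (|μ| + ω) ≤ (b - a) * (2 * |μ| + ν + ω) * (|μ| + ω) := by
      rw [h1]; exact mul_le_mul_of_nonneg_right h2 (by positivity)
    have h4 : ω * (2 * |μ| + ν + ω) ≤ (ν + ω) * (|μ| + ω) := by nlinarith
    have h5 : (ν - ω) * (ω * (2 * |μ| + ν + ω)) ≤ (ν - ω) * ((ν + ω) * (|μ| + ω)) :=
      mul_le_mul_of_nonneg_left h4 (by linarith)
    have h6 : (ν - ω) * ω * (2 * |μ| + ν + ω) ≤ (b - a) * (|μ| + ω) * (2 * |μ| + ν + ω) := by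
      nlinarith
    exact le_of_mul_le_mul_right h6 (by linarith)
  have h7 : Real.pi * T * ω / (|μ| + ω) * k = (ν - ω) * ω / (|μ| + ω) / 2 := by
    rw [hk]; ring
  rw [h7]
  linarith

/-- The constants of `enorm_integral_resolvent_pair_le` are uniform over the Matsubara frequencies,
because `σₖ` stays away from the real axis in angle. -/
lemma exists_opening_ge {μ T : ℝ} (hT : 0 < T) : ∃ ρ > 0, ∀ k : ℕ,
    ρ ≤ (matsubaraRoot μ T k).im ^ 2 / ‖matsubaraRoot μ T k‖ ^ 2 := by
  set a := √(μ ^ 2 + matsubara T 0 ^ 2) with ha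
  have hμa : |μ| < a := lt_sqrt_matsubara hT 0
  have ha0 : 0 < a := (abs_nonneg μ).trans_lt hμa
  refine ⟨(a - |μ|) / (2 * a), div_pos (by linarith) (by positivity), fun k => ?_⟩
  rw [matsubaraRoot_im_sq hT, norm_matsubaraRoot_sq]
  set b := √(μ ^ 2 + matsubara T k ^ 2) with hb
  have hab : a ≤ b := Real.sqrt_le_sqrt (by
    have := matsubara_le hT k; have := matsubara_pos hT 0; nlinarith)
  rw [div_div, div_le_div_iff₀ (by positivity) (by linarith)]
  have h1 := le_abs_self μ
  have h2 := mul_le_mul_of_nonneg_right hab (abs_nonneg μ)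
  have h3 := mul_le_mul_of_nonneg_left h1 ha0.le
  nlinarith

lemma opening_le_one (σ : ℂ) : σ.im ^ 2 / ‖σ‖ ^ 2 ≤ 1 := by
  refine div_le_one_of_le₀ ?_ (by positivity)
  rw [← Complex.normSq_eq_norm_sq, Complex.normSq_apply]
  nlinarith [sq_nonneg σ.re]

end MatsubaraRates

/-! ### A positive kernel that dominates `K_T⁻¹` -/

section BCSKernel

variable {E : Type*} [NormedAddCommGroup E] [InnerProductSpace ℝ E] [FiniteDimensional ℝ E]
  [MeasurableSpace E] [BorelSpace E]

/-- A superposition of the kernels of `((Im √(μ + i ω_k))² - Δ)⁻²`, which dominates the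
convolution kernel of `K_T⁻¹` up to a constant. -/
noncomputable def bcsKernel (μ T : ℝ) (x : E) : ℝ≥0∞ :=
  ∑' k, resolventSqKernel 1 ((matsubaraRoot μ T k).im ^ 2) x

lemma measurable_bcsKernel (μ T : ℝ) : Measurable (bcsKernel μ T : E → ℝ≥0∞) :=
  Measurable.tsum fun _ => measurable_resolventSqKernel _ _

lemma bcsKernel_neg (μ T : ℝ) (x : E) : bcsKernel μ T (-x) = bcsKernel μ T x := by
  simp [bcsKernel, resolventSqKernel, realHeatKernel]

lemma ae_norm_ne [Nontrivial E] (μ : ℝ) : ∀ᵐ ξ : E, (2 * Real.pi * ‖ξ‖) ^ 2 ≠ μ := by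
  have h : volume (Metric.sphere (0 : E) (√μ / (2 * Real.pi))) = 0 :=
    Measure.addHaar_sphere volume _ _
  rw [ae_iff]
  refine measure_mono_null (fun ξ hξ => ?_) h
  simp only [ne_eq, not_not, Set.mem_ofPred_eq] at hξ
  rw [mem_sphere_zero_iff_norm, ← hξ, Real.sqrt_sq (by positivity)]
  field_simp

/-- `K_T⁻¹` is dominated, as a form, by the convolution with `bcsKernel`. -/
theorem exists_enorm_integral_inv_symbol_le [Nontrivial E] (μ : ℝ) {T : ℝ} (hT : 0 < T) :
    ∃ C : ℝ, ∀ f g : E → ℂ, Measurable f → Measurable g → Integrable f → Integrable g →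
      Integrable (fun ξ => conj (𝓕 g ξ) * 𝓕 f ξ) →
      ‖∫ ξ, (((symbolOfEnergy μ T ((2 * Real.pi * ‖ξ‖) ^ 2))⁻¹ : ℝ) : ℂ) *
        (conj (𝓕 g ξ) * 𝓕 f ξ)‖ₑ ≤
      ENNReal.ofReal C * convForm (bcsKernel μ T) (fun x => ‖g x‖ₑ) (fun x => ‖f x‖ₑ) := by
  obtain ⟨ρ, hρ, hρk⟩ := exists_opening_ge (μ := μ) hT
  set e : ℝ := Module.finrank ℝ E / 2 with he
  refine ⟨4 * T * ρ ^ (-e), fun f g hfm hgm hf hg hfg => ?_⟩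
  set u : E → ℂ := fun ξ => conj (𝓕 g ξ) * 𝓕 f ξ with hu
  set a : ℕ → E → ℝ := fun k ξ =>
    (((2 * Real.pi * ‖ξ‖) ^ 2 - μ) ^ 2 + matsubara T k ^ 2)⁻¹ with ha
  have ha0 : ∀ k ξ, 0 ≤ a k ξ := fun k ξ => by simp only [ha]; positivity
  have hak : ∀ k ξ, a k ξ ≤ (matsubara T k ^ 2)⁻¹ := fun k ξ =>
    inv_anti₀ (by have := matsubara_pos hT k; positivity) (by
      have := sq_nonneg ((2 * Real.pi * ‖ξ‖) ^ 2 - μ); linarith)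
  have hbnd : ∀ k ξ, ‖(((4 * T) * a k ξ : ℝ) : ℂ)‖ ≤ 4 * T * (matsubara T k ^ 2)⁻¹ := fun k ξ => by
    rw [Complex.norm_of_nonneg (mul_nonneg (by positivity) (ha0 k ξ))]
    exact mul_le_mul_of_nonneg_left (hak k ξ) (by positivity)
  have hint : ∀ k, Integrable (fun ξ => (((4 * T) * a k ξ : ℝ) : ℂ) * u ξ) := fun k => by
    refine hfg.bdd_mul (c := 4 * T * (matsubara T k ^ 2)⁻¹) ?_
      (Filter.Eventually.of_forall (hbnd k))
    exact Measurable.aestronglyMeasurable (by simp only [ha]; fun_prop)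
  have hsum0 : Summable (fun k : ℕ => 4 * T * (matsubara T k ^ 2)⁻¹) := by
    refine Summable.mul_left _ ?_
    have h1 : Summable (fun k : ℕ => ((Real.pi * T) ^ 2)⁻¹ * (1 / ((k : ℝ) + 1) ^ 2)) :=
      (by exact_mod_cast (summable_nat_add_iff 1).2 (Real.summable_one_div_nat_pow.2 one_lt_two) :
        Summable fun k : ℕ => 1 / ((k : ℝ) + 1) ^ 2).mul_left _
    refine h1.of_nonneg_of_le (fun k => by positivity) (fun k => ?_)
    rw [one_div, ← mul_inv, ← mul_pow]
    refine inv_anti₀ (by have := Real.pi_pos; positivity) ?_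
    have h2 : 0 < Real.pi * T := by have := Real.pi_pos; positivity
    refine pow_le_pow_left₀ (by positivity) ?_ 2
    unfold matsubara
    nlinarith [(Nat.cast_nonneg k : (0 : ℝ) ≤ k)]
  have hsum : Summable (fun k => ∫ ξ, ‖(((4 * T) * a k ξ : ℝ) : ℂ) * u ξ‖) := by
    refine (hsum0.mul_right (∫ ξ, ‖u ξ‖)).of_nonneg_of_le
      (fun k => integral_nonneg fun ξ => norm_nonneg _) (fun k => ?_)
    rw [← integral_const_mul]
    refine integral_mono (hint k).norm (hfg.norm.const_mul _) fun ξ => ?_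
    simp only [norm_mul]
    exact mul_le_mul_of_nonneg_right (by simpa using hbnd k ξ) (by positivity)
  have hall := hasSum_integral_of_summable_integral_norm hint hsum
  have heq : ∫ ξ, (((symbolOfEnergy μ T ((2 * Real.pi * ‖ξ‖) ^ 2))⁻¹ : ℝ) : ℂ) * u ξ =
      ∑' k, ∫ ξ, (((4 * T) * a k ξ : ℝ) : ℂ) * u ξ := by
    rw [hall.tsum_eq]
    refine integral_congr_ae ?_
    -- The expansion is only available off the Fermi sphere `(2 π ‖ξ‖)² = μ`, a null set.
    filter_upwards [ae_norm_ne (E := E) μ] with ξ hξ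
    have h1 := (Complex.hasSum_ofReal.2 (hasSum_inv_symbolOfEnergy hT hξ)).mul_right (u ξ)
    simp only [div_eq_mul_inv] at h1
    exact h1.tsum_eq.symm
  rw [heq]
  calc _ ≤ ∑' k, ‖∫ ξ, (((4 * T) * a k ξ : ℝ) : ℂ) * u ξ‖ₑ := enorm_tsum_le_tsum_enorm
    _ ≤ ∑' k, ENNReal.ofReal (4 * T * ρ ^ (-e)) *
        convForm (resolventSqKernel 1 ((matsubaraRoot μ T k).im ^ 2)) (fun x => ‖g x‖ₑ)
          (fun x => ‖f x‖ₑ) := by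
        refine ENNReal.tsum_le_tsum fun k => ?_
        have h1 := enorm_integral_resolvent_pair_le (matsubaraRoot_im_pos (μ := μ) hT k) rfl
          hfm hgm hf hg hfg
        simp_rw [norm_energy] at h1
        have e1 : ∫ ξ, (((4 * T) * a k ξ : ℝ) : ℂ) * u ξ =
            ((4 * T : ℝ) : ℂ) * ∫ ξ, ((a k ξ : ℝ) : ℂ) * u ξ := by
          rw [← integral_const_mul]
          congr 1; ext ξ; push_cast; ring
        rw [e1, enorm_mul, ← ofReal_norm, Complex.norm_of_nonneg (by positivity),
          show ENNReal.ofReal (4 * T * ρ ^ (-e)) = ENNReal.ofReal (4 * T) *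
            ENNReal.ofReal (ρ ^ (-e)) from ENNReal.ofReal_mul (by positivity), mul_assoc]
        refine mul_le_mul' le_rfl (h1.trans (mul_le_mul' (ENNReal.ofReal_le_ofReal ?_) le_rfl))
        set r := (matsubaraRoot μ T k).im ^ 2 / ‖matsubaraRoot μ T k‖ ^ 2 with hr
        have hr0 : ρ ≤ r := hρk k
        have hr1 : r ≤ 1 := opening_le_one _
        have h2 : r ^ (-e) ≤ ρ ^ (-e) :=
          Real.rpow_le_rpow_of_nonpos hρ hr0 (by rw [he]; simp; positivity)
        calc r * r ^ (-e) ≤ 1 * ρ ^ (-e) :=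
              mul_le_mul hr1 h2 (Real.rpow_nonneg (hρ.le.trans hr0) _) zero_le_one
          _ = _ := one_mul _
    _ = _ := by
        rw [ENNReal.tsum_mul_left, ← convForm_tsum (fun k => measurable_resolventSqKernel _ _)
          hgm.enorm hfm.enorm]
        rfl

end BCSKernel

/-! ### The exponentially weighted kernel -/

section WeightedKernel

variable {E : Type*} [NormedAddCommGroup E] [InnerProductSpace ℝ E] [FiniteDimensional ℝ E]
  [MeasurableSpace E] [BorelSpace E]

/-- An exponential weight of rate `κ < y` is absorbed into the heat kernel at the cost of a dilation
of the time by `(1 - κ / y)⁻¹` and of a shift of the energy by `κ y`. -/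
lemma exp_mul_realHeatKernel_le {κ y t b : ℝ} (hκ : 0 < κ) (hκy : κ < y) (ht : 0 < t) (x : E) :
    Real.exp (κ * ‖x‖) * (Real.exp (-t * b) * realHeatKernel t x) ≤
      ((1 - κ / y)⁻¹) ^ (Module.finrank ℝ E / 2 : ℝ) *
        (Real.exp (-t * (b - κ * y)) * realHeatKernel ((1 - κ / y)⁻¹ * t) x) := by
  have hy : 0 < y := hκ.trans hκy
  have hl : 0 < 1 - κ / y := sub_pos.2 ((div_lt_one hy).2 hκy)
  set m := (1 - κ / y)⁻¹ with hm
  have hm0 : 0 < m := inv_pos.2 hl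
  have hpow : m ^ (Module.finrank ℝ E / 2 : ℝ) *
      (4 * Real.pi * (m * t))⁻¹ ^ (Module.finrank ℝ E / 2 : ℝ) =
      (4 * Real.pi * t)⁻¹ ^ (Module.finrank ℝ E / 2 : ℝ) := by
    rw [← Real.mul_rpow hm0.le (by positivity)]
    congr 1
    have := Real.pi_pos
    field_simp
  have hexp : Real.exp (κ * ‖x‖) * (Real.exp (-t * b) * Real.exp (-(‖x‖ ^ 2 / (4 * t)))) ≤
      Real.exp (-t * (b - κ * y)) * Real.exp (-(‖x‖ ^ 2 / (4 * (m * t)))) := by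
    rw [← Real.exp_add, ← Real.exp_add, ← Real.exp_add, Real.exp_le_exp]
    have e1 : ‖x‖ ^ 2 / (4 * (m * t)) = ‖x‖ ^ 2 / (4 * t) * (1 - κ / y) := by
      rw [hm]; field_simp
    rw [e1]
    -- the inequality of arithmetic and geometric means for `κ‖x‖ ≤ t κ y + (κ / y)‖x‖² / (4 t)`
    have h2 : κ * ‖x‖ ≤ t * (κ * y) + ‖x‖ ^ 2 / (4 * t) * (κ / y) := by
      have h3 : t * (κ * y) + ‖x‖ ^ 2 / (4 * t) * (κ / y) - κ * ‖x‖ =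
          κ / (4 * t * y) * (2 * t * y - ‖x‖) ^ 2 := by field_simp; ring
      have : 0 ≤ κ / (4 * t * y) * (2 * t * y - ‖x‖) ^ 2 := by positivity
      linarith
    linarith
  unfold realHeatKernel
  calc _ = (4 * Real.pi * t)⁻¹ ^ (Module.finrank ℝ E / 2 : ℝ) *
        (Real.exp (κ * ‖x‖) * (Real.exp (-t * b) * Real.exp (-(‖x‖ ^ 2 / (4 * t))))) := by ring
    _ ≤ (4 * Real.pi * t)⁻¹ ^ (Module.finrank ℝ E / 2 : ℝ) *
        (Real.exp (-t * (b - κ * y)) * Real.exp (-(‖x‖ ^ 2 / (4 * (m * t))))) :=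
        mul_le_mul_of_nonneg_left hexp (by positivity)
    _ = _ := by rw [← hpow]; ring

lemma exp_mul_resolventSqKernel_le {κ y b : ℝ} (hκ : 0 < κ) (hκy : κ < y) (x : E) :
    ENNReal.ofReal (Real.exp (κ * ‖x‖)) * resolventSqKernel 1 b x ≤
      ENNReal.ofReal (((1 - κ / y)⁻¹) ^ (Module.finrank ℝ E / 2 : ℝ)) *
        resolventSqKernel (1 - κ / y)⁻¹ (b - κ * y) x := by
  unfold resolventSqKernel
  rw [← lintegral_const_mul' _ _ ENNReal.ofReal_ne_top,
    ← lintegral_const_mul' _ _ ENNReal.ofReal_ne_top]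
  refine lintegral_mono_ae ?_
  filter_upwards [ae_quadrant] with q hq
  have hl : 0 < 1 - κ / y := sub_pos.2 ((div_lt_one (hκ.trans hκy)).2 hκy)
  rw [← ENNReal.ofReal_mul (by positivity), ← ENNReal.ofReal_mul (by positivity),
    ← ENNReal.ofReal_mul (by positivity), ← ENNReal.ofReal_mul (by positivity), one_mul]
  exact ENNReal.ofReal_le_ofReal (exp_mul_realHeatKernel_le hκ hκy (add_pos hq.1 hq.2) x)

/-- The sum over the Matsubara frequencies turns the squares of resolvents into a resolvent; the
proof compares it with a telescoping sum. -/
lemma tsum_inv_sq_le {ε δ A : ℝ} (hε : 0 < ε) (hδ : 0 < δ) (hA : ε ≤ A) {b : ℕ → ℝ}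
    (hb : ∀ k : ℕ, A + δ * k ≤ b k) :
    ∑' k, ENNReal.ofReal ((b k)⁻¹ ^ 2) ≤ ENNReal.ofReal ((1 + δ / ε) / δ * A⁻¹) := by
  have hA0 : 0 < A := hε.trans_le hA
  set F : ℕ → ℝ := fun k => (1 + δ / ε) / δ * (A + δ * k)⁻¹ with hF
  have hpos : ∀ k : ℕ, 0 < A + δ * k := fun k => by positivity
  have hstep : ∀ k : ℕ, (b k)⁻¹ ^ 2 ≤ F k - F (k + 1) := fun k => by
    have h1 : (b k)⁻¹ ^ 2 ≤ (A + δ * k)⁻¹ ^ 2 :=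
      pow_le_pow_left₀ (inv_nonneg.2 ((hpos k).le.trans (hb k))) (inv_anti₀ (hpos k) (hb k)) 2
    refine h1.trans ?_
    have h2 := hpos k
    have h3 : 0 < A + δ * (k + 1 : ℕ) := hpos (k + 1)
    have h4 : F k - F (k + 1) = (1 + δ / ε) * ((A + δ * k)⁻¹ * (A + δ * (k + 1 : ℕ))⁻¹) := by
      simp only [hF]; push_cast at h3 ⊢; field_simp; ring
    rw [h4, sq, mul_comm (1 + δ / ε), mul_assoc]
    refine mul_le_mul_of_nonneg_left ?_ (inv_nonneg.2 h2.le)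
    rw [inv_mul_eq_div, le_div_iff₀ h3, inv_mul_le_iff₀ h2]
    have h5 : δ ≤ δ / ε * (A + δ * k) := by
      rw [div_mul_eq_mul_div, le_div_iff₀ hε]
      have : 0 ≤ δ * k := by positivity
      nlinarith
    push_cast
    linarith
  refine ENNReal.tsum_le_of_sum_range_le fun n => ?_
  rw [← ENNReal.ofReal_sum_of_nonneg (fun k _ => by positivity)]
  refine ENNReal.ofReal_le_ofReal ((Finset.sum_le_sum fun k _ => hstep k).trans ?_)
  rw [Finset.sum_range_sub']
  have : 0 ≤ F n := by have := hpos n; simp only [hF]; positivity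
  have h0 : F 0 = (1 + δ / ε) / δ * A⁻¹ := by simp [hF]
  linarith

/-- With an exponential weight of a rate below the critical one, `bcsKernel` is still dominated by
a positive kernel whose Fourier multiplier is at most a multiple of `1 / (1 + ‖ξ‖²)`. -/
theorem exists_weighted_kernel (μ : ℝ) {T κ : ℝ} (hT : 0 < T) (hκ : 0 < κ)
    (hκc : κ < criticalRate μ T) :
    ∃ M : E → ℝ≥0∞, Measurable M ∧
      (∀ x, ENNReal.ofReal (Real.exp (κ * ‖x‖)) * bcsKernel μ T x ≤ M x) ∧
      ∃ C : ℝ, ∀ f g : E → ℝ, (∀ x, 0 ≤ f x) → (∀ x, 0 ≤ g x) → Measurable f → Measurable g →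
        Integrable f → Integrable g →
        convForm M (fun x => ENNReal.ofReal (g x)) (fun x => ENNReal.ofReal (f x)) ≤
        ENNReal.ofReal C * ∫⁻ ξ, ENNReal.ofReal ((1 + ‖ξ‖ ^ 2)⁻¹) *
          (‖𝓕 (fun x => (g x : ℂ)) ξ‖ₑ * ‖𝓕 (fun x => (f x : ℂ)) ξ‖ₑ) := by
  obtain ⟨δ, hδ, hδk⟩ := exists_matsubaraRoot_im_sq_ge (μ := μ) hT
  set y := criticalRate μ T with hy
  have hy0 : 0 < y := hκ.trans hκc
  have hl : 0 < 1 - κ / y := sub_pos.2 ((div_lt_one hy0).2 hκc)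
  set m := (1 - κ / y)⁻¹ with hm
  have hm0 : 0 < m := inv_pos.2 hl
  set e : ℝ := Module.finrank ℝ E / 2 with he
  set ε := y ^ 2 - κ * y with hε
  have hε0 : 0 < ε := by rw [hε]; nlinarith
  set c := min ε m with hc
  have hc0 : 0 < c := lt_min hε0 hm0
  have hmeas : ∀ k, Measurable (resolventSqKernel m ((matsubaraRoot μ T k).im ^ 2 - κ * y) :
    E → ℝ≥0∞) := fun k => measurable_resolventSqKernel _ _
  have hMmeas : Measurable (fun x : E => ∑' k,
    resolventSqKernel m ((matsubaraRoot μ T k).im ^ 2 - κ * y) x) := Measurable.tsum hmeas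
  refine ⟨fun x => ENNReal.ofReal (m ^ e) * ∑' k,
    resolventSqKernel m ((matsubaraRoot μ T k).im ^ 2 - κ * y) x, hMmeas.const_mul _,
    fun x => ?_, m ^ e * ((1 + δ / ε) / δ * c⁻¹), fun f g hf0 hg0 hfm hgm hf hg => ?_⟩
  · unfold bcsKernel
    beta_reduce
    rw [← ENNReal.tsum_mul_left, ← ENNReal.tsum_mul_left]
    exact ENNReal.tsum_le_tsum fun k => exp_mul_resolventSqKernel_le hκ hκc x
  rw [convForm_const_mul _ hMmeas hgm.ennreal_ofReal hfm.ennreal_ofReal,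
    convForm_tsum hmeas hgm.ennreal_ofReal hfm.ennreal_ofReal,
    ENNReal.ofReal_mul (by positivity), mul_assoc]
  refine mul_le_mul' le_rfl ?_
  set u : E → ℝ≥0∞ := fun ξ => ‖𝓕 (fun x => (g x : ℂ)) ξ‖ₑ * ‖𝓕 (fun x => (f x : ℂ)) ξ‖ₑ with hu
  have hum : Measurable u :=
    (continuous_fourier hg.ofReal).measurable.enorm.mul
      (continuous_fourier hf.ofReal).measurable.enorm
  have hbk : ∀ k : ℕ, ε + δ * k ≤ (matsubaraRoot μ T k).im ^ 2 - κ * y := fun k => by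
    have := hδk k; rw [hε]; linarith
  calc _ ≤ ∑' k : ℕ, ∫⁻ ξ, ENNReal.ofReal ((((matsubaraRoot μ T k).im ^ 2 - κ * y) +
        m * (2 * Real.pi * ‖ξ‖) ^ 2)⁻¹ ^ 2) * u ξ :=
        ENNReal.tsum_le_tsum fun k => convForm_resolventSqKernel_le hm0
          (lt_of_lt_of_le (by positivity) (hbk k)) hg0 hf0 hgm hfm hg hf
    _ = ∫⁻ ξ, (∑' k : ℕ, ENNReal.ofReal ((((matsubaraRoot μ T k).im ^ 2 - κ * y) +
        m * (2 * Real.pi * ‖ξ‖) ^ 2)⁻¹ ^ 2)) * u ξ := by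
        rw [← lintegral_tsum]
        · simp_rw [ENNReal.tsum_mul_right]
        · exact fun k => Measurable.aemeasurable (by fun_prop)
    _ ≤ ∫⁻ ξ, ENNReal.ofReal ((1 + δ / ε) / δ * c⁻¹) * (ENNReal.ofReal ((1 + ‖ξ‖ ^ 2)⁻¹) *
        u ξ) := by
        refine lintegral_mono fun ξ => ?_
        rw [← mul_assoc (ENNReal.ofReal _) (ENNReal.ofReal _) (u ξ)]
        refine mul_le_mul' ?_ le_rfl
        have h1 : 0 ≤ m * (2 * Real.pi * ‖ξ‖) ^ 2 := by positivity
        refine (tsum_inv_sq_le hε0 hδ (A := ε + m * (2 * Real.pi * ‖ξ‖) ^ 2) (by linarith)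
          (fun k => by linarith [hbk k])).trans ?_
        rw [← ENNReal.ofReal_mul (by positivity)]
        refine ENNReal.ofReal_le_ofReal ?_
        rw [mul_assoc ((1 + δ / ε) / δ) c⁻¹, ← mul_inv]
        refine mul_le_mul_of_nonneg_left (inv_anti₀ (by positivity) ?_) (by positivity)
        have h2 : ‖ξ‖ ^ 2 ≤ (2 * Real.pi * ‖ξ‖) ^ 2 := by
          refine pow_le_pow_left₀ (norm_nonneg _) ?_ 2
          have := Real.pi_gt_three
          nlinarith [norm_nonneg ξ]
        calc c * (1 + ‖ξ‖ ^ 2) = c + c * ‖ξ‖ ^ 2 := by ring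
          _ ≤ ε + m * (2 * Real.pi * ‖ξ‖) ^ 2 :=
            add_le_add (min_le_left _ _) (mul_le_mul (min_le_right _ _) h2 (by positivity) hm0.le)
    _ = _ := lintegral_const_mul' _ _ ENNReal.ofReal_ne_top

end WeightedKernel

/-! ### The Sobolev inequality -/

section Sobolev

lemma sq_lintegral_mul_le {α : Type*} [MeasurableSpace α] {ν : Measure α} {f g : α → ℝ≥0∞}
    (hf : AEMeasurable f ν) (hg : AEMeasurable g ν) :
    (∫⁻ a, f a * g a ∂ν) ^ 2 ≤ (∫⁻ a, f a ^ 2 ∂ν) * ∫⁻ a, g a ^ 2 ∂ν := by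
  have h := ENNReal.lintegral_mul_le_Lp_mul_Lq ν Real.HolderConjugate.two_two hf hg
  simp only [Pi.mul_apply, ENNReal.rpow_ofNat] at h
  calc _ ≤ ((∫⁻ a, f a ^ 2 ∂ν) ^ (1 / 2 : ℝ) * (∫⁻ a, g a ^ 2 ∂ν) ^ (1 / 2 : ℝ)) ^ 2 := by gcongr
    _ = _ := by
      rw [mul_pow, ← ENNReal.rpow_natCast, ← ENNReal.rpow_natCast, ← ENNReal.rpow_mul,
        ← ENNReal.rpow_mul]
      norm_num

variable {E : Type*} [NormedAddCommGroup E] [InnerProductSpace ℝ E] [FiniteDimensional ℝ E]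
  [MeasurableSpace E] [BorelSpace E]

lemma lintegral_ball_rpow_le {n s : ℝ} (hn : n = Module.finrank ℝ E) (hn1 : 1 ≤ n)
    (hs : 2 * s < n) : ∃ L : ℝ, 0 < L ∧ ∀ A : ℝ, 0 < A →
      ∫⁻ ξ in Metric.ball (0 : E) A, ENNReal.ofReal (‖ξ‖ ^ (-(2 * s))) ≤
        ENNReal.ofReal (A ^ (n - 2 * s) * L) := by
  have hint : ∀ A : ℝ, IntegrableOn (fun ξ : E => ‖ξ‖ ^ (-(2 * s))) (Metric.ball 0 A) := fun A =>
    integrableOn_ball_of_norm_le_rpow (C := 1) (α := 2 * s) (by rw [hn] at hn1; exact_mod_cast hn1)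
      (hn ▸ hs) (Filter.Eventually.of_forall fun x => by
        rw [Real.norm_of_nonneg (by positivity), one_mul])
      (Measurable.aestronglyMeasurable (by fun_prop))
  set L := ∫ ξ in Metric.ball (0 : E) 1, ‖ξ‖ ^ (-(2 * s)) with hL
  have hL0 : 0 ≤ L := integral_nonneg fun ξ => by positivity
  -- `L + 1` only serves to have a positive constant.
  refine ⟨L + 1, by linarith, fun A hA => ?_⟩
  rw [← ofReal_integral_eq_lintegral_ofReal (hint A)
    (Filter.Eventually.of_forall fun ξ => by positivity)]
  refine ENNReal.ofReal_le_ofReal ?_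
  have h := Measure.setIntegral_comp_smul_of_pos volume (fun ξ : E => ‖ξ‖ ^ (-(2 * s)))
    (Metric.ball (0 : E) 1) hA
  rw [smul_unitBall_of_pos hA] at h
  have h2 : ∫ ξ in Metric.ball (0 : E) 1, ‖A • ξ‖ ^ (-(2 * s)) = A ^ (-(2 * s)) * L := by
    rw [hL, ← integral_const_mul]
    congr 1; ext ξ
    rw [norm_smul, Real.norm_of_nonneg hA.le, Real.mul_rpow hA.le (norm_nonneg _)]
  rw [h2, smul_eq_mul] at h
  have hAn : 0 < A ^ Module.finrank ℝ E := by positivity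
  have h3 : ∫ ξ in Metric.ball (0 : E) A, ‖ξ‖ ^ (-(2 * s)) = A ^ (n - 2 * s) * L := by
    rw [sub_eq_add_neg, Real.rpow_add hA, hn, Real.rpow_natCast, mul_assoc, h,
      mul_inv_cancel_left₀ hAn.ne']
  rw [h3]
  exact mul_le_mul_of_nonneg_left (by linarith) (by positivity)

/-- Cauchy-Schwarz bound of the low frequencies by a Sobolev norm. -/
lemma lintegral_ball_enorm_le {v : E → ℂ} (hv : AEStronglyMeasurable v) {n s : ℝ}
    (hn1 : 1 ≤ n) (hn : n = Module.finrank ℝ E)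
    {L A B : ℝ} (hL : 0 ≤ L) (hA : 0 < A) (hB : 0 ≤ B)
    (hLA : ∫⁻ ξ in Metric.ball (0 : E) A, ENNReal.ofReal (‖ξ‖ ^ (-(2 * s))) ≤
      ENNReal.ofReal (A ^ (n - 2 * s) * L))
    (hvB : ∫⁻ ξ, ENNReal.ofReal (‖ξ‖ ^ (2 * s)) * ‖v ξ‖ₑ ^ 2 ≤ ENNReal.ofReal (B ^ 2)) :
    ∫⁻ ξ in Metric.ball (0 : E) A, ‖v ξ‖ₑ ≤
      ENNReal.ofReal (A ^ ((n - 2 * s) / 2) * √L * B) := by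
  have : Nontrivial E := Module.nontrivial_of_finrank_pos (R := ℝ) (by
    rw [hn] at hn1; exact_mod_cast hn1)
  have h0 : ∀ᵐ ξ : E, ξ ≠ 0 := Measure.ae_ne volume 0
  refine (ENNReal.pow_le_pow_left_iff two_ne_zero).1 ?_
  calc (∫⁻ ξ in Metric.ball (0 : E) A, ‖v ξ‖ₑ) ^ 2
      = (∫⁻ ξ in Metric.ball (0 : E) A, ENNReal.ofReal (‖ξ‖ ^ (-s)) *
        (ENNReal.ofReal (‖ξ‖ ^ s) * ‖v ξ‖ₑ)) ^ 2 := by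
        congr 1
        refine lintegral_congr_ae (ae_restrict_of_ae ?_)
        filter_upwards [h0] with ξ hξ
        rw [← mul_assoc, ← ENNReal.ofReal_mul (by positivity), ← Real.rpow_add (by positivity)]
        simp
    _ ≤ (∫⁻ ξ in Metric.ball (0 : E) A, ENNReal.ofReal (‖ξ‖ ^ (-s)) ^ 2) *
        ∫⁻ ξ in Metric.ball (0 : E) A, (ENNReal.ofReal (‖ξ‖ ^ s) * ‖v ξ‖ₑ) ^ 2 :=
        sq_lintegral_mul_le (by fun_prop)
          (AEMeasurable.mul (by fun_prop) hv.enorm.restrict)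
    _ ≤ ENNReal.ofReal (A ^ (n - 2 * s) * L) * ENNReal.ofReal (B ^ 2) := by
        refine mul_le_mul' (le_trans (le_of_eq ?_) hLA)
          ((setLIntegral_le_lintegral _ _).trans (le_trans (le_of_eq ?_) hvB))
        · congr 1; ext ξ
          rw [← ENNReal.ofReal_pow (by positivity), ← Real.rpow_natCast,
            ← Real.rpow_mul (by positivity)]
          congr 2; push_cast; ring
        · congr 1; ext ξ
          rw [mul_pow, ← ENNReal.ofReal_pow (by positivity), ← Real.rpow_natCast,
            ← Real.rpow_mul (by positivity)]
          congr 3; push_cast; ring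
    _ = _ := by
        rw [← ENNReal.ofReal_mul (by positivity), ← ENNReal.ofReal_pow (by positivity)]
        congr 1
        rw [mul_pow, mul_pow, Real.sq_sqrt hL, ← Real.rpow_natCast (A ^ ((n - 2 * s) / 2)),
          ← Real.rpow_mul hA.le]
        congr 3; push_cast; ring

/-- Splitting of the superlevel sets into low frequencies, which are bounded, and high frequencies,
to which Chebyshev's inequality is applied. -/
lemma measure_superlevel_le (u : Lp ℂ 2 (volume : Measure E)) {A t : ℝ} (ht : 0 < t)
    (hlow : ∫⁻ ξ in Metric.ball (0 : E) A, ‖(𝓕 u) ξ‖ₑ ≤ ENNReal.ofReal (t / 2)) :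
    volume {x | t < ‖u x‖} ≤
      ENNReal.ofReal (4 / t ^ 2) * ∫⁻ ξ in (Metric.ball (0 : E) A)ᶜ, ‖(𝓕 u) ξ‖ₑ ^ 2 := by
  set S := Metric.ball (0 : E) A with hS
  have hSm : MeasurableSet S := measurableSet_ball
  have hU : MemLp (𝓕 u : Lp ℂ 2 (volume : Measure E)) 2 := Lp.memLp _
  have hv2 : MemLp (S.indicator (𝓕 u : Lp ℂ 2 (volume : Measure E))) 2 := hU.indicator hSm
  have hv1 : Integrable (S.indicator (𝓕 u : Lp ℂ 2 (volume : Measure E))) := by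
    refine ⟨hv2.aestronglyMeasurable, ?_⟩
    rw [HasFiniteIntegral]
    simp_rw [enorm_indicator_eq_indicator_enorm]
    rw [lintegral_indicator hSm]
    exact hlow.trans_lt ENNReal.ofReal_lt_top
  set ul : Lp ℂ 2 (volume : Measure E) := 𝓕⁻ (hv2.toLp _) with hul
  have hulb : ∀ᵐ x, ‖ul x‖ ≤ t / 2 := by
    filter_upwards [fourierInv_toLp_ae_eq hv1 hv2] with x hx
    rw [hul, hx, Real.fourierInv_eq_fourier_neg]
    refine (norm_fourier_le _ _).trans ?_
    rw [integral_norm_eq_lintegral_enorm hv1.aestronglyMeasurable]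
    simp_rw [enorm_indicator_eq_indicator_enorm]
    rw [lintegral_indicator hSm]
    exact ENNReal.toReal_le_of_le_ofReal (by positivity) hlow
  -- The low-frequency part `ul` is at most `t / 2`, so the high-frequency part exceeds `t / 2`
  -- wherever `t < ‖u‖`.
  set uh := u - ul with huh
  have hFh : ∀ᵐ ξ, (𝓕 uh) ξ = Sᶜ.indicator (𝓕 u : Lp ℂ 2 (volume : Measure E)) ξ := by
    have e : 𝓕 uh = 𝓕 u - hv2.toLp _ := by
      rw [huh, hul, sub_eq_add_neg, FourierTransform.fourier_add, sub_eq_add_neg]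
      congr 1
      have := FourierTransform.fourier_smul (-1 : ℂ)
        (𝓕⁻ (hv2.toLp _) : Lp ℂ 2 (volume : Measure E))
      simp
    rw [e]
    filter_upwards [Lp.coeFn_sub (𝓕 u) (hv2.toLp _), hv2.coeFn_toLp] with ξ h1 h2
    rw [h1, Pi.sub_apply, h2, Set.indicator_compl, Pi.sub_apply]
  have hsub : volume {x | t < ‖u x‖} ≤ volume {x | ENNReal.ofReal (t ^ 2 / 4) ≤ ‖uh x‖ₑ ^ 2} := by
    refine measure_mono_ae ?_
    filter_upwards [hulb, Lp.coeFn_sub u ul] with x h1 h2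
    intro (h3 : t < ‖u x‖)
    change ENNReal.ofReal (t ^ 2 / 4) ≤ ‖uh x‖ₑ ^ 2
    rw [huh, h2, Pi.sub_apply, ← ofReal_norm, ← ENNReal.ofReal_pow (norm_nonneg _)]
    refine ENNReal.ofReal_le_ofReal ?_
    have h4 := norm_sub_norm_le (u x) (ul x)
    nlinarith
  refine hsub.trans ?_
  have hcheb := mul_meas_ge_le_lintegral₀ (μ := volume)
    ((Lp.aestronglyMeasurable uh).enorm.pow_const 2) (ENNReal.ofReal (t ^ 2 / 4))
  rw [← lintegral_enorm_fourier_sq] at hcheb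
  have e2 : ∫⁻ ξ, ‖(𝓕 uh) ξ‖ₑ ^ 2 = ∫⁻ ξ in Sᶜ, ‖(𝓕 u) ξ‖ₑ ^ 2 := by
    rw [← lintegral_indicator hSm.compl]
    refine lintegral_congr_ae ?_
    filter_upwards [hFh] with ξ hξ
    rw [hξ]
    by_cases h : ξ ∈ Sᶜ
    · rw [Set.indicator_of_mem h, Set.indicator_of_mem h]
    · rw [Set.indicator_of_notMem h, Set.indicator_of_notMem h]; simp
  rw [e2] at hcheb
  calc _ = ENNReal.ofReal (4 / t ^ 2) * (ENNReal.ofReal (t ^ 2 / 4) *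
        volume {x | ENNReal.ofReal (t ^ 2 / 4) ≤ ‖uh x‖ₑ ^ 2}) := by
        rw [← mul_assoc, ← ENNReal.ofReal_mul (by positivity),
          show 4 / t ^ 2 * (t ^ 2 / 4) = 1 by field_simp]
        simp
    _ ≤ _ := mul_le_mul' le_rfl hcheb

lemma lintegral_Ioc_rpow {r b : ℝ} (hr : -1 < r) (hb : 0 ≤ b) :
    ∫⁻ t in Set.Ioc 0 b, ENNReal.ofReal (t ^ r) = ENNReal.ofReal (b ^ (r + 1) / (r + 1)) := by
  rw [← ofReal_integral_eq_lintegral_ofReal, ← intervalIntegral.integral_of_le hb,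
    integral_rpow (Or.inl hr), Real.zero_rpow (by linarith), sub_zero]
  · exact (intervalIntegrable_iff_integrableOn_Ioc_of_le hb).1
      (intervalIntegral.intervalIntegrable_rpow' hr)
  · filter_upwards [ae_restrict_mem measurableSet_Ioc] with t ht
    exact Real.rpow_nonneg ht.1.le _

/-- The Sobolev embedding `Ḣˢ ⊂ L^q`, `q = 2 n / (n - 2 s)`, by the Chemin-Xu argument: each
superlevel set comes with its own cut-off between low and high frequencies. -/
theorem exists_sobolev {n s : ℝ} (hn1 : 1 ≤ n) (hn : n = Module.finrank ℝ E) (hs0 : 0 < s)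
    (hs : 2 * s < n) : ∃ C : ℝ, ∀ (u : Lp ℂ 2 (volume : Measure E)) (B : ℝ), 0 < B →
      ∫⁻ ξ, ENNReal.ofReal (‖ξ‖ ^ (2 * s)) * ‖(𝓕 u) ξ‖ₑ ^ 2 ≤ ENNReal.ofReal (B ^ 2) →
      ∫⁻ x, ‖u x‖ₑ ^ (2 * n / (n - 2 * s)) ≤ ENNReal.ofReal (C * B ^ (2 * n / (n - 2 * s))) := by
  obtain ⟨L, hL, hLA⟩ := lintegral_ball_rpow_le (E := E) hn hn1 hs
  set a := (n - 2 * s) / 2 with ha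
  have ha0 : 0 < a := by rw [ha]; linarith
  set q := 2 * n / (n - 2 * s) with hq
  have hq2 : q - 2 = 2 * s / a := by
    rw [hq, ha]; have : n - 2 * s ≠ 0 := by linarith
    field_simp; ring
  have hq2pos : 0 < q - 2 := by rw [hq2]; positivity
  refine ⟨q * 4 * (2 * √L) ^ (q - 2) / (q - 2), fun u B hB hU => ?_⟩
  set K := 2 * √L * B with hK
  have hK0 : 0 < K := by have := Real.sqrt_pos.2 hL; positivity
  set w : E → ℝ≥0∞ := fun ξ => ‖(𝓕 u) ξ‖ₑ ^ 2 with hw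
  have hwm : Measurable w := (Lp.stronglyMeasurable _).measurable.enorm.pow_const 2
  -- the cut-off of the level `t` is `A` with `K A ^ a = t`
  have hlevel : ∀ t : ℝ, 0 < t → volume {x | t < ‖u x‖} ≤
      ENNReal.ofReal (4 / t ^ 2) * ∫⁻ ξ, (Set.Iic (K * ‖ξ‖ ^ a)).indicator 1 t * w ξ := by
    intro t ht
    set A := (t / K) ^ (1 / a) with hA
    have hA0 : 0 < A := by positivity
    have hAa : A ^ a = t / K := by
      rw [hA, ← Real.rpow_mul (by positivity), one_div_mul_cancel ha0.ne', Real.rpow_one]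
    have hlow := lintegral_ball_enorm_le (v := (𝓕 u : Lp ℂ 2 (volume : Measure E)))
      (Lp.aestronglyMeasurable _) hn1 hn hL.le hA0 hB.le (hLA A hA0) hU
    rw [← ha, hAa, show t / K * √L * B = t / 2 by
      rw [hK]; have := Real.sqrt_pos.2 hL; field_simp] at hlow
    refine (measure_superlevel_le u ht hlow).trans (mul_le_mul' le_rfl ?_)
    rw [← lintegral_indicator measurableSet_ball.compl]
    refine lintegral_mono fun ξ => ?_
    by_cases hξ : ξ ∈ (Metric.ball (0 : E) A)ᶜ
    · have h1 : A ≤ ‖ξ‖ := by simpa using hξ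
      have h2 : t ∈ Set.Iic (K * ‖ξ‖ ^ a) := by
        have h3 : A ^ a ≤ ‖ξ‖ ^ a := Real.rpow_le_rpow hA0.le h1 ha0.le
        rw [hAa, div_le_iff₀ hK0] at h3
        simpa [mul_comm] using h3
      rw [Set.indicator_of_mem hξ, Set.indicator_of_mem h2]
      simp [hw]
    · rw [Set.indicator_of_notMem hξ]; exact zero_le
  have hcake := lintegral_rpow_eq_lintegral_meas_lt_mul (volume : Measure E)
    (f := fun x => ‖u x‖) (Filter.Eventually.of_forall fun x => norm_nonneg _)
    (Lp.aestronglyMeasurable u).norm.aemeasurable (p := q) (by linarith)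
  calc ∫⁻ x, ‖u x‖ₑ ^ q = ∫⁻ x, ENNReal.ofReal (‖u x‖ ^ q) := by
        congr 1; ext x
        rw [← ofReal_norm, ENNReal.ofReal_rpow_of_nonneg (norm_nonneg _) (by linarith)]
    _ ≤ ENNReal.ofReal q * ∫⁻ t in Set.Ioi (0 : ℝ), ENNReal.ofReal 4 *
        ∫⁻ ξ, (Set.Iic (K * ‖ξ‖ ^ a)).indicator 1 t * (ENNReal.ofReal (t ^ (q - 3)) * w ξ) := by
        rw [hcake]
        refine mul_le_mul' le_rfl (lintegral_mono_ae ?_)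
        filter_upwards [ae_restrict_mem measurableSet_Ioi] with t ht
        have ht : 0 < t := ht
        refine (mul_le_mul' (hlevel t ht) le_rfl).trans (le_of_eq ?_)
        have e1 : ENNReal.ofReal (4 / t ^ 2) * ENNReal.ofReal (t ^ (q - 1)) =
            ENNReal.ofReal 4 * ENNReal.ofReal (t ^ (q - 3)) := by
          rw [← ENNReal.ofReal_mul (by positivity), ← ENNReal.ofReal_mul (by positivity)]
          congr 1
          rw [show q - 1 = (q - 3) + 2 by ring, Real.rpow_add ht, Real.rpow_ofNat]
          field_simp
        rw [mul_right_comm, e1, mul_assoc, ← lintegral_const_mul' _ _ ENNReal.ofReal_ne_top]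
        congr 2; ext ξ; ring
    _ = ENNReal.ofReal q * (ENNReal.ofReal 4 * ∫⁻ ξ, (∫⁻ t in Set.Ioc 0 (K * ‖ξ‖ ^ a),
        ENNReal.ofReal (t ^ (q - 3))) * w ξ) := by
        rw [lintegral_const_mul' _ _ ENNReal.ofReal_ne_top, lintegral_lintegral_swap]
        · congr 3; ext ξ
          simp_rw [← mul_assoc]
          rw [lintegral_mul_const]
          · congr 1
            rw [← Set.Ioi_inter_Iic, Set.inter_comm, ← Measure.restrict_restrict measurableSet_Iic,
              ← lintegral_indicator measurableSet_Iic]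
            congr 1; ext t
            by_cases h : t ∈ Set.Iic (K * ‖ξ‖ ^ a)
            · rw [Set.indicator_of_mem h, Set.indicator_of_mem h]; simp
            · rw [Set.indicator_of_notMem h, Set.indicator_of_notMem h]; simp
          · exact (measurable_one.indicator measurableSet_Iic).mul (by fun_prop)
        · refine Measurable.aemeasurable (Measurable.mul ?_ (by fun_prop))
          have : (fun p : ℝ × E => (Set.Iic (K * ‖p.2‖ ^ a)).indicator (1 : ℝ → ℝ≥0∞) p.1) =
              Set.indicator {p : ℝ × E | p.1 ≤ K * ‖p.2‖ ^ a} 1 := by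
            ext p; simp [Set.indicator]
          change Measurable (fun p : ℝ × E => (Set.Iic (K * ‖p.2‖ ^ a)).indicator 1 p.1)
          rw [this]
          exact measurable_one.indicator (measurableSet_le (by fun_prop) (by fun_prop))
    _ = ENNReal.ofReal q * (ENNReal.ofReal 4 * (ENNReal.ofReal (K ^ (q - 2) / (q - 2)) *
        ∫⁻ ξ, ENNReal.ofReal (‖ξ‖ ^ (2 * s)) * w ξ)) := by
        rw [← lintegral_const_mul' (ENNReal.ofReal (K ^ (q - 2) / (q - 2))) _
          ENNReal.ofReal_ne_top]
        congr 2
        refine lintegral_congr fun ξ => ?_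
        rw [lintegral_Ioc_rpow (by linarith) (by positivity), ← mul_assoc,
          ← ENNReal.ofReal_mul (by positivity)]
        congr 2
        rw [show q - 3 + 1 = q - 2 by ring, Real.mul_rpow hK0.le (by positivity),
          ← Real.rpow_mul (norm_nonneg _), hq2, mul_div_cancel₀ _ ha0.ne']
        ring
    _ ≤ ENNReal.ofReal q * (ENNReal.ofReal 4 * (ENNReal.ofReal (K ^ (q - 2) / (q - 2)) *
        ENNReal.ofReal (B ^ 2))) := by gcongr
    _ = _ := by
        rw [← ENNReal.ofReal_mul (by positivity), ← ENNReal.ofReal_mul (by positivity),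
          ← ENNReal.ofReal_mul (by linarith)]
        congr 1
        have hBq : B ^ q = B ^ (q - 2) * B ^ 2 := by
          rw [← Real.rpow_natCast B 2, ← Real.rpow_add hB]; congr 1; push_cast; ring
        rw [hBq, hK, Real.mul_rpow (by positivity) hB.le]
        ring

end Sobolev

/-! ### Form bounds of potentials in `Lᵖ` -/

section FormBound

lemma enorm_fourier_le {E : Type*} [NormedAddCommGroup E] [InnerProductSpace ℝ E]
    [FiniteDimensional ℝ E] [MeasurableSpace E] [BorelSpace E] (f : E → ℂ) (ξ : E) :
    ‖𝓕 f ξ‖ₑ ≤ ∫⁻ x, ‖f x‖ₑ := by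
  rw [Real.fourier_eq']
  refine (enorm_integral_le_lintegral_enorm _).trans (le_of_eq (lintegral_congr fun x => ?_))
  rw [smul_eq_mul, enorm_mul, ← ofReal_norm (Complex.exp _), Complex.norm_exp_ofReal_mul_I]
  simp

/-- The squared `H¹` norm, `∫ (1 + ‖ξ‖²) |û(ξ)|² dξ`. -/
noncomputable def sobolevEnergy {d : ℕ}
    (u : Lp ℂ 2 (volume : Measure (EuclideanSpace ℝ (Fin d)))) : ℝ≥0∞ :=
  ∫⁻ ξ, ENNReal.ofReal (1 + ‖ξ‖ ^ 2) * ‖(𝓕 u) ξ‖ₑ ^ 2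

/-- In dimension one, `H¹` functions are bounded. -/
lemma exists_form_bound_one :
    ∃ C : ℝ, 0 ≤ C ∧ ∀ (W : EuclideanSpace ℝ (Fin 1) → ℝ), AEStronglyMeasurable W →
      ∀ (u : Lp ℂ 2 (volume : Measure (EuclideanSpace ℝ (Fin 1)))) (B : ℝ), 0 < B →
        sobolevEnergy u ≤ ENNReal.ofReal (B ^ 2) →
        ∫⁻ x, ‖W x‖ₑ * ‖u x‖ₑ ^ 2 ≤ ENNReal.ofReal (C * B ^ 2) * eLpNorm W 1 volume := by
  have hint : Integrable (fun ξ : EuclideanSpace ℝ (Fin 1) => (1 + ‖ξ‖ ^ 2)⁻¹) := by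
    have h := integrable_rpow_neg_one_add_norm_sq (μ := (volume : Measure
      (EuclideanSpace ℝ (Fin 1)))) (r := 2) (by simp)
    refine h.congr (Filter.Eventually.of_forall fun ξ => ?_)
    simp only [neg_div_self (two_ne_zero' ℝ), Real.rpow_neg_one]
  set C := ∫ ξ : EuclideanSpace ℝ (Fin 1), (1 + ‖ξ‖ ^ 2)⁻¹ with hC
  have hC0 : 0 ≤ C := integral_nonneg fun ξ => by positivity
  refine ⟨C, hC0, fun W hW u B hB hu => ?_⟩
  have hUm : AEMeasurable (fun ξ => ‖(𝓕 u) ξ‖ₑ) := (Lp.aestronglyMeasurable _).enorm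
  have hL1 : (∫⁻ ξ, ‖(𝓕 u) ξ‖ₑ) ^ 2 ≤ ENNReal.ofReal (C * B ^ 2) := by
    calc (∫⁻ ξ, ‖(𝓕 u) ξ‖ₑ) ^ 2 = (∫⁻ ξ, ENNReal.ofReal (√((1 + ‖ξ‖ ^ 2)⁻¹)) *
          (ENNReal.ofReal (√(1 + ‖ξ‖ ^ 2)) * ‖(𝓕 u) ξ‖ₑ)) ^ 2 := by
          congr 1
          refine lintegral_congr fun ξ => ?_
          rw [← mul_assoc, ← ENNReal.ofReal_mul (by positivity), ← Real.sqrt_mul (by positivity),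
            inv_mul_cancel₀ (by positivity)]
          simp
      _ ≤ (∫⁻ ξ : EuclideanSpace ℝ (Fin 1), ENNReal.ofReal (√((1 + ‖ξ‖ ^ 2)⁻¹)) ^ 2) *
          ∫⁻ ξ, (ENNReal.ofReal (√(1 + ‖ξ‖ ^ 2)) * ‖(𝓕 u) ξ‖ₑ) ^ 2 :=
          sq_lintegral_mul_le (by fun_prop) (AEMeasurable.mul (by fun_prop) hUm)
      _ ≤ ENNReal.ofReal C * ENNReal.ofReal (B ^ 2) := by
          refine mul_le_mul' (le_of_eq ?_) (le_trans (le_of_eq ?_) hu)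
          · rw [hC, ofReal_integral_eq_lintegral_ofReal hint
              (Filter.Eventually.of_forall fun ξ => by positivity)]
            refine lintegral_congr fun ξ => ?_
            rw [← ENNReal.ofReal_pow (by positivity), Real.sq_sqrt (by positivity)]
          · refine lintegral_congr fun ξ => ?_
            rw [mul_pow, ← ENNReal.ofReal_pow (by positivity), Real.sq_sqrt (by positivity)]
      _ = _ := (ENNReal.ofReal_mul hC0).symm
  have hi : Integrable (𝓕 u : Lp ℂ 2 (volume : Measure (EuclideanSpace ℝ (Fin 1)))) := by
    refine ⟨Lp.aestronglyMeasurable _, ?_⟩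
    rw [HasFiniteIntegral, lt_top_iff_ne_top]
    intro h
    rw [h] at hL1
    simp at hL1
  have hsup : ∀ᵐ x, ‖u x‖ₑ ^ 2 ≤ ENNReal.ofReal (C * B ^ 2) := by
    have h := fourierInv_toLp_ae_eq hi (Lp.memLp _)
    rw [Lp.toLp_coeFn, FourierTransform.fourierInv_fourier_eq] at h
    filter_upwards [h] with x hx
    refine le_trans (pow_le_pow_left' ?_ 2) hL1
    rw [hx, Real.fourierInv_eq_fourier_neg]
    exact enorm_fourier_le _ _
  rw [eLpNorm_one_eq_lintegral_enorm, ← lintegral_const_mul' _ _ ENNReal.ofReal_ne_top]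
  refine lintegral_mono_ae ?_
  filter_upwards [hsup] with x hx
  rw [mul_comm]
  exact mul_le_mul' hx le_rfl

/-- Hölder's inequality and the Sobolev inequality of order `s = d / (2 r) ≤ 1`. -/
lemma exists_form_bound_of_one_lt {d : ℕ} {r : ℝ} (hd : 1 ≤ d) (hr1 : 1 < r)
    (hdr : (d : ℝ) ≤ 2 * r) :
    ∃ C : ℝ, 0 ≤ C ∧ ∀ (W : EuclideanSpace ℝ (Fin d) → ℝ), AEStronglyMeasurable W →
      ∀ (u : Lp ℂ 2 (volume : Measure (EuclideanSpace ℝ (Fin d)))) (B : ℝ), 0 < B →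
        sobolevEnergy u ≤ ENNReal.ofReal (B ^ 2) →
        ∫⁻ x, ‖W x‖ₑ * ‖u x‖ₑ ^ 2 ≤
          ENNReal.ofReal (C * B ^ 2) * eLpNorm W (ENNReal.ofReal r) volume := by
  have hd' : (1 : ℝ) ≤ d := by exact_mod_cast hd
  have hr0 : 0 < r := by linarith
  set s : ℝ := d / (2 * r) with hs
  have hs0 : 0 < s := by positivity
  have hs1 : s ≤ 1 := (div_le_one (by positivity)).2 hdr
  have h2s : 2 * s = d / r := by rw [hs]; field_simp
  have hsd : 2 * s < d := by rw [h2s]; exact div_lt_self (by linarith) hr1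
  obtain ⟨C₀, hC₀⟩ := exists_sobolev (E := EuclideanSpace ℝ (Fin d)) hd' (by simp) hs0 hsd
  have hconj := Real.HolderConjugate.conjExponent hr1
  set r' := r.conjExponent with hr'
  have hr'0 : 0 < r' := hconj.symm.pos
  have hq : 2 * (d : ℝ) / (d - 2 * s) = 2 * r' := by
    rw [h2s, hr', Real.conjExponent]
    have : r - 1 ≠ 0 := by linarith
    have : (d : ℝ) ≠ 0 := by linarith
    have h3 : (d : ℝ) - d / r = d * (r - 1) / r := by field_simp
    rw [h3]; field_simp
  rw [hq] at hC₀
  refine ⟨max C₀ 0 ^ (1 / r'), by positivity, fun W hW u B hB hu => ?_⟩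
  have hU : ∫⁻ ξ, ENNReal.ofReal (‖ξ‖ ^ (2 * s)) * ‖(𝓕 u) ξ‖ₑ ^ 2 ≤ ENNReal.ofReal (B ^ 2) := by
    refine le_trans (lintegral_mono fun ξ => mul_le_mul' (ENNReal.ofReal_le_ofReal ?_) le_rfl) hu
    rcases le_total ‖ξ‖ 1 with h | h
    · have := Real.rpow_le_one (norm_nonneg ξ) h (by positivity : 0 ≤ 2 * s)
      have := sq_nonneg ‖ξ‖
      linarith
    · have h1 : ‖ξ‖ ^ (2 * s) ≤ ‖ξ‖ ^ (2 : ℝ) := Real.rpow_le_rpow_of_exponent_le h (by linarith)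
      rw [Real.rpow_ofNat] at h1
      linarith
  have hS := hC₀ u B hB hU
  have hum : AEMeasurable (fun x => ‖u x‖ₑ) := (Lp.aestronglyMeasurable _).enorm
  have hH := ENNReal.lintegral_mul_le_Lp_mul_Lq volume hconj hW.enorm (hum.pow_const 2)
  simp only [Pi.mul_apply] at hH
  refine hH.trans ?_
  rw [mul_comm, eLpNorm_eq_lintegral_rpow_enorm_toReal (by simpa using hr0) ENNReal.ofReal_ne_top,
    ENNReal.toReal_ofReal hr0.le]
  refine mul_le_mul' ?_ le_rfl
  have e1 : ∀ x, (‖u x‖ₑ ^ 2) ^ r' = ‖u x‖ₑ ^ (2 * r') := fun x => by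
    rw [← ENNReal.rpow_natCast, ← ENNReal.rpow_mul]; norm_num
  simp_rw [e1]
  calc _ ≤ ENNReal.ofReal (max C₀ 0 * B ^ (2 * r')) ^ (1 / r') := by
        refine ENNReal.rpow_le_rpow (hS.trans (ENNReal.ofReal_le_ofReal ?_)) (by positivity)
        exact mul_le_mul_of_nonneg_right (le_max_left _ _) (by positivity)
    _ = _ := by
        rw [ENNReal.ofReal_rpow_of_nonneg (by positivity) (by positivity),
          Real.mul_rpow (by positivity) (by positivity), ← Real.rpow_mul hB.le]
        rw [show 2 * r' * (1 / r') = (2 : ℝ) by field_simp, Real.rpow_ofNat]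

/-- A potential in the admissible `Lᵖ` class is form-bounded with respect to `1 - Δ`, with a bound
proportional to its `Lᵖ` norm. -/
theorem exists_form_bound {d : ℕ} {p : ℝ≥0∞} (hp : AdmissibleExponent d p) :
    ∃ C : ℝ≥0∞, C ≠ ⊤ ∧ ∀ (W : EuclideanSpace ℝ (Fin d) → ℝ), MemLp W p →
      ∀ u : Lp ℂ 2 (volume : Measure (EuclideanSpace ℝ (Fin d))), sobolevEnergy u ≠ ⊤ →
        ∫⁻ x, ‖W x‖ₑ * ‖u x‖ₑ ^ 2 ≤ C * eLpNorm W p volume * sobolevEnergy u := by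
  have key : ∃ C : ℝ, 0 ≤ C ∧ ∀ (W : EuclideanSpace ℝ (Fin d) → ℝ), AEStronglyMeasurable W →
      ∀ (u : Lp ℂ 2 (volume : Measure (EuclideanSpace ℝ (Fin d)))) (B : ℝ), 0 < B →
        sobolevEnergy u ≤ ENNReal.ofReal (B ^ 2) →
        ∫⁻ x, ‖W x‖ₑ * ‖u x‖ₑ ^ 2 ≤ ENNReal.ofReal (C * B ^ 2) * eLpNorm W p volume := by
    rcases hp with ⟨rfl, rfl⟩ | ⟨rfl, h1, h2⟩ | ⟨rfl, rfl⟩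
    · exact exists_form_bound_one
    · have hr : 1 < p.toReal := by
        have := (ENNReal.toReal_lt_toReal ENNReal.one_ne_top h2.ne).2 h1
        simpa using this
      have := exists_form_bound_of_one_lt (d := 2) one_le_two hr (by push_cast; linarith)
      rwa [ENNReal.ofReal_toReal h2.ne] at this
    · have := exists_form_bound_of_one_lt (d := 3) (r := 3 / 2) (by norm_num) (by norm_num)
        (by norm_num)
      rwa [ENNReal.ofReal_div_of_pos (by norm_num), ENNReal.ofReal_ofNat, ENNReal.ofReal_ofNat]
        at this
  obtain ⟨C, hC0, hC⟩ := key
  refine ⟨ENNReal.ofReal C, ENNReal.ofReal_ne_top, fun W hW u hu => ?_⟩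
  set h := (sobolevEnergy u).toReal with hh
  have hh0 : 0 ≤ h := ENNReal.toReal_nonneg
  have hε : ∀ ε : ℝ, 0 < ε → ∫⁻ x, ‖W x‖ₑ * ‖u x‖ₑ ^ 2 ≤
      ENNReal.ofReal (C * (h + ε)) * eLpNorm W p volume := fun ε hε => by
    have := hC W hW.1 u (√(h + ε)) (Real.sqrt_pos.2 (by linarith)) (by
      rw [Real.sq_sqrt (by linarith), ← ENNReal.ofReal_toReal hu]
      exact ENNReal.ofReal_le_ofReal (by linarith))
    rwa [Real.sq_sqrt (by linarith)] at this
  have hlim : Filter.Tendsto (fun ε : ℝ => ENNReal.ofReal (C * (h + ε)) * eLpNorm W p volume)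
      (nhdsWithin 0 (Set.Ioi 0)) (nhds (ENNReal.ofReal (C * (h + 0)) * eLpNorm W p volume)) := by
    refine ENNReal.Tendsto.mul_const ?_ (Or.inr hW.2.ne)
    refine (ENNReal.continuous_ofReal.comp (by fun_prop :
      Continuous fun ε : ℝ => C * (h + ε))).tendsto 0 |>.mono_left nhdsWithin_le_nhds
  have := ge_of_tendsto hlim (Filter.eventually_of_mem self_mem_nhdsWithin hε)
  rw [add_zero, ENNReal.ofReal_mul hC0, hh, ENNReal.ofReal_toReal hu] at this
  rwa [mul_right_comm]

/-- The dual of the form bound: `√|W| g` lies in `H⁻¹` for `g ∈ L²`. The bound is tested with the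
function `u` whose Fourier transform is `(1 + ‖ξ‖²)⁻¹ f̂`. -/
theorem exists_dual_form_bound {d : ℕ} {p : ℝ≥0∞} (hp : AdmissibleExponent d p) :
    ∃ C : ℝ≥0∞, C ≠ ⊤ ∧ ∀ (W : EuclideanSpace ℝ (Fin d) → ℝ), MemLp W p →
      ∀ f : EuclideanSpace ℝ (Fin d) → ℂ, Integrable f → MemLp f 2 →
      ∀ g : EuclideanSpace ℝ (Fin d) → ℝ≥0∞, AEMeasurable g →
        (∀ x, ‖f x‖ₑ ≤ ‖W x‖ₑ ^ (1 / 2 : ℝ) * g x) →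
        ∫⁻ ξ, ENNReal.ofReal ((1 + ‖ξ‖ ^ 2)⁻¹) * ‖𝓕 f ξ‖ₑ ^ 2 ≤
          C * eLpNorm W p volume * ∫⁻ x, g x ^ 2 := by
  obtain ⟨C, hC, hCW⟩ := exists_form_bound hp
  refine ⟨C, hC, fun W hW f hf1 hf2 g hg hfg => ?_⟩
  set F : Lp ℂ 2 (volume : Measure (EuclideanSpace ℝ (Fin d))) := hf2.toLp f with hF
  set I := ∫⁻ ξ, ENNReal.ofReal ((1 + ‖ξ‖ ^ 2)⁻¹) * ‖𝓕 f ξ‖ₑ ^ 2 with hI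
  have hle1 : ∀ ξ : EuclideanSpace ℝ (Fin d), (1 + ‖ξ‖ ^ 2)⁻¹ ≤ 1 := fun ξ =>
    inv_le_one_of_one_le₀ (by have := sq_nonneg ‖ξ‖; linarith)
  have hFf : (fun ξ => (𝓕 F) ξ) =ᵐ[volume] 𝓕 f := fourier_toLp_ae_eq hf1 hf2
  have hI' : I = ∫⁻ ξ, ENNReal.ofReal ((1 + ‖ξ‖ ^ 2)⁻¹) * ‖(𝓕 F) ξ‖ₑ ^ 2 := by
    refine lintegral_congr_ae ?_
    filter_upwards [hFf] with ξ hξ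
    rw [hξ]
  have hFsq : ∫⁻ ξ, ‖(𝓕 F) ξ‖ₑ ^ 2 ≠ ⊤ := by
    have := (Lp.memLp (𝓕 F)).2
    rw [eLpNorm_lt_top_iff_lintegral_rpow_enorm_lt_top (by norm_num) (by norm_num)] at this
    simpa using this.ne
  have hItop : I ≠ ⊤ := by
    rw [hI']
    refine ne_top_of_le_ne_top hFsq (lintegral_mono fun ξ => ?_)
    refine mul_le_of_le_one_left' ?_
    rw [← ENNReal.ofReal_one]
    exact ENNReal.ofReal_le_ofReal (hle1 ξ)
  have hv2 : MemLp (fun ξ => (((1 + ‖ξ‖ ^ 2)⁻¹ : ℝ) : ℂ) * (𝓕 F) ξ) 2 := by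
    refine (Lp.memLp (𝓕 F)).mono ?_ (Filter.Eventually.of_forall fun ξ => ?_)
    · exact (Measurable.aestronglyMeasurable (by fun_prop)).mul (Lp.aestronglyMeasurable _)
    · rw [norm_mul, Complex.norm_of_nonneg (by positivity)]
      exact mul_le_of_le_one_left (norm_nonneg _) (hle1 ξ)
  set u : Lp ℂ 2 (volume : Measure (EuclideanSpace ℝ (Fin d))) := 𝓕⁻ (hv2.toLp _) with hu
  have hFu : ∀ᵐ ξ, (𝓕 u) ξ = (((1 + ‖ξ‖ ^ 2)⁻¹ : ℝ) : ℂ) * (𝓕 F) ξ := by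
    rw [hu, FourierTransform.fourier_fourierInv_eq]; exact hv2.coeFn_toLp
  have hHu : sobolevEnergy u = I := by
    rw [hI']
    refine lintegral_congr_ae ?_
    filter_upwards [hFu] with ξ hξ
    rw [hξ, enorm_mul, mul_pow, ← mul_assoc, ← ofReal_norm (((1 + ‖ξ‖ ^ 2)⁻¹ : ℝ) : ℂ),
      Complex.norm_of_nonneg (by positivity), ← ENNReal.ofReal_pow (by positivity),
      ← ENNReal.ofReal_mul (by positivity)]
    congr 2
    field_simp
  have hpair : I ≤ ∫⁻ x, ‖f x‖ₑ * ‖u x‖ₑ := by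
    have h1 := integral_conj_fourier_mul F u
    have h2 : ∫ ξ, conj ((𝓕 F) ξ) * (𝓕 u) ξ =
        ((∫ ξ, (1 + ‖ξ‖ ^ 2)⁻¹ * ‖(𝓕 F) ξ‖ ^ 2 : ℝ) : ℂ) := by
      rw [← integral_complex_ofReal]
      refine integral_congr_ae ?_
      filter_upwards [hFu] with ξ hξ
      rw [hξ, mul_left_comm, Complex.conj_mul']
      push_cast; rfl
    have h4 : Integrable (fun ξ => (1 + ‖ξ‖ ^ 2)⁻¹ * ‖(𝓕 F) ξ‖ ^ 2) := by
      refine (Lp.memLp (𝓕 F)).integrable_norm_pow two_ne_zero |>.bdd_mul (c := 1)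
        (Measurable.aestronglyMeasurable (by fun_prop))
        (Filter.Eventually.of_forall fun ξ => ?_)
      rw [Real.norm_of_nonneg (by positivity)]; exact hle1 ξ
    have h3 : I = ENNReal.ofReal (∫ ξ, (1 + ‖ξ‖ ^ 2)⁻¹ * ‖(𝓕 F) ξ‖ ^ 2) := by
      rw [hI', ofReal_integral_eq_lintegral_ofReal h4
        (Filter.Eventually.of_forall fun ξ => by positivity)]
      refine lintegral_congr fun ξ => ?_
      rw [ENNReal.ofReal_mul (by positivity), ENNReal.ofReal_pow (norm_nonneg _), ofReal_norm]
    calc I ≤ ‖∫ x, conj (F x) * u x‖ₑ := by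
          rw [← h1, h2, h3, ← ofReal_norm]
          exact ENNReal.ofReal_le_ofReal (by simpa using le_abs_self _)
      _ ≤ ∫⁻ x, ‖conj (F x) * u x‖ₑ := enorm_integral_le_lintegral_enorm _
      _ = _ := by
          refine lintegral_congr_ae ?_
          filter_upwards [hf2.coeFn_toLp] with x hx
          rw [enorm_mul, ← ofReal_norm (conj (F x)), Complex.norm_conj, ofReal_norm, hF, hx]
  have hsq : I ^ 2 ≤ (C * eLpNorm W p volume * ∫⁻ x, g x ^ 2) * I := by
    calc I ^ 2 ≤ (∫⁻ x, g x * (‖W x‖ₑ ^ (1 / 2 : ℝ) * ‖u x‖ₑ)) ^ 2 := by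
          refine pow_le_pow_left' (hpair.trans (lintegral_mono fun x => ?_)) 2
          calc _ ≤ ‖W x‖ₑ ^ (1 / 2 : ℝ) * g x * ‖u x‖ₑ := mul_le_mul' (hfg x) le_rfl
            _ = _ := by ring
      _ ≤ (∫⁻ x, g x ^ 2) * ∫⁻ x, (‖W x‖ₑ ^ (1 / 2 : ℝ) * ‖u x‖ₑ) ^ 2 :=
          sq_lintegral_mul_le hg ((hW.1.enorm.pow_const _).mul (Lp.aestronglyMeasurable _).enorm)
      _ = (∫⁻ x, g x ^ 2) * ∫⁻ x, ‖W x‖ₑ * ‖u x‖ₑ ^ 2 := by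
          congr 1
          refine lintegral_congr fun x => ?_
          rw [mul_pow, ← ENNReal.rpow_natCast, ← ENNReal.rpow_mul]
          norm_num
      _ ≤ (∫⁻ x, g x ^ 2) * (C * eLpNorm W p volume * I) :=
          mul_le_mul' le_rfl (hHu ▸ hCW W hW u (hHu ▸ hItop))
      _ = _ := by ring
  rcases eq_or_ne I 0 with h0 | h0
  · rw [h0]; exact zero_le
  · rw [sq] at hsq
    exact (ENNReal.mul_le_mul_iff_left h0 hItop).1 hsq

end FormBound

/-! ### Truncations -/

section Truncation

variable {E : Type*} [NormedAddCommGroup E] [InnerProductSpace ℝ E] [FiniteDimensional ℝ E]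
  [MeasurableSpace E] [BorelSpace E]

/-- The truncation of a `[0, ∞]`-valued function at height `m` and to the ball of radius `m`. It is
real-valued; `toReal` is harmless because the truncated value is at most `m`. -/
noncomputable def truncation (m : ℕ) (k : E → ℝ≥0∞) (x : E) : ℝ :=
  ((Metric.ball 0 (m : ℝ)).indicator (fun x => min (k x) m) x).toReal

lemma truncation_nonneg (m : ℕ) (k : E → ℝ≥0∞) (x : E) : 0 ≤ truncation m k x :=
  ENNReal.toReal_nonneg

lemma measurable_truncation (m : ℕ) {k : E → ℝ≥0∞} (hk : Measurable k) :
    Measurable (truncation m k) :=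
  ((hk.min measurable_const).indicator measurableSet_ball).ennreal_toReal

lemma ofReal_truncation (m : ℕ) (k : E → ℝ≥0∞) (x : E) :
    ENNReal.ofReal (truncation m k x) =
      (Metric.ball 0 (m : ℝ)).indicator (fun x => min (k x) m) x := by
  refine ENNReal.ofReal_toReal ?_
  by_cases h : x ∈ Metric.ball (0 : E) m
  · rw [Set.indicator_of_mem h]
    exact ((min_le_right _ _).trans_lt (ENNReal.natCast_lt_top m)).ne
  · rw [Set.indicator_of_notMem h]; exact ENNReal.zero_ne_top

lemma ofReal_truncation_le (m : ℕ) (k : E → ℝ≥0∞) (x : E) :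
    ENNReal.ofReal (truncation m k x) ≤ k x := by
  rw [ofReal_truncation]
  exact Set.indicator_apply_le' (fun _ => min_le_left _ _) fun _ => zero_le

lemma truncation_mono (k : E → ℝ≥0∞) (x : E) :
    Monotone fun m : ℕ => ENNReal.ofReal (truncation m k x) := by
  intro m l hml
  simp only [ofReal_truncation]
  have h1 : (m : ℝ) ≤ l := by exact_mod_cast hml
  have h2 : (m : ℝ≥0∞) ≤ l := by exact_mod_cast hml
  by_cases h : x ∈ Metric.ball (0 : E) m
  · rw [Set.indicator_of_mem h, Set.indicator_of_mem (Metric.ball_subset_ball h1 h)]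
    exact min_le_min_left _ h2
  · rw [Set.indicator_of_notMem h]; exact zero_le

lemma iSup_truncation (k : E → ℝ≥0∞) (x : E) :
    ⨆ m : ℕ, ENNReal.ofReal (truncation m k x) = k x := by
  refine le_antisymm (iSup_le fun m => ofReal_truncation_le m k x) ?_
  refine le_of_forall_lt fun c hc => ?_
  obtain ⟨n, hn⟩ := exists_nat_gt ‖x‖
  obtain ⟨l, hl⟩ := ENNReal.exists_nat_gt (ne_top_of_lt hc)
  refine lt_of_lt_of_le ?_ (le_iSup _ (max n l))
  have hx : x ∈ Metric.ball (0 : E) (max n l : ℕ) := by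
    rw [mem_ball_zero_iff]
    exact hn.trans_le (by exact_mod_cast le_max_left n l)
  rw [ofReal_truncation, Set.indicator_of_mem hx]
  exact lt_min hc (hl.trans_le (by exact_mod_cast le_max_right n l))

lemma memLp_truncation (m : ℕ) {k : E → ℝ≥0∞} (hk : Measurable k) (q : ℝ≥0∞) :
    MemLp (truncation m k) q := by
  have hb : ∀ x, ‖truncation m k x‖ ≤ m := fun x => by
    rw [Real.norm_of_nonneg (truncation_nonneg _ _ _)]
    refine ENNReal.toReal_le_of_le_ofReal (by positivity) ?_
    rw [ENNReal.ofReal_natCast]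
    exact Set.indicator_apply_le' (fun _ => min_le_right _ _) fun _ => zero_le
  have hfin : volume (Metric.ball (0 : E) m) < ⊤ := measure_ball_lt_top
  have h1 : MemLp ((Metric.ball (0 : E) m).indicator (truncation m k)) q := by
    rw [memLp_indicator_iff_restrict measurableSet_ball]
    have : IsFiniteMeasure (volume.restrict (Metric.ball (0 : E) m)) := ⟨by simpa using hfin⟩
    exact MemLp.of_bound (measurable_truncation m hk).aestronglyMeasurable m
      (Filter.Eventually.of_forall hb)
  convert h1 using 1
  ext x
  by_cases h : x ∈ Metric.ball (0 : E) m
  · rw [Set.indicator_of_mem h]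
  · rw [Set.indicator_of_notMem h, truncation, Set.indicator_of_notMem h]; simp

lemma measurable_conv {M f : E → ℝ≥0∞} (hM : Measurable M) (hf : Measurable f) :
    Measurable fun x => ∫⁻ y, M (x - y) * f y :=
  Measurable.lintegral_prod_right' (f := fun p : E × E => M (p.1 - p.2) * f p.2)
    ((hM.comp (measurable_fst.sub measurable_snd)).mul (hf.comp measurable_snd))

lemma convForm_symm {M g f : E → ℝ≥0∞} (hM : Measurable M) (hMe : ∀ x, M (-x) = M x)
    (hg : Measurable g) (hf : Measurable f) : convForm M g f = convForm M f g := by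
  unfold convForm
  have h1 : ∀ (g f : E → ℝ≥0∞), Measurable f → ∀ x, g x * ∫⁻ y, M (x - y) * f y =
      ∫⁻ y, g x * (M (x - y) * f y) := fun g f hf x =>
    (lintegral_const_mul _ ((hM.comp (measurable_id.const_sub x)).mul hf)).symm
  simp_rw [h1 g f hf, h1 f g hg]
  rw [lintegral_lintegral_swap]
  · refine lintegral_congr fun y => lintegral_congr fun x => ?_
    rw [← hMe, neg_sub]; ring
  · exact ((hg.comp measurable_fst).mul ((hM.comp (measurable_fst.sub measurable_snd)).mul
      (hf.comp measurable_snd))).aemeasurable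

lemma iSup_mul_iSup_of_monotone {a b : ℕ → ℝ≥0∞} (ha : Monotone a) (hb : Monotone b) :
    (⨆ l, a l) * (⨆ l, b l) = ⨆ l, a l * b l := by
  refine le_antisymm ?_ (iSup_le fun l => mul_le_mul' (le_iSup a l) (le_iSup b l))
  rw [ENNReal.iSup_mul]
  refine iSup_le fun i => ?_
  rw [ENNReal.mul_iSup]
  exact iSup_le fun j => (mul_le_mul' (ha (le_max_left i j)) (hb (le_max_right i j))).trans
    (le_iSup (fun l => a l * b l) (max i j))

/-- By monotone convergence, bounds on the form of a positive kernel need to be checked on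
truncated functions only. -/
lemma convForm_le_of_truncation {M k f : E → ℝ≥0∞} (hM : Measurable M) (hk : Measurable k)
    (hf : Measurable f) {X : ℝ≥0∞}
    (h : ∀ m l : ℕ, convForm M (fun x => ENNReal.ofReal (truncation m k x))
      (fun x => ENNReal.ofReal (truncation l f x)) ≤ X) : convForm M k f ≤ X := by
  have hinner : ∀ x, ∫⁻ y, M (x - y) * f y =
      ⨆ l : ℕ, ∫⁻ y, M (x - y) * ENNReal.ofReal (truncation l f y) := fun x => by
    rw [← lintegral_iSup]
    · refine lintegral_congr fun y => ?_
      rw [← ENNReal.mul_iSup, iSup_truncation]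
    · exact fun l => (hM.comp (measurable_id.const_sub x)).mul
        (measurable_truncation l hf).ennreal_ofReal
    · exact fun a b hab y => mul_le_mul' le_rfl (truncation_mono f y hab)
  have hmono : ∀ x, Monotone fun l : ℕ =>
      ∫⁻ y, M (x - y) * ENNReal.ofReal (truncation l f y) := fun x a b hab =>
    lintegral_mono fun y => mul_le_mul' le_rfl (truncation_mono f y hab)
  have houter : convForm M k f = ⨆ l : ℕ, ∫⁻ x, ENNReal.ofReal (truncation l k x) *
      ∫⁻ y, M (x - y) * ENNReal.ofReal (truncation l f y) := by
    unfold convForm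
    rw [← lintegral_iSup]
    · refine lintegral_congr fun x => ?_
      rw [hinner, ← iSup_truncation k x, iSup_mul_iSup_of_monotone
        (truncation_mono k x) (hmono x)]
    · exact fun l => (measurable_truncation l hk).ennreal_ofReal.mul
        (measurable_conv hM (measurable_truncation l hf).ennreal_ofReal)
    · exact fun a b hab x => mul_le_mul' (truncation_mono k x hab) (hmono x hab)
  rw [houter]
  exact iSup_le fun l => h l l

end Truncation

/-! ### The weighted kernel between potentials -/

section WeightedForm

/-- The weighted kernel of `exists_weighted_kernel`, sandwiched between `√|W|` and `√|W'|`, is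
bounded on `L²`, with a bound given by the `Lᵖ` norms of `W` and `W'`. -/
theorem exists_weighted_form_bound {d : ℕ} {p : ℝ≥0∞} (hp : AdmissibleExponent d p) (μ : ℝ)
    {T κ : ℝ} (hT : 0 < T) (hκ : 0 < κ) (hκc : κ < criticalRate μ T) :
    ∃ M : EuclideanSpace ℝ (Fin d) → ℝ≥0∞, Measurable M ∧
      (∀ x, ENNReal.ofReal (Real.exp (κ * ‖x‖)) * bcsKernel μ T x ≤ M x) ∧
      ∃ K : ℝ≥0∞, K ≠ ⊤ ∧ ∀ W W' : EuclideanSpace ℝ (Fin d) → ℝ, Measurable W → Measurable W' →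
        MemLp W p → MemLp W' p → ∀ g g' : EuclideanSpace ℝ (Fin d) → ℝ≥0∞,
        Measurable g → Measurable g' →
        convForm M (fun x => ‖W x‖ₑ ^ (1 / 2 : ℝ) * g x)
          (fun x => ‖W' x‖ₑ ^ (1 / 2 : ℝ) * g' x) ^ 2 ≤
          K * (eLpNorm W p volume * eLpNorm W' p volume) *
            ((∫⁻ x, g x ^ 2) * ∫⁻ x, g' x ^ 2) := by
  obtain ⟨M, hM, hMw, C, hC⟩ := exists_weighted_kernel (E := EuclideanSpace ℝ (Fin d)) μ hT hκ hκc
  obtain ⟨D, hD, hDW⟩ := exists_dual_form_bound hp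
  refine ⟨M, hM, hMw, ENNReal.ofReal C ^ 2 * D ^ 2, by finiteness,
    fun W W' hWm hWm' hW hW' g g' hg hg' => ?_⟩
  set k := fun x => ‖W x‖ₑ ^ (1 / 2 : ℝ) * g x with hk
  set k' := fun x => ‖W' x‖ₑ ^ (1 / 2 : ℝ) * g' x with hk'
  have hkm : Measurable k := (hWm.enorm.pow_const _).mul hg
  have hkm' : Measurable k' := (hWm'.enorm.pow_const _).mul hg'
  have hdual : ∀ {W : EuclideanSpace ℝ (Fin d) → ℝ} {g : EuclideanSpace ℝ (Fin d) → ℝ≥0∞},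
      Measurable W → MemLp W p → Measurable g → ∀ m : ℕ,
      ∫⁻ ξ, ENNReal.ofReal ((1 + ‖ξ‖ ^ 2)⁻¹) *
        ‖𝓕 (fun x => (truncation m (fun x => ‖W x‖ₑ ^ (1 / 2 : ℝ) * g x) x : ℂ)) ξ‖ₑ ^ 2 ≤
        D * eLpNorm W p volume * ∫⁻ x, g x ^ 2 := fun {W g} hWm hW hg m => by
    have hkm : Measurable fun x => ‖W x‖ₑ ^ (1 / 2 : ℝ) * g x := (hWm.enorm.pow_const _).mul hg
    refine hDW W hW _ (memLp_one_iff_integrable.1 (memLp_truncation m hkm 1)).ofReal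
      (memLp_truncation m hkm 2).ofReal g hg.aemeasurable fun x => ?_
    refine le_trans (le_of_eq ?_) 
      (ofReal_truncation_le m (fun x => ‖W x‖ₑ ^ (1 / 2 : ℝ) * g x) x)
    rw [← ofReal_norm]
    congr 1
    exact (Complex.norm_of_nonneg (truncation_nonneg _ _ _))
  rw [← ENNReal.rpow_natCast, ← ENNReal.le_rpow_inv_iff (by norm_num)]
  refine convForm_le_of_truncation hM hkm hkm' fun m l => ?_
  rw [ENNReal.le_rpow_inv_iff (by norm_num), ENNReal.rpow_natCast]
  have h1 := hC (truncation l k') (truncation m k) (truncation_nonneg _ _) (truncation_nonneg _ _)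
    (measurable_truncation _ hkm') (measurable_truncation _ hkm)
    (memLp_one_iff_integrable.1 (memLp_truncation l hkm' 1))
    (memLp_one_iff_integrable.1 (memLp_truncation m hkm 1))
  refine (pow_le_pow_left' h1 2).trans ?_
  rw [mul_pow]
  set a := fun ξ : EuclideanSpace ℝ (Fin d) => ‖𝓕 (fun x => (truncation m k x : ℂ)) ξ‖ₑ with ha
  set b := fun ξ : EuclideanSpace ℝ (Fin d) => ‖𝓕 (fun x => (truncation l k' x : ℂ)) ξ‖ₑ with hb
  have ham : Measurable a := (continuous_fourier
    (memLp_one_iff_integrable.1 (memLp_truncation m hkm 1)).ofReal).measurable.enorm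
  have hbm : Measurable b := (continuous_fourier
    (memLp_one_iff_integrable.1 (memLp_truncation l hkm' 1)).ofReal).measurable.enorm
  have hsq : ∀ ξ : EuclideanSpace ℝ (Fin d), ENNReal.ofReal ((1 + ‖ξ‖ ^ 2)⁻¹) =
      ENNReal.ofReal (√((1 + ‖ξ‖ ^ 2)⁻¹)) ^ 2 := fun ξ => by
    rw [← ENNReal.ofReal_pow (by positivity), Real.sq_sqrt (by positivity)]
  have hcs : (∫⁻ ξ, ENNReal.ofReal ((1 + ‖ξ‖ ^ 2)⁻¹) * (a ξ * b ξ)) ^ 2 ≤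
      (∫⁻ ξ, ENNReal.ofReal ((1 + ‖ξ‖ ^ 2)⁻¹) * a ξ ^ 2) *
        ∫⁻ ξ, ENNReal.ofReal ((1 + ‖ξ‖ ^ 2)⁻¹) * b ξ ^ 2 := by
    have := sq_lintegral_mul_le (ν := (volume : Measure (EuclideanSpace ℝ (Fin d))))
      (f := fun ξ => ENNReal.ofReal (√((1 + ‖ξ‖ ^ 2)⁻¹)) * a ξ)
      (g := fun ξ => ENNReal.ofReal (√((1 + ‖ξ‖ ^ 2)⁻¹)) * b ξ) (by fun_prop) (by fun_prop)
    simp_rw [hsq]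
    simp_rw [mul_pow] at this
    refine le_trans (le_of_eq ?_) this
    congr 1
    refine lintegral_congr fun ξ => ?_
    ring
  calc _ ≤ ENNReal.ofReal C ^ 2 * ((D * eLpNorm W p volume * ∫⁻ x, g x ^ 2) *
        (D * eLpNorm W' p volume * ∫⁻ x, g' x ^ 2)) :=
        mul_le_mul' le_rfl (hcs.trans (mul_le_mul' (hdual hWm hW hg m) (hdual hWm' hW' hg' l)))
    _ = _ := by ring

end WeightedForm

/-! ### Lower bounds of the symbol -/

section SymbolBounds

lemma tanh_le_self {v : ℝ} (hv : 0 ≤ v) : Real.tanh v ≤ v := by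
  have hmono : MonotoneOn (fun x : ℝ => x * Real.cosh x - Real.sinh x) (Set.Ici 0) := by
    refine monotoneOn_of_deriv_nonneg (convex_Ici 0) (by fun_prop) (by fun_prop) fun x hx => ?_
    have h : HasDerivAt (fun x : ℝ => x * Real.cosh x - Real.sinh x)
        (1 * Real.cosh x + x * Real.sinh x - Real.cosh x) x :=
      ((hasDerivAt_id' x).mul (Real.hasDerivAt_cosh x)).sub (Real.hasDerivAt_sinh x)
    rw [interior_Ici, Set.mem_Ioi] at hx
    rw [h.deriv]
    have := mul_nonneg hx.le (Real.sinh_nonneg_iff.2 hx.le)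
    linarith
  have h := hmono Set.self_mem_Ici hv hv
  simp only [zero_mul, Real.sinh_zero, sub_zero] at h
  rw [Real.tanh_eq_sinh_div_cosh, div_le_iff₀ (Real.cosh_pos v)]
  linarith

lemma tanh_pos {v : ℝ} (hv : 0 < v) : 0 < Real.tanh v := by
  rw [Real.tanh_eq_sinh_div_cosh]
  exact div_pos (Real.sinh_pos_iff.2 hv) (Real.cosh_pos v)

lemma symbolOfEnergy_eq_abs (μ : ℝ) {T s : ℝ} (hs : s ≠ μ) :
    symbolOfEnergy μ T s = |s - μ| / Real.tanh (|s - μ| / (2 * T)) := by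
  rw [symbolOfEnergy, if_neg hs]
  rcases abs_choice (s - μ) with h | h <;> rw [h]
  rw [neg_div (2 * T), Real.tanh_neg, neg_div_neg_eq]

lemma two_mul_le_symbolOfEnergy (μ : ℝ) {T : ℝ} (hT : 0 < T) (s : ℝ) :
    2 * T ≤ symbolOfEnergy μ T s := by
  rcases eq_or_ne s μ with h | h
  · rw [symbolOfEnergy, if_pos h]
  · have h0 : 0 < |s - μ| := abs_pos.2 (sub_ne_zero.2 h)
    rw [symbolOfEnergy_eq_abs μ h, le_div_iff₀ (tanh_pos (by positivity))]
    have := tanh_le_self (v := |s - μ| / (2 * T)) (by positivity)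
    rw [le_div_iff₀ (by positivity)] at this
    linarith

lemma abs_sub_le_symbolOfEnergy (μ : ℝ) {T : ℝ} (hT : 0 < T) (s : ℝ) :
    |s - μ| ≤ symbolOfEnergy μ T s := by
  rcases eq_or_ne s μ with h | h
  · rw [symbolOfEnergy, if_pos h, h, sub_self, abs_zero]; positivity
  · have h0 : 0 < |s - μ| := abs_pos.2 (sub_ne_zero.2 h)
    rw [symbolOfEnergy_eq_abs μ h, le_div_iff₀ (tanh_pos (by positivity))]
    exact mul_le_of_le_one_right h0.le (Real.tanh_lt_one _).le

lemma symbolOfEnergy_pos (μ : ℝ) {T : ℝ} (hT : 0 < T) (s : ℝ) : 0 < symbolOfEnergy μ T s :=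
  lt_of_lt_of_le (by positivity) (two_mul_le_symbolOfEnergy μ hT s)

lemma measurable_symbolOfEnergy (μ T : ℝ) : Measurable (symbolOfEnergy μ T) := by
  unfold symbolOfEnergy
  have h : Measurable Real.tanh := by
    rw [show Real.tanh = fun x => Real.sinh x / Real.cosh x from
      funext Real.tanh_eq_sinh_div_cosh]
    fun_prop
  refine Measurable.ite (measurableSet_singleton μ) measurable_const ?_
  exact (measurable_id.sub_const μ).div (h.comp ((measurable_id.sub_const μ).div_const _))

lemma one_add_le_symbolOfEnergy (μ : ℝ) {T : ℝ} (hT : 0 < T) (s : ℝ) :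
    1 + s ≤ ((1 + |μ|) / (2 * T) + 1) * symbolOfEnergy μ T s := by
  have h1 := two_mul_le_symbolOfEnergy μ hT s
  have h2 := abs_sub_le_symbolOfEnergy μ hT s
  have h3 : (1 + |μ|) ≤ (1 + |μ|) / (2 * T) * symbolOfEnergy μ T s := by
    rw [div_mul_eq_mul_div, le_div_iff₀ (by positivity)]
    exact mul_le_mul_of_nonneg_left h1 (by positivity)
  have h4 := le_abs_self (s - μ)
  have h5 := le_abs_self μ
  linarith

variable {d : ℕ}

lemma measurable_symbol (μ T : ℝ) :
    Measurable (symbol μ T : EuclideanSpace ℝ (Fin d) → ℝ) :=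
  (measurable_symbolOfEnergy μ T).comp (by fun_prop)

/-- The form domain of `K_T` is contained in `H¹`. -/
lemma sobolevEnergy_ne_top {μ T : ℝ} (hT : 0 < T)
    {u : Lp ℂ 2 (volume : Measure (EuclideanSpace ℝ (Fin d)))} (hu : u ∈ formDomain d μ T) :
    sobolevEnergy u ≠ ⊤ := by
  set c := (1 + |μ|) / (2 * T) + 1 with hc
  have hc0 : 0 ≤ c := by positivity
  refine ne_top_of_le_ne_top ((hu.2.const_mul c).lintegral_lt_top).ne (lintegral_mono fun ξ => ?_)
  rw [← ofReal_norm, ← ENNReal.ofReal_pow (norm_nonneg _), ← ENNReal.ofReal_mul (by positivity),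
    ← mul_assoc]
  refine ENNReal.ofReal_le_ofReal (mul_le_mul_of_nonneg_right ?_ (by positivity))
  refine le_trans ?_ (one_add_le_symbolOfEnergy μ hT ((2 * Real.pi * ‖ξ‖) ^ 2))
  rw [mul_pow]
  have : 1 ≤ (2 * Real.pi) ^ 2 := one_le_pow₀ (by linarith [Real.pi_gt_three])
  nlinarith [sq_nonneg ‖ξ‖]

end SymbolBounds

/-! ### Pointwise bounds by duality -/

section Pairing

variable {E : Type*} [NormedAddCommGroup E] [InnerProductSpace ℝ E] [FiniteDimensional ℝ E]
  [MeasurableSpace E] [BorelSpace E]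

/-- The bounded part of the set where `F < |u|`. Testing `u` against its own restriction to these
sets detects the failure of `|u| ≤ F`. -/
def excessSet (u : E → ℂ) (F : E → ℝ≥0∞) (n : ℕ) : Set E :=
  Metric.ball 0 n ∩ {x | F x < ‖u x‖ₑ}

lemma measurableSet_excessSet {u : E → ℂ} {F : E → ℝ≥0∞} (hu : Measurable u) (hF : Measurable F)
    (n : ℕ) : MeasurableSet (excessSet u F n) :=
  measurableSet_ball.inter (measurableSet_lt hF hu.enorm)

lemma integrable_excess (u : Lp ℂ 2 (volume : Measure E)) {F : E → ℝ≥0∞} (hF : Measurable F)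
    (n : ℕ) : Integrable ((excessSet u F n).indicator u) := by
  have hs := measurableSet_excessSet (Lp.stronglyMeasurable u).measurable hF n
  have hfin : volume (excessSet u F n) < ⊤ :=
    (measure_mono Set.inter_subset_left).trans_lt (measure_ball_lt_top (x := (0 : E)) (r := n))
  have : IsFiniteMeasure (volume.restrict (excessSet u F n)) := ⟨by simpa using hfin⟩
  rw [integrable_indicator_iff hs]
  exact ((Lp.memLp u).restrict _).integrable one_le_two

/-- A square-integrable function is dominated by `F` if its pairings with its restrictions to the
excess sets are. Only these test functions are used, because they inherit evenness from `u` and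
`F`. -/
lemma ae_enorm_le_of_pairing (u : Lp ℂ 2 (volume : Measure E)) {F : E → ℝ≥0∞} (hF : Measurable F)
    (h : ∀ n, ‖∫ x, conj ((excessSet u F n).indicator u x) * u x‖ₑ ≤
      ∫⁻ x, ‖(excessSet u F n).indicator u x‖ₑ * F x) : ∀ᵐ x, ‖u x‖ₑ ≤ F x := by
  have hum : Measurable u := (Lp.stronglyMeasurable u).measurable
  have hnull : ∀ n, volume (excessSet u F n) = 0 := fun n => by
    by_contra h0
    set A := excessSet u F n with hA
    have hAm : MeasurableSet A := measurableSet_excessSet hum hF n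
    have hr : ∫⁻ x, ‖A.indicator u x‖ₑ * F x = ∫⁻ x in A, ‖u x‖ₑ * F x := by
      rw [← lintegral_indicator hAm]
      refine lintegral_congr fun x => ?_
      by_cases hx : x ∈ A <;> simp [hx]
    have hsq : Integrable fun x => ‖u x‖ ^ 2 := (Lp.memLp u).integrable_norm_pow two_ne_zero
    have hl : ‖∫ x, conj (A.indicator u x) * u x‖ₑ = ∫⁻ x in A, ‖u x‖ₑ * ‖u x‖ₑ := by
      have h1 : ∫ x, conj (A.indicator u x) * u x = ((∫ x in A, ‖u x‖ ^ 2 : ℝ) : ℂ) := by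
        rw [← integral_complex_ofReal, ← integral_indicator hAm]
        refine integral_congr_ae (Filter.Eventually.of_forall fun x => ?_)
        by_cases hx : x ∈ A
        · simp [hx, Complex.conj_mul']
        · simp [hx]
      rw [h1, ← ofReal_norm, Complex.norm_of_nonneg (by positivity),
        ofReal_integral_eq_lintegral_ofReal hsq.integrableOn
          (Filter.Eventually.of_forall fun x => by positivity)]
      refine lintegral_congr fun x => ?_
      rw [ENNReal.ofReal_pow (norm_nonneg _), ofReal_norm, sq]
    have hfin : ∫⁻ x in A, ‖u x‖ₑ * F x ≠ ⊤ := by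
      refine ne_top_of_le_ne_top (hsq.lintegral_lt_top).ne ((setLIntegral_mono_ae'
        (g := fun x => ENNReal.ofReal (‖u x‖ ^ 2)) hAm
        (Filter.Eventually.of_forall fun x hx => ?_)).trans (setLIntegral_le_lintegral _ _))
      rw [ENNReal.ofReal_pow (norm_nonneg _), ofReal_norm, sq]
      exact mul_le_mul' le_rfl hx.2.le
    have hlt : ∫⁻ x in A, ‖u x‖ₑ * F x < ∫⁻ x in A, ‖u x‖ₑ * ‖u x‖ₑ := by
      refine setLIntegral_strict_mono hAm h0 (hum.enorm.mul hum.enorm) hfin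
        (Filter.Eventually.of_forall fun x hx => ?_)
      have hx' : F x < ‖u x‖ₑ := hx.2
      exact (ENNReal.mul_lt_mul_iff_right (ne_bot_of_gt hx') (by finiteness)).2 hx'
    exact absurd (h n) (by rw [hr, hl]; exact not_le.2 hlt)
  have hU : volume (⋃ n, excessSet u F n) = 0 := measure_iUnion_null hnull
  filter_upwards [measure_eq_zero_iff_ae_notMem.1 hU] with x hx
  by_contra hlt
  obtain ⟨n, hn⟩ := exists_nat_gt ‖x‖
  exact hx (Set.mem_iUnion.2 ⟨n, mem_ball_zero_iff.2 hn, not_le.1 hlt⟩)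

lemma integrable_conj_mul (u v : Lp ℂ 2 (volume : Measure E)) :
    Integrable fun x => conj (u x) * v x :=
  (L2.integrable_inner (𝕜 := ℂ) u v).congr (Filter.Eventually.of_forall fun x => by
    simp only [RCLike.inner_apply, mul_comm])

lemma const_mul_convForm (c : ℝ≥0∞) {M g f : E → ℝ≥0∞} (hM : Measurable M) (hg : Measurable g)
    (hf : Measurable f) :
    c * convForm M g f = ∫⁻ x, g x * (c * ∫⁻ y, M (x - y) * f y) := by
  rw [convForm, ← lintegral_const_mul _ (by exact hg.mul (measurable_conv hM hf))]
  exact lintegral_congr fun x => mul_left_comm _ _ _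

lemma fourier_neg_of_even {f : E → ℂ} (hf : ∀ᵐ x, f (-x) = f x) (ξ : E) : 𝓕 f (-ξ) = 𝓕 f ξ := by
  rw [← Real.fourierInv_eq_fourier_neg, Real.fourierInv_eq_fourier_comp_neg,
    Real.fourier_eq', Real.fourier_eq']
  refine integral_congr_ae ?_
  filter_upwards [hf] with x hx
  rw [hx]

lemma ae_neg {P : E → Prop} (h : ∀ᵐ x, P x) : ∀ᵐ x, P (-x) :=
  (Measure.measurePreserving_neg (volume : Measure E)).quasiMeasurePreserving.ae h

lemma convolution_even {M f : E → ℝ≥0∞} (hM : ∀ x, M (-x) = M x) (hf : ∀ᵐ x, f (-x) = f x)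
    (x : E) : ∫⁻ y, M (-x - y) * f y = ∫⁻ y, M (x - y) * f y := by
  rw [← lintegral_neg_eq_self]
  refine lintegral_congr_ae ?_
  filter_upwards [hf] with y hy
  rw [hy, ← hM, neg_sub, sub_neg_eq_add, neg_add_eq_sub, ← hM, neg_sub]

end Pairing

/-! ### The eigenvalue equation as an integral inequality -/

section TestEquation

variable {d : ℕ}

/-- `K_T⁻¹ h` lies in the form domain and is dominated by the convolution of the BCS kernel with
`|h|`. -/
theorem exists_inverse_symbol [Nonempty (Fin d)] (μ : ℝ) {T : ℝ} (hT : 0 < T) :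
    ∃ C : ℝ≥0∞, C ≠ ⊤ ∧ ∀ h : EuclideanSpace ℝ (Fin d) → ℂ, Measurable h → Integrable h →
      ∀ h2 : MemLp h 2, (∀ᵐ x, h (-x) = h x) → ∃ φ ∈ formDomain d μ T,
        (∀ᵐ ξ, (symbol μ T ξ : ℂ) * (𝓕 φ) ξ =
          (𝓕 (h2.toLp h) : Lp ℂ 2 (volume : Measure (EuclideanSpace ℝ (Fin d)))) ξ) ∧
        ∀ᵐ x, ‖φ x‖ₑ ≤ C * ∫⁻ y, bcsKernel μ T (x - y) * ‖h y‖ₑ := by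
  obtain ⟨C, hC⟩ := exists_enorm_integral_inv_symbol_le (E := EuclideanSpace ℝ (Fin d)) μ hT
  refine ⟨ENNReal.ofReal C, ENNReal.ofReal_ne_top, fun h hm h1 h2 heven => ?_⟩
  set H : Lp ℂ 2 (volume : Measure (EuclideanSpace ℝ (Fin d))) := h2.toLp h with hH
  have hKpos : ∀ ξ : EuclideanSpace ℝ (Fin d), 0 < symbol μ T ξ := fun ξ =>
    symbolOfEnergy_pos μ hT _
  have hKinv : ∀ ξ : EuclideanSpace ℝ (Fin d), ‖(((symbol μ T ξ)⁻¹ : ℝ) : ℂ)‖ ≤ (2 * T)⁻¹ :=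
    fun ξ => by
      rw [Complex.norm_of_nonneg (inv_nonneg.2 (hKpos ξ).le)]
      exact inv_anti₀ (by positivity) (two_mul_le_symbolOfEnergy μ hT _)
  have hv2 : MemLp (fun ξ => (((symbol μ T ξ)⁻¹ : ℝ) : ℂ) * (𝓕 H) ξ) 2 := by
    refine ((Lp.memLp (𝓕 H)).const_mul (((2 * T)⁻¹ : ℝ) : ℂ)).mono ?_
      (Filter.Eventually.of_forall fun ξ => ?_)
    · exact (Complex.measurable_ofReal.comp (measurable_symbol μ T).inv).aestronglyMeasurable.mul
        (Lp.aestronglyMeasurable _)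
    · rw [norm_mul, norm_mul, Complex.norm_of_nonneg (by positivity : (0 : ℝ) ≤ (2 * T)⁻¹)]
      exact mul_le_mul_of_nonneg_right (hKinv ξ) (norm_nonneg _)
  set φ : Lp ℂ 2 (volume : Measure (EuclideanSpace ℝ (Fin d))) := 𝓕⁻ (hv2.toLp _) with hφ
  have hFφ : ∀ᵐ ξ, (𝓕 φ) ξ = (((symbol μ T ξ)⁻¹ : ℝ) : ℂ) * (𝓕 H) ξ := by
    rw [hφ, FourierTransform.fourier_fourierInv_eq]; exact hv2.coeFn_toLp
  have hFH : ∀ᵐ ξ, (𝓕 H) ξ = 𝓕 h ξ := fourier_toLp_ae_eq h1 h2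
  have hφeven : ∀ᵐ x, φ (-x) = φ x := by
    refine even_of_fourier_even φ ?_
    filter_upwards [hFφ, hFH, ae_neg hFφ, ae_neg hFH] with ξ a b a' b'
    rw [a, b, a', b', fourier_neg_of_even heven]
    simp [symbol]
  refine ⟨φ, ⟨hφeven, ?_⟩, ?_, ?_⟩
  · have hi : Integrable fun ξ => (symbol μ T ξ)⁻¹ * ‖(𝓕 H) ξ‖ ^ 2 := by
      refine ((Lp.memLp (𝓕 H)).integrable_norm_pow two_ne_zero).bdd_mul (c := (2 * T)⁻¹)
        (measurable_symbol μ T).inv.aestronglyMeasurable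
        (Filter.Eventually.of_forall fun ξ => ?_)
      simpa using hKinv ξ
    refine hi.congr ?_
    filter_upwards [hFφ] with ξ hξ
    rw [hξ, norm_mul, Complex.norm_of_nonneg (inv_nonneg.2 (hKpos ξ).le)]
    have := (hKpos ξ).ne'
    field_simp
  · filter_upwards [hFφ] with ξ hξ
    rw [hξ, ← mul_assoc, ← Complex.ofReal_mul, mul_inv_cancel₀ (hKpos ξ).ne', Complex.ofReal_one,
      one_mul]
  · have hFm : Measurable fun x : EuclideanSpace ℝ (Fin d) =>
        ENNReal.ofReal C * ∫⁻ y, bcsKernel μ T (x - y) * ‖h y‖ₑ :=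
      (measurable_conv (measurable_bcsKernel μ T) hm.enorm).const_mul _
    refine ae_enorm_le_of_pairing φ hFm fun n => ?_
    set A := excessSet φ (fun x => ENNReal.ofReal C * ∫⁻ y, bcsKernel μ T (x - y) * ‖h y‖ₑ) n
      with hA
    have hφm : Measurable φ := (Lp.stronglyMeasurable φ).measurable
    have hAm : MeasurableSet A := measurableSet_excessSet hφm hFm n
    set g := A.indicator φ with hg
    have hgm : Measurable g := hφm.indicator hAm
    have hg1 : Integrable g := integrable_excess φ hFm n
    have hg2 : MemLp g 2 := (Lp.memLp φ).indicator hAm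
    set G : Lp ℂ 2 (volume : Measure (EuclideanSpace ℝ (Fin d))) := hg2.toLp g with hG
    have hFG : ∀ᵐ ξ, (𝓕 G) ξ = 𝓕 g ξ := fourier_toLp_ae_eq hg1 hg2
    have hint : Integrable fun ξ => conj (𝓕 g ξ) * 𝓕 h ξ := by
      have hi : Integrable fun ξ => conj ((𝓕 G) ξ) * (𝓕 H) ξ := integrable_conj_mul _ _
      refine hi.congr ?_
      filter_upwards [hFH, hFG] with ξ a b
      rw [a, b]
    have key := hC h g hm hgm h1 hg1 hint
    have heq : ∫ x, conj (g x) * φ x = ∫ ξ, (((symbolOfEnergy μ T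
        ((2 * Real.pi * ‖ξ‖) ^ 2))⁻¹ : ℝ) : ℂ) * (conj (𝓕 g ξ) * 𝓕 h ξ) := by
      have h3 : ∫ x, conj (g x) * φ x = ∫ x, conj (G x) * φ x := by
        refine integral_congr_ae ?_
        filter_upwards [hg2.coeFn_toLp] with x hx
        rw [hG, hx]
      rw [h3, ← integral_conj_fourier_mul]
      refine integral_congr_ae ?_
      filter_upwards [hFH, hFG, hFφ] with ξ a b c
      rw [c, a, b, mul_left_comm]
      rfl
    rw [heq]
    refine key.trans (le_of_eq ?_)
    exact const_mul_convForm _ (measurable_bcsKernel μ T) hgm.enorm hm.enorm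

/-- The pointwise form of the eigenvalue equation: `α = -K_T⁻¹ V α`, with the kernel of `K_T⁻¹`
dominated by a positive one. -/
theorem exists_enorm_eigenfunction_le [Nonempty (Fin d)] {μ T : ℝ} (hT : 0 < T)
    {V : EuclideanSpace ℝ (Fin d) → ℝ} (hV : Measurable V) (hVsym : ∀ᵐ x, V (-x) = V x)
    {α : Lp ℂ 2 (volume : Measure (EuclideanSpace ℝ (Fin d)))} (hα : IsEigenfunction μ T V 0 α) :
    ∃ C : ℝ≥0∞, C ≠ ⊤ ∧ ∀ᵐ x, ‖α x‖ₑ ≤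
      C * ∫⁻ y, bcsKernel μ T (x - y) * (‖V y‖ₑ * ‖α y‖ₑ) := by
  obtain ⟨C, hCtop, hC⟩ := exists_inverse_symbol (d := d) μ hT
  refine ⟨C, hCtop, ?_⟩
  have hM : Measurable (bcsKernel μ T : EuclideanSpace ℝ (Fin d) → ℝ≥0∞) :=
    measurable_bcsKernel μ T
  have hαm : Measurable α := (Lp.stronglyMeasurable α).measurable
  have hVα : Measurable fun y => ‖V y‖ₑ * ‖α y‖ₑ := hV.enorm.mul hαm.enorm
  have hFm : Measurable fun x : EuclideanSpace ℝ (Fin d) =>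
      C * ∫⁻ y, bcsKernel μ T (x - y) * (‖V y‖ₑ * ‖α y‖ₑ) :=
    (measurable_conv hM hVα).const_mul _
  have hαeven : ∀ᵐ x, α (-x) = α x := hα.2.1.1
  have hVαeven : ∀ᵐ y, ‖V (-y)‖ₑ * ‖α (-y)‖ₑ = ‖V y‖ₑ * ‖α y‖ₑ := by
    filter_upwards [hVsym, hαeven] with y a b
    rw [a, b]
  refine ae_enorm_le_of_pairing α hFm fun n => ?_
  set A := excessSet α (fun x => C * ∫⁻ y, bcsKernel μ T (x - y) * (‖V y‖ₑ * ‖α y‖ₑ)) n with hA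
  have hAm : MeasurableSet A := measurableSet_excessSet hαm hFm n
  set h := A.indicator α with hh
  have hhm : Measurable h := hαm.indicator hAm
  have h1 : Integrable h := integrable_excess α hFm n
  have h2 : MemLp h 2 := (Lp.memLp α).indicator hAm
  have heven : ∀ᵐ x, h (-x) = h x := by
    filter_upwards [hαeven] with x hx
    have hmem : -x ∈ A ↔ x ∈ A := by
      simp only [hA, excessSet, Set.mem_inter_iff, mem_ball_zero_iff, norm_neg,
        Set.mem_ofPred_eq, hx, 
        convolution_even (f := fun y => ‖V y‖ₑ * ‖α y‖ₑ) (bcsKernel_neg μ T) hVαeven]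
    by_cases hxA : x ∈ A
    · rw [hh, Set.indicator_of_mem hxA, Set.indicator_of_mem (hmem.2 hxA), hx]
    · rw [hh, Set.indicator_of_notMem hxA, Set.indicator_of_notMem (mt hmem.1 hxA)]
  obtain ⟨φ, hφ, hφK, hφle⟩ := hC h hhm h1 h2 heven
  have hform := hα.2.2.2 φ hφ
  rw [Complex.ofReal_zero, zero_smul, inner_zero_right, form] at hform
  -- The symbol cancels against the one in the test function `φ = K_T⁻¹ h`.
  have hkin : ∫ ξ, (symbol μ T ξ : ℂ) * (conj ((𝓕 φ) ξ) * (𝓕 α) ξ) =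
      ∫ x, conj (h x) * α x := by
    have h3 : ∫ x, conj (h x) * α x = ∫ x, conj ((h2.toLp h) x) * α x := by
      refine integral_congr_ae ?_
      filter_upwards [h2.coeFn_toLp] with x hx
      rw [hx]
    rw [h3, ← integral_conj_fourier_mul]
    refine integral_congr_ae ?_
    filter_upwards [hφK] with ξ hξ
    rw [← hξ, map_mul, Complex.conj_ofReal, mul_assoc]
  rw [hkin, add_eq_zero_iff_eq_neg] at hform
  rw [hform, enorm_neg]
  calc _ ≤ ∫⁻ x, ‖(V x : ℂ) * (conj (φ x) * α x)‖ₑ := enorm_integral_le_lintegral_enorm _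
    _ ≤ ∫⁻ x, (‖V x‖ₑ * ‖α x‖ₑ) * (C * ∫⁻ y, bcsKernel μ T (x - y) * ‖h y‖ₑ) := by
        refine lintegral_mono_ae ?_
        filter_upwards [hφle] with x hx
        rw [enorm_mul, enorm_mul, ← ofReal_norm (V x : ℂ), ← ofReal_norm (conj (φ x)),
          Complex.norm_conj, Complex.norm_real, ofReal_norm, ofReal_norm, mul_left_comm, mul_comm]
        exact mul_le_mul' le_rfl hx
    _ = C * convForm (bcsKernel μ T) (fun x => ‖V x‖ₑ * ‖α x‖ₑ) (fun x => ‖h x‖ₑ) :=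
        (const_mul_convForm C hM hVα hhm.enorm).symm
    _ = C * convForm (bcsKernel μ T) (fun x => ‖h x‖ₑ) (fun x => ‖V x‖ₑ * ‖α x‖ₑ) := by
        rw [convForm_symm hM (bcsKernel_neg μ T) hVα hhm.enorm]
    _ = _ := const_mul_convForm C hM hhm.enorm hVα

end TestEquation

/-! ### Bounded weights and absorption -/

section Absorption

variable {E : Type*} [NormedAddCommGroup E] [InnerProductSpace ℝ E] [FiniteDimensional ℝ E]
  [MeasurableSpace E] [BorelSpace E]

lemma convForm_add_right {M g f f' : E → ℝ≥0∞} (hM : Measurable M) (hg : Measurable g)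
    (hf : Measurable f) :
    convForm M g (fun x => f x + f' x) = convForm M g f + convForm M g f' := by
  unfold convForm
  rw [← lintegral_add_left (by exact hg.mul (measurable_conv hM hf))]
  refine lintegral_congr fun x => ?_
  rw [← mul_add, ← lintegral_add_left
    (by exact (hM.comp (measurable_id.const_sub x)).mul hf)]
  simp_rw [mul_add]

/-- An `Lᵖ` function with `p < ∞` has small norm outside of a large ball. -/
lemma tendsto_eLpNorm_tail {p : ℝ≥0∞} (hp0 : p ≠ 0) (hp : p ≠ ⊤) {V : E → ℝ} (hV : MemLp V p) :
    Filter.Tendsto (fun n : ℕ => eLpNorm ((Metric.closedBall (0 : E) n)ᶜ.indicator V) p)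
      Filter.atTop (nhds 0) := by
  have hpp : 0 < p.toReal := ENNReal.toReal_pos hp0 hp
  have h1 : Filter.Tendsto (fun n : ℕ =>
      ∫⁻ x, ‖(Metric.closedBall (0 : E) n)ᶜ.indicator V x‖ₑ ^ p.toReal) Filter.atTop
      (nhds (∫⁻ _ : E, 0)) := by
    refine tendsto_lintegral_of_dominated_convergence' (fun x => ‖V x‖ₑ ^ p.toReal)
      (fun n => ?_) (fun n => Filter.Eventually.of_forall fun x => ?_) ?_
      (Filter.Eventually.of_forall fun x => ?_)
    · exact ((hV.1.indicator measurableSet_closedBall.compl).enorm.pow_const _)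
    · exact ENNReal.rpow_le_rpow (enorm_indicator_le_enorm_self _ _) hpp.le
    · exact ((eLpNorm_lt_top_iff_lintegral_rpow_enorm_lt_top hp0 hp).1 hV.2).ne
    · refine tendsto_const_nhds.congr' ?_
      obtain ⟨m, hm⟩ := exists_nat_ge ‖x‖
      filter_upwards [Filter.eventually_ge_atTop m] with n hn
      have hx : x ∈ Metric.closedBall (0 : E) n :=
        mem_closedBall_zero_iff.2 (hm.trans (by exact_mod_cast hn))
      rw [Set.indicator_of_notMem (by simpa using hx)]
      simp [hpp]
  rw [lintegral_zero] at h1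
  simp_rw [eLpNorm_eq_lintegral_rpow_enorm_toReal hp0 hp]
  have h2 := h1.ennrpow_const (1 / p.toReal)
  rwa [ENNReal.zero_rpow_of_pos (by positivity)] at h2

/-- A bounded exponential weight; it grows at most like `exp (κ ‖x - y‖)` from `y` to `x`. -/
noncomputable def cappedWeight (κ : ℝ) (n : ℕ) (x : E) : ℝ≥0∞ :=
  ENNReal.ofReal (Real.exp (κ * min ‖x‖ n))

lemma measurable_cappedWeight (κ : ℝ) (n : ℕ) :
    Measurable (cappedWeight κ n : E → ℝ≥0∞) := by
  unfold cappedWeight; fun_prop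

lemma cappedWeight_le_mul {κ : ℝ} (hκ : 0 ≤ κ) (n : ℕ) (x y : E) :
    cappedWeight κ n x ≤ ENNReal.ofReal (Real.exp (κ * ‖x - y‖)) * cappedWeight κ n y := by
  unfold cappedWeight
  rw [← ENNReal.ofReal_mul (Real.exp_pos _).le, ← Real.exp_add, ← mul_add]
  refine ENNReal.ofReal_le_ofReal (Real.exp_le_exp.2 (mul_le_mul_of_nonneg_left ?_ hκ))
  have h := norm_le_norm_sub_add x y
  rw [← min_add_add_left]
  exact le_min ((min_le_left _ _).trans h)
    ((min_le_right _ _).trans (le_add_of_nonneg_left (norm_nonneg _)))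

lemma cappedWeight_le_of_norm_le {κ : ℝ} (hκ : 0 ≤ κ) (n : ℕ) {x : E} {R : ℝ} (hx : ‖x‖ ≤ R) :
    cappedWeight κ n x ≤ ENNReal.ofReal (Real.exp (κ * R)) :=
  ENNReal.ofReal_le_ofReal (Real.exp_le_exp.2
    (mul_le_mul_of_nonneg_left ((min_le_left _ _).trans hx) hκ))

lemma cappedWeight_le {κ : ℝ} (hκ : 0 ≤ κ) (n : ℕ) (x : E) :
    cappedWeight κ n x ≤ ENNReal.ofReal (Real.exp (κ * n)) :=
  ENNReal.ofReal_le_ofReal (Real.exp_le_exp.2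
    (mul_le_mul_of_nonneg_left (min_le_right _ _) hκ))

lemma monotone_cappedWeight {κ : ℝ} (hκ : 0 ≤ κ) (x : E) :
    Monotone fun n => cappedWeight κ n x := fun a b hab =>
  ENNReal.ofReal_le_ofReal (Real.exp_le_exp.2 (mul_le_mul_of_nonneg_left
    (min_le_min_left _ (by exact_mod_cast hab)) hκ))

/-- Absorption of a term with a small coefficient; finiteness of `X` is essential. -/
lemma le_two_mul_of_sq_le {X a D : ℝ≥0∞} (hX : X ≠ ⊤) (ha : a ≤ 1 / 2)
    (h : X ^ 2 ≤ a * X ^ 2 + D * X) : X ≤ 2 * D := by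
  rcases eq_or_ne X 0 with h0 | h0
  · rw [h0]; exact zero_le
  rcases eq_or_ne D ⊤ with hD | hD
  · rw [hD, ENNReal.mul_top two_ne_zero]; exact le_top
  have h1 : X * X ≤ (1 / 2 * X + D) * X := by
    calc X * X = X ^ 2 := (sq X).symm
      _ ≤ 1 / 2 * X ^ 2 + D * X := h.trans (add_le_add (mul_le_mul' ha le_rfl) le_rfl)
      _ = _ := by ring
  have h2 : X ≤ 1 / 2 * X + D := (ENNReal.mul_le_mul_iff_left h0 hX).1 h1
  have h3 : 1 / 2 * X + 1 / 2 * X = X := by rw [← add_mul, ENNReal.add_halves, one_mul]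
  have h4 : 1 / 2 * X ≤ D := by
    have : 1 / 2 * X + 1 / 2 * X ≤ 1 / 2 * X + D := h3.le.trans h2
    exact (ENNReal.add_le_add_iff_left (by finiteness)).1 this
  calc X = 2 * (1 / 2 * X) := by rw [two_mul, h3]
    _ ≤ 2 * D := mul_le_mul' le_rfl h4

lemma add_sq_le_four_mul (P Q : ℝ≥0∞) : (P + Q) ^ 2 ≤ 4 * (P ^ 2 + Q ^ 2) := by
  rcases le_total P Q with h | h
  · calc (P + Q) ^ 2 ≤ (Q + Q) ^ 2 := pow_le_pow_left' (add_le_add h le_rfl) 2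
      _ = 4 * Q ^ 2 := by ring
      _ ≤ _ := mul_le_mul' le_rfl le_add_self
  · calc (P + Q) ^ 2 ≤ (P + P) ^ 2 := pow_le_pow_left' (add_le_add le_rfl h) 2
      _ = 4 * P ^ 2 := by ring
      _ ≤ _ := mul_le_mul' le_rfl le_self_add

end Absorption

/-! ### Exponential decay of the eigenfunction -/

section Decay

variable {d : ℕ} {p : ℝ≥0∞}

lemma AdmissibleExponent.ne_zero (hp : AdmissibleExponent d p) : p ≠ 0 := by
  rcases hp with ⟨-, rfl⟩ | ⟨-, h, -⟩ | ⟨-, rfl⟩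
  · exact one_ne_zero
  · exact (zero_lt_one.trans h).ne'
  · exact (ENNReal.div_pos (by norm_num) (by norm_num)).ne'

lemma AdmissibleExponent.ne_top (hp : AdmissibleExponent d p) : p ≠ ⊤ := by
  rcases hp with ⟨-, rfl⟩ | ⟨-, -, h⟩ | ⟨-, rfl⟩
  · exact ENNReal.one_ne_top
  · exact h.ne
  · exact ENNReal.div_ne_top (by norm_num) (by norm_num)

lemma AdmissibleExponent.nonempty (hp : AdmissibleExponent d p) : Nonempty (Fin d) := by
  rcases hp with ⟨rfl, -⟩ | ⟨rfl, -⟩ | ⟨rfl, -⟩ <;> exact ⟨0⟩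

lemma enorm_rpow_half_sq (v : ℝ) : (‖v‖ₑ ^ (1 / 2 : ℝ)) ^ 2 = ‖v‖ₑ := by
  rw [← ENNReal.rpow_natCast, ← ENNReal.rpow_mul]; norm_num

/-- Exponential decay of `√|V| α`. The part of the weighted function far from the origin is
absorbed, because `V` has a small `Lᵖ` norm there; in a ball the weight is bounded. -/
theorem lintegral_weighted_ne_top (hp : AdmissibleExponent d p) {μ T κ : ℝ} (hT : 0 < T)
    (hκ : 0 < κ) (hκc : κ < criticalRate μ T) {V : EuclideanSpace ℝ (Fin d) → ℝ}
    (hVm : Measurable V) (hV : MemLp V p) (hVsym : ∀ᵐ x, V (-x) = V x)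
    {α : Lp ℂ 2 (volume : Measure (EuclideanSpace ℝ (Fin d)))} (hα : IsEigenfunction μ T V 0 α) :
    ∫⁻ x, (ENNReal.ofReal (Real.exp (κ * ‖x‖)) * (‖V x‖ₑ ^ (1 / 2 : ℝ) * ‖α x‖ₑ)) ^ 2 ≠ ⊤ := by
  have : Nonempty (Fin d) := hp.nonempty
  obtain ⟨M, hM, hMw, K, hK, hKb⟩ := exists_weighted_form_bound hp μ hT hκ hκc
  obtain ⟨C, hC, hCα⟩ := exists_enorm_eigenfunction_le hT hVm hVsym hα
  obtain ⟨D, hD, hDb⟩ := exists_form_bound hp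
  set s : EuclideanSpace ℝ (Fin d) → ℝ≥0∞ := fun x => ‖V x‖ₑ ^ (1 / 2 : ℝ) with hs
  set b : EuclideanSpace ℝ (Fin d) → ℝ≥0∞ := fun x => s x * ‖α x‖ₑ with hb
  have hαm : Measurable α := (Lp.stronglyMeasurable α).measurable
  have hsm : Measurable s := hVm.enorm.pow_const _
  have hbm : Measurable b := hsm.mul hαm.enorm
  set B := ∫⁻ x, b x ^ 2 with hBdef
  set N := eLpNorm V p volume with hN
  have hNtop : N ≠ ⊤ := hV.2.ne
  have hB : B ≠ ⊤ := by
    have hsob := sobolevEnergy_ne_top hT hα.2.1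
    refine ne_top_of_le_ne_top (ENNReal.mul_ne_top (ENNReal.mul_ne_top hD hNtop) hsob)
      (le_trans (le_of_eq ?_) (hDb V hV α hsob))
    refine lintegral_congr fun x => ?_
    rw [hb, hs]
    simp only
    rw [mul_pow, enorm_rpow_half_sq]
  -- The weighted equation: the weight moves from `x` to `y` at the cost of `exp (κ ‖x - y‖)`, which
  -- `M` contains.
  have hpt : ∀ n, ∀ᵐ x, cappedWeight κ n x * b x ≤
      s x * (C * ∫⁻ y, M (x - y) * (s y * (cappedWeight κ n y * b y))) := fun n => by
    filter_upwards [hCα] with x hx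
    calc cappedWeight κ n x * b x = s x * (cappedWeight κ n x * ‖α x‖ₑ) := by rw [hb]; ring
      _ ≤ s x * (cappedWeight κ n x *
          (C * ∫⁻ y, bcsKernel μ T (x - y) * (‖V y‖ₑ * ‖α y‖ₑ))) :=
          mul_le_mul' le_rfl (mul_le_mul' le_rfl hx)
      _ = s x * (C * ∫⁻ y, cappedWeight κ n x *
          (bcsKernel μ T (x - y) * (‖V y‖ₑ * ‖α y‖ₑ))) := by
          rw [lintegral_const_mul _ (by
            exact ((measurable_bcsKernel μ T).comp (measurable_id.const_sub x)).mul
              (hVm.enorm.mul hαm.enorm))]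
          ring
      _ ≤ _ := by
          refine mul_le_mul' le_rfl (mul_le_mul' le_rfl (lintegral_mono fun y => ?_))
          calc cappedWeight κ n x * (bcsKernel μ T (x - y) * (‖V y‖ₑ * ‖α y‖ₑ))
              ≤ (ENNReal.ofReal (Real.exp (κ * ‖x - y‖)) * cappedWeight κ n y) *
                (bcsKernel μ T (x - y) * (‖V y‖ₑ * ‖α y‖ₑ)) :=
                mul_le_mul' (cappedWeight_le_mul hκ.le n x y) le_rfl
            _ = (ENNReal.ofReal (Real.exp (κ * ‖x - y‖)) * bcsKernel μ T (x - y)) *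
                (s y * (cappedWeight κ n y * b y)) := by
                rw [hb, hs, ← enorm_rpow_half_sq (V y)]; ring
            _ ≤ _ := mul_le_mul' (hMw _) le_rfl
  -- `R` makes the coefficient of the absorbed term at most `1 / 2`.
  obtain ⟨R, hR⟩ : ∃ R : ℕ, 4 * C ^ 2 * K *
      eLpNorm ((Metric.closedBall (0 : EuclideanSpace ℝ (Fin d)) R)ᶜ.indicator V) p ^ 2
        ≤ 1 / 2 := by
    have h1 := tendsto_eLpNorm_tail hp.ne_zero hp.ne_top hV
    have h2 := ENNReal.Tendsto.const_mul (a := 4 * C ^ 2 * K) (ENNReal.Tendsto.pow (n := 2) h1)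
      (Or.inr (by finiteness))
    rw [zero_pow two_ne_zero, mul_zero] at h2
    exact ((h2.eventually_lt_const (u := 1 / 2) (by norm_num)).exists).imp fun _ h => h.le
  set S := (Metric.closedBall (0 : EuclideanSpace ℝ (Fin d)) R)ᶜ with hS
  have hSm : MeasurableSet S := measurableSet_closedBall.compl
  set ε := eLpNorm (S.indicator V) p volume with hε
  have hεN : ε ≤ N := eLpNorm_indicator_le _
  set Y := ENNReal.ofReal (Real.exp (κ * R)) ^ 2 * B with hY
  have hYtop : Y ≠ ⊤ := by finiteness
  have hbound : ∀ n, ∫⁻ x, (cappedWeight κ n x * b x) ^ 2 ≤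
      2 * (4 * C ^ 2 * K * (N * N) * Y) + Y := fun n => by
    set w : EuclideanSpace ℝ (Fin d) → ℝ≥0∞ := fun x => cappedWeight κ n x * b x with hw
    have hwm : Measurable w := (measurable_cappedWeight κ n).mul hbm
    set f := S.indicator w with hf
    set k := Sᶜ.indicator w with hk
    have hfm : Measurable f := hwm.indicator hSm
    have hkm : Measurable k := hwm.indicator hSm.compl
    have hkY : ∫⁻ x, k x ^ 2 ≤ Y := by
      rw [hY, hBdef, ← lintegral_const_mul _ (hbm.pow_const 2)]
      refine lintegral_mono fun x => ?_
      by_cases hx : x ∈ Sᶜ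
      · rw [hk, Set.indicator_of_mem hx, hw, ← mul_pow]
        refine pow_le_pow_left' (mul_le_mul' (cappedWeight_le_of_norm_le hκ.le n ?_) le_rfl) 2
        simpa [hS] using hx
      · rw [hk, Set.indicator_of_notMem hx, zero_pow two_ne_zero]; exact zero_le
    have hwsq : ∫⁻ x, w x ^ 2 = (∫⁻ x, f x ^ 2) + ∫⁻ x, k x ^ 2 := by
      rw [← lintegral_add_left (hfm.pow_const 2)]
      refine lintegral_congr fun x => ?_
      by_cases hx : x ∈ S <;> simp [hf, hk, hx]
    have hfX : ∫⁻ x, f x ^ 2 ≠ ⊤ := by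
      refine ne_top_of_le_ne_top (b := ENNReal.ofReal (Real.exp (κ * n)) ^ 2 * B)
        (by finiteness) ?_
      rw [hBdef, ← lintegral_const_mul _ (hbm.pow_const 2)]
      refine lintegral_mono fun x => ?_
      rw [← mul_pow]
      refine pow_le_pow_left' ((Set.indicator_le_self S w x).trans ?_) 2
      exact mul_le_mul' (cappedWeight_le hκ.le n x) le_rfl
    set X := ∫⁻ x, f x ^ 2 with hX
    set F : EuclideanSpace ℝ (Fin d) → ℝ≥0∞ :=
      fun x => ‖S.indicator V x‖ₑ ^ (1 / 2 : ℝ) * f x with hF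
    have hVS : Measurable (S.indicator V) := hVm.indicator hSm
    have hVS' : MemLp (S.indicator V) p := hV.indicator hSm
    have hFm : Measurable F := (hVS.enorm.pow_const _).mul hfm
    have hFs : ∀ x, F x = s x * f x := fun x => by
      by_cases hx : x ∈ S <;> simp [hF, hf, hs, hx]
    have hsplit : ∀ y, s y * w y = F y + s y * k y := fun y => by
      rw [hFs]
      by_cases hy : y ∈ S <;> simp [hf, hk, hy]
    have hP := hKb _ _ hVS hVS hVS' hVS' f f hfm hfm
    have hQ := hKb _ _ hVS hVm hVS' hV f k hfm hkm
    have hXle : X ≤ C * (convForm M F F + convForm M F fun y => s y * k y) := by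
      rw [← convForm_add_right hM hFm hFm, const_mul_convForm C hM hFm
        (by exact hFm.add (hsm.mul hkm))]
      refine lintegral_mono_ae ?_
      filter_upwards [hpt n] with x hx
      rw [hFs, sq]
      by_cases hxS : x ∈ S
      · have hfw : f x = w x := Set.indicator_of_mem hxS w
        simp_rw [← hsplit]
        calc f x * f x ≤ f x * (s x * (C * ∫⁻ y, M (x - y) * (s y * w y))) :=
              mul_le_mul' le_rfl (hfw ▸ hx)
          _ = _ := by ring
      · have hf0 : f x = 0 := Set.indicator_of_notMem hxS w
        simp [hf0]
    -- Squares avoid square roots of the potentials' norms.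
    have hXsq : X ^ 2 ≤ 4 * C ^ 2 * K * ε ^ 2 * X ^ 2 + 4 * C ^ 2 * K * (N * N) * Y * X := by
      calc X ^ 2 ≤ (C * (convForm M F F + convForm M F fun y => s y * k y)) ^ 2 :=
            pow_le_pow_left' hXle 2
        _ ≤ C ^ 2 * (4 * (convForm M F F ^ 2 + (convForm M F fun y => s y * k y) ^ 2)) := by
            rw [mul_pow]; exact mul_le_mul' le_rfl (add_sq_le_four_mul _ _)
        _ ≤ C ^ 2 * (4 * (K * (ε * ε) * (X * X) + K * (N * N) * (X * Y))) := by
            refine mul_le_mul' le_rfl (mul_le_mul' le_rfl (add_le_add hP (hQ.trans ?_)))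
            exact mul_le_mul' (mul_le_mul' le_rfl (mul_le_mul' hεN le_rfl))
              (mul_le_mul' le_rfl hkY)
        _ = _ := by ring
    rw [hwsq]
    exact add_le_add (le_two_mul_of_sq_le hfX hR hXsq) hkY
  refine ne_top_of_le_ne_top (b := 2 * (4 * C ^ 2 * K * (N * N) * Y) + Y) (by finiteness) ?_
  calc _ ≤ ∫⁻ x, ⨆ n : ℕ, (cappedWeight κ n x * b x) ^ 2 := by
        refine lintegral_mono fun x => ?_
        obtain ⟨n, hn⟩ := exists_nat_ge ‖x‖
        refine le_trans (le_of_eq ?_) (le_iSup _ n)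
        rw [cappedWeight, min_eq_left hn]
    _ = ⨆ n : ℕ, ∫⁻ x, (cappedWeight κ n x * b x) ^ 2 := by
        refine lintegral_iSup
          (fun n => ((measurable_cappedWeight κ n).mul hbm).pow_const 2) fun m n hmn x => ?_
        exact pow_le_pow_left' (mul_le_mul' (monotone_cappedWeight hκ.le x hmn) le_rfl) 2
    _ ≤ _ := iSup_le hbound

/-- The form sees the potential up to null sets only. -/
lemma IsEigenfunction.congr {μ T c : ℝ} {V V' : EuclideanSpace ℝ (Fin d) → ℝ}
    {α : Lp ℂ 2 (volume : Measure (EuclideanSpace ℝ (Fin d)))} (hα : IsEigenfunction μ T V c α)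
    (h : V =ᵐ[volume] V') : IsEigenfunction μ T V' c α := by
  refine ⟨hα.1, hα.2.1, hα.2.2.1, fun φ hφ => ?_⟩
  rw [← hα.2.2.2 φ hφ, form, form]
  congr 1
  refine integral_congr_ae ?_
  filter_upwards [h] with x hx
  rw [hx]

lemma enorm_weighted (a v : ℝ) (z : ℂ) :
    ‖((Real.exp a * √|v| : ℝ) : ℂ) * z‖ₑ =
      ENNReal.ofReal (Real.exp a) * (‖v‖ₑ ^ (1 / 2 : ℝ) * ‖z‖ₑ) := by
  rw [enorm_mul, ← ofReal_norm (_ : ℂ), Complex.norm_of_nonneg (by positivity),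
    ENNReal.ofReal_mul (Real.exp_pos _).le, mul_assoc, Real.sqrt_eq_rpow,
    ← ENNReal.ofReal_rpow_of_nonneg (abs_nonneg v) (by norm_num), ← Real.norm_eq_abs,
    ofReal_norm]

theorem memLp_weighted (hp : AdmissibleExponent d p) {μ T κ : ℝ} (hT : 0 < T)
    (hκ : 0 < κ) (hκc : κ < criticalRate μ T) {V : EuclideanSpace ℝ (Fin d) → ℝ}
    (hV : MemLp V p) (hVsym : ∀ᵐ x, V (-x) = V x)
    {α : Lp ℂ 2 (volume : Measure (EuclideanSpace ℝ (Fin d)))} (hα : IsEigenfunction μ T V 0 α) :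
    MemLp (fun x => ((Real.exp (κ * ‖x‖) * √|V x| : ℝ) : ℂ) * α x) 2 := by
  set V' := hV.1.mk V with hV'
  have hVV' : V =ᵐ[volume] V' := hV.1.ae_eq_mk
  have hV'm : Measurable V' := hV.1.stronglyMeasurable_mk.measurable
  have hV'sym : ∀ᵐ x, V' (-x) = V' x := by
    filter_upwards [hVsym, hVV', ae_neg hVV'] with x h1 h2 h3
    rw [← h2, ← h3, h1]
  have key := lintegral_weighted_ne_top hp hT hκ hκc hV'm (hV.ae_eq hVV') hV'sym
    (hα.congr hVV')
  have hmem : MemLp (fun x => ((Real.exp (κ * ‖x‖) * √|V' x| : ℝ) : ℂ) * α x) 2 := by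
    refine ⟨(Measurable.aestronglyMeasurable (by fun_prop)).mul (Lp.aestronglyMeasurable α), ?_⟩
    rw [eLpNorm_lt_top_iff_lintegral_rpow_enorm_lt_top two_ne_zero ENNReal.ofNat_ne_top]
    simp_rw [enorm_weighted, ENNReal.toReal_ofNat, ENNReal.rpow_ofNat]
    exact key.lt_top
  refine hmem.ae_eq ?_
  filter_upwards [hVV'] with x hx
  rw [hx]

end Decay

end BCS

theorem proposition1 {d : ℕ} {p : ℝ≥0∞} (hp : BCS.AdmissibleExponent d p)
    (μ Tc : ℝ) (V : EuclideanSpace ℝ (Fin d) → ℝ) (hV : MemLp V p volume)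
    (hVsym : ∀ᵐ x, V (-x) = V x)
    (hTc : BCS.IsCriticalTemperature μ V Tc)
    (hnd : BCS.IsNondegenerate μ Tc V 0)
    (α₀ : Lp ℂ 2 (volume : Measure (EuclideanSpace ℝ (Fin d))))
    (hα₀ : BCS.IsEigenfunction μ Tc V 0 α₀)
    (κ : ℝ) (hκ : κ < BCS.criticalRate μ Tc) :
    MemLp (fun x => ((Real.exp (κ * ‖x‖) * Real.sqrt |V x| : ℝ) : ℂ) * α₀ x) 2 volume := by
  have hpos := BCS.criticalRate_pos (μ := μ) hTc.1
  -- A larger rate gives a stronger claim, so the rate may be taken to be positive.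
  have h := BCS.memLp_weighted hp (κ := max κ (BCS.criticalRate μ Tc / 2)) hTc.1
    (lt_max_of_lt_right (by linarith)) (max_lt hκ (by linarith)) hV hVsym hα₀
  have hVm : AEMeasurable V := hV.1.aemeasurable
  refine h.mono ((AEMeasurable.aestronglyMeasurable ?_).mul (Lp.aestronglyMeasurable α₀))
    (Filter.Eventually.of_forall fun x => ?_)
  · fun_prop
  · rw [norm_mul, norm_mul, Complex.norm_of_nonneg (by positivity),
      Complex.norm_of_nonneg (by positivity)]
    gcongr
    exact le_max_left _ _
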